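/- Let $M$ be a smooth 7-manifold (Hausdorff, second countable, without boundary) with a smooth closed 3-form $\lambda$ that on each tangent space $T_pM$ is linearly equivalent to the form $([a,b],c)$ on the imaginary Cayley numbers $\operatorname{Im}\mathbb O$, where $[a,b]=ab-ba$ and $(x,y)=\operatorname{Re}(x\bar y)$ (in particular, $M$ may be any $G_2$-manifold with its $G_2$-form $\lambda$). Let $\tilde X$ be the set of smooth immersed loops $\gamma:S^1\to M$ for which there is a finite set $A\subset S^1$ such that $\gamma$ restricts to an embedding of $S^1\setminus A$ and, for any two distinct points $x_1,x_2\in A$ with $\gamma(x_1)=\gamma(x_2)$, the branches of $\gamma$ at $x_1$ and $x_2$ have tangency of at most finite order. Let $\tilde Y=\tilde X/\mathrm{Diff}^+(S^1)$ be the space of unparametrized loops, with the smooth structure induced by that of $C^\infty(S^1,M)$: the smooth curves in $\tilde Y$ are those that lift locally to smooth maps $\mathbb R\times S^1\to M$, and charts are diffeomorphisms with respect to smooth curves, defined on open subsets of Fréchet spaces. The tangent space $T_{[\gamma]}\tilde Y$ is the Fréchet space $\Gamma(N_\gamma)$ of smooth sections of the normal bundle $N_\gamma=\gamma^*TM/\mathbb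 R\dot\gamma$, and the transgressed 2-form $\omega=T(\lambda)$ on $\tilde Y$ is $$\omega_\gamma(x,y)=\oint_\gamma\lambda(\dot\gamma,x,y)\,dt .$$ A subspace of $T_{[\gamma]}\tilde Y$ is called Lagrangian if it equals its own $\omega_\gamma$-orthogonal. Let $\Sigma$ be a smooth 4-manifold (Hausdorff, second countable, without boundary) and $f:\Sigma\to M$ an immersion with $f^*\lambda=0$. Then the set $L(\Sigma)$ of loops contained in $\Sigma$ is a Lagrangian submanifold of $\tilde Y$, immersed or embedded according to $\Sigma$. Precisely: 1. Let $\mathcal L(f)$ be the space of smooth loops $\delta:S^1\to\Sigma$ with $f\circ\delta\in\tilde X$, modulo $\mathrm{Diff}^+(S^1)$. The map $\mathcal L(f)\to\tilde Y$, $[\delta]\mapsto[f\circ\delta]$, is a Lagrangian immersion: for every $[\delta]\in\mathcal L(f)$ the image $F\subset T_{[f\circ\delta]}\tilde Y=\Gamma(N_{f\circ\delta})$ of its differential at $[\delta]$ is a closed complemented Lagrangian subspace, and there are charts of $\mathcal L(f)$ around $[\delta]$, modelled on $F$, and of $\tilde Y$ around $[f\circ\delta]$, modelled on $\Gamma(N_{f\circ\delta})$,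 in which the map is the inclusion of $F$. 2. If $f$ is an embedding, then $L(\Sigma)=\{[\gamma]\in\tilde Y:\gamma(S^1)\subset f(\Sigma)\}$ is an embedded Lagrangian submanifold of $\tilde Y$: for every $[\gamma]\in L(\Sigma)$ the set $F$ of velocities at $[\gamma]$ of smooth curves in $L(\Sigma)$ is a closed complemented Lagrangian subspace of $T_{[\gamma]}\tilde Y=\Gamma(N_\gamma)$, and there is a chart of $\tilde Y$ around $[\gamma]$, modelled on $\Gamma(N_\gamma)$, in which $L(\Sigma)$ corresponds to $F$. -/

import Mathlib

open Set Filter Topology Manifold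
open scoped ContDiff Quaternion

noncomputable section

/-! ### Cayley numbers and forms of type `G₂` -/

/-- Multiplication of the Cayley numbers `𝕆 = ℍ ⊕ ℍ` (Cayley–Dickson doubling). -/
def cayleyMul (x y : ℍ[ℝ] × ℍ[ℝ]) : ℍ[ℝ] × ℍ[ℝ] :=
  (x.1 * y.1 - star y.2 * x.2, y.2 * x.1 + x.2 * star y.1)

/-- The canonical anti-involution of the Cayley numbers. -/
def cayleyConj (x : ℍ[ℝ] × ℍ[ℝ]) : ℍ[ℝ] × ℍ[ℝ] :=
  (star x.1, -x.2)

/-- The dot product `(x, y) = tr (x * ȳ)` of the Cayley numbers. -/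
def cayleyDot (x y : ℍ[ℝ] × ℍ[ℝ]) : ℝ :=
  (cayleyMul x (cayleyConj y)).1.re

/-- The imaginary Cayley numbers: those `x` with `x̄ = -x`. -/
def imCayley : Submodule ℝ (ℍ[ℝ] × ℍ[ℝ]) where
  carrier := {x | cayleyConj x = -x}
  add_mem' {x y} hx hy := by
    simp only [Set.mem_ofPred_eq, cayleyConj, Prod.ext_iff, Prod.fst_add, Prod.fst_neg,
      Prod.snd_neg, star_add] at hx hy ⊢
    exact ⟨by rw [hx.1, hy.1, neg_add], trivial⟩
  zero_mem' := by simp [cayleyConj]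
  smul_mem' c x hx := by
    simp only [Set.mem_ofPred_eq, cayleyConj, Prod.ext_iff, Prod.smul_fst,
      Prod.fst_neg, Prod.snd_neg] at hx ⊢
    exact ⟨by rw [Quaternion.star_smul, hx.1, smul_neg], trivial⟩

/-- The 3-form `([a, b], c)` on the imaginary Cayley numbers. -/
def cayleyForm (a b c : ℍ[ℝ] × ℍ[ℝ]) : ℝ :=
  cayleyDot (cayleyMul a b - cayleyMul b a) c

section Manifolds

variable {E : Type*} [NormedAddCommGroup E] [NormedSpace ℝ E] {H : Type*} [TopologicalSpace H]
  (I : ModelWithCorners ℝ E H) {M : Type*} [TopologicalSpace M] [ChartedSpace H M]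

/-- A 3-form `lam` on `M` read in the chart at `x`, that is, its pullback under the inverse of
the chart. -/
def formInChart (lam : ∀ p : M, (TangentSpace I p) [⋀^Fin 3]→L[ℝ] ℝ) (x : M) (y : E) :
    E [⋀^Fin 3]→L[ℝ] ℝ :=
  (lam ((extChartAt I x).symm y)).compContinuousLinearMap
    (mfderiv 𝓘(ℝ, E) I (extChartAt I x).symm y)

/-- `lam` is a smooth closed 3-form on the boundaryless manifold `M` which on every tangent space
is linearly equivalent to the form `([a, b], c)` on the imaginary Cayley numbers. (A nonzero
constant multiple of that form is linearly equivalent to it by a dilatation.) -/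
structure IsG2Form (lam : ∀ p : M, (TangentSpace I p) [⋀^Fin 3]→L[ℝ] ℝ) : Prop where
  smooth : ∀ x : M, ContDiffOn ℝ ∞ (formInChart I lam x) (extChartAt I x).target
  closed : ∀ x : M, ∀ y ∈ (extChartAt I x).target, extDeriv (formInChart I lam x) y = 0
  cayley : ∀ p : M, ∃ e : TangentSpace I p ≃ₗ[ℝ] imCayley, ∀ a b c : TangentSpace I p,
    lam p ![a, b, c] = cayleyForm (e a) (e b) (e c)

end Manifolds

/-! ### Smooth curves and charts

Following the convenient calculus, the smooth structure on the spaces below is given by their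
smooth curves. On Fréchet spaces and Fréchet manifolds, a set is open iff its preimages under all
smooth curves are open, and a map is smooth iff it maps smooth curves to smooth curves. -/

/-- A set together with a distinguished collection of smooth curves. -/
class SmoothCurves (X : Type*) where
  curves : Set (ℝ → X)

/-- The smooth curves in `X`. -/
def IsSmoothCurve {X : Type*} [SmoothCurves X] (c : ℝ → X) : Prop :=
  c ∈ SmoothCurves.curves

/-- Open sets: those whose preimages under all smooth curves are open. -/
def IsCurveOpen {X : Type*} [SmoothCurves X] (U : Set X) : Prop :=
  ∀ c : ℝ → X, IsSmoothCurve c → IsOpen (c ⁻¹' U)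

/-- The smooth curves in a subset (for instance in a linear subspace) are the smooth curves in the
ambient space lying in it. -/
instance {X : Type*} [SmoothCurves X] (p : X → Prop) : SmoothCurves (Subtype p) where
  curves := {c | IsSmoothCurve fun u => (c u : X)}

/-- `φ`, restricted to `V`, is (the inverse of) a chart of `X`: a diffeomorphism from the open
subset `V` of the vector space `W` onto an open subset of `X`. -/
structure IsSmoothChart {W X : Type*} [SmoothCurves W] [SmoothCurves X] (V : Set W)
    (φ : W → X) : Prop where
  open_source : IsCurveOpen V
  open_image : IsCurveOpen (φ '' V)
  injOn : InjOn φ V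
  smooth_iff : ∀ c : ℝ → W, (∀ u, c u ∈ V) → (IsSmoothCurve c ↔ IsSmoothCurve (φ ∘ c))

/-- The subspace `F` is closed and complemented: it is the image of a smooth linear projection. -/
def IsSplit {W : Type*} [AddCommGroup W] [Module ℝ W] [SmoothCurves W] (F : Submodule ℝ W) :
    Prop :=
  ∃ P : W →ₗ[ℝ] W, LinearMap.IsProj F P ∧
    ∀ c : ℝ → W, IsSmoothCurve c → IsSmoothCurve (P ∘ c)

section Loops

variable {E : Type*} [NormedAddCommGroup E] [NormedSpace ℝ E] {H : Type*} [TopologicalSpace H]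
  {E' : Type*} [NormedAddCommGroup E'] [NormedSpace ℝ E'] {H' : Type*} [TopologicalSpace H']

/-! ### Loops -/

/-- A smooth loop `S¹ = ℝ/ℤ → M`, given as a smooth 1-periodic map `ℝ → M`. -/
structure Loop (I : ModelWithCorners ℝ E H) (M : Type*) [TopologicalSpace M]
    [ChartedSpace H M] where
  toFun : ℝ → M
  smooth : ContMDiff 𝓘(ℝ, ℝ) I ∞ toFun
  periodic : Function.Periodic toFun 1

variable {I : ModelWithCorners ℝ E H} {M : Type*} [TopologicalSpace M] [ChartedSpace H M]
  {J : ModelWithCorners ℝ E' H'} {S : Type*} [TopologicalSpace S] [ChartedSpace H' S]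

/-- The loop as a map on the circle `ℝ/ℤ`. -/
def Loop.onCircle (γ : Loop I M) : AddCircle (1 : ℝ) → M :=
  γ.periodic.lift

/-- The velocity of a loop. -/
def Loop.velocity (γ : Loop I M) (t : ℝ) : TangentSpace I (γ.toFun t) :=
  mfderiv 𝓘(ℝ, ℝ) I γ.toFun t (1 : ℝ)

/-- Composition of a loop with a smooth map. -/
def Loop.map {f : S → M} (hf : ContMDiff J I ∞ f) (δ : Loop J S) : Loop I M where
  toFun := f ∘ δ.toFun
  smooth := hf.comp δ.smooth
  periodic := fun t => congrArg f (δ.periodic t)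

/-- A smooth curve of loops is a smooth map `ℝ × S¹ → M`. -/
instance : SmoothCurves (Loop I M) where
  curves := {c | ContMDiff 𝓘(ℝ, ℝ × ℝ) I ∞ fun q : ℝ × ℝ => (c q.1).toFun q.2}

/-- `γ'` is obtained from `γ` by an orientation preserving reparametrization: an element of
`Diff⁺(S¹)` is given by its lift, an increasing diffeomorphism of `ℝ` that commutes with
translation by `1`. -/
def Loop.Reparam (γ γ' : Loop I M) : Prop :=
  ∃ φ : ℝ ≃ₘ^∞⟮𝓘(ℝ, ℝ), 𝓘(ℝ, ℝ)⟯ ℝ, StrictMono φ ∧ (∀ t, φ (t + 1) = φ t + 1) ∧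
    ∀ t, γ'.toFun t = γ.toFun (φ t)

variable (I M) in
/-- The equivalence relation of orientation preserving reparametrization. -/
def Loop.setoid : Setoid (Loop I M) where
  r := Loop.Reparam
  iseqv :=
    { refl := fun γ => ⟨Diffeomorph.refl 𝓘(ℝ, ℝ) ℝ ∞, fun _ _ h => h, fun _ => rfl, fun _ => rfl⟩
      symm := by
        rintro γ γ' ⟨φ, hmono, hper, h⟩
        refine ⟨φ.symm, fun a b hab => ?_, fun t => ?_, fun t => ?_⟩
        · have h1 : φ (φ.symm a) < φ (φ.symm b) := by simpa using hab
          exact hmono.lt_iff_lt.1 h1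
        · apply φ.injective
          change φ (φ.symm (t + 1)) = φ (φ.symm t + 1)
          rw [hper, φ.apply_symm_apply, φ.apply_symm_apply]
        · rw [h, φ.apply_symm_apply]
      trans := by
        rintro γ γ' γ'' ⟨φ, hmono, hper, h⟩ ⟨ψ, hmono', hper', h'⟩
        refine ⟨ψ.trans φ, fun a b hab => hmono (hmono' hab), fun t => ?_, fun t => ?_⟩
        · change φ (ψ (t + 1)) = φ (ψ t) + 1
          rw [hper', hper]
        · rw [h', h]
          rfl }

/-- The quotient of a set `P` of loops by reparametrization. -/
def Unparam (P : Set (Loop I M)) : Type _ :=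
  Quotient ((Loop.setoid I M).comap (Subtype.val : {γ : Loop I M // γ ∈ P} → Loop I M))

/-- The class of a loop modulo reparametrization. -/
def Unparam.mk {P : Set (Loop I M)} (γ : {γ : Loop I M // γ ∈ P}) : Unparam P :=
  Quotient.mk _ γ

/-- A curve of unparametrized loops is smooth if it lifts, near each parameter value, to a smooth
curve of parametrized loops. -/
instance (P : Set (Loop I M)) : SmoothCurves (Unparam P) where
  curves := {c | ∀ u₀ : ℝ, ∃ g : ℝ → {γ : Loop I M // γ ∈ P}, IsSmoothCurve g ∧
    ∀ᶠ u in 𝓝 u₀, c u = Unparam.mk (g u)}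

/-! ### Singular knots -/

/-- The branches of `γ` at `x₁` and at `x₂` (where `γ x₁ = γ x₂`) have tangency of at most finite
order: some smooth function that vanishes along the branch at `x₂` does not vanish to infinite
order at `x₁` along the branch at `x₁`. -/
def Loop.FiniteContact (γ : Loop I M) (x₁ x₂ : ℝ) : Prop :=
  ∃ g : M → ℝ, ContMDiff I 𝓘(ℝ, ℝ) ∞ g ∧ (∀ᶠ t in 𝓝 x₂, g (γ.toFun t) = 0) ∧
    ∃ n : ℕ, iteratedDeriv n (g ∘ γ.toFun) x₁ ≠ 0

/-- Singular knots: immersed loops that are an embedding outside a finite subset `A` of the circle,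
with tangencies of at most finite order between the branches at distinct points of `A`. -/
structure Loop.IsSingularKnot (γ : Loop I M) : Prop where
  immersion : ∀ t, γ.velocity t ≠ 0
  exceptional : ∃ A : Set (AddCircle (1 : ℝ)), A.Finite ∧
    IsEmbedding (Aᶜ.domRestrict γ.onCircle) ∧
    ∀ x₁ x₂ : ℝ, (x₁ : AddCircle (1 : ℝ)) ∈ A → (x₂ : AddCircle (1 : ℝ)) ∈ A →
      (x₁ : AddCircle (1 : ℝ)) ≠ (x₂ : AddCircle (1 : ℝ)) → γ.toFun x₁ = γ.toFun x₂ →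
      γ.FiniteContact x₁ x₂

variable (I M) in
/-- The set of parametrized singular knots in `M`. -/
def singularKnots : Set (Loop I M) := {γ | γ.IsSingularKnot}

variable (I M) in
/-- The space of unparametrized singular knots in `M`. -/
abbrev KnotSpace : Type _ := Unparam (singularKnots I M)

/-- The loops in `S` that `f : S → M` maps to singular knots in `M`. -/
def loopsOver {f : S → M} (hf : ContMDiff J I ∞ f) : Set (Loop J S) :=
  {δ | (δ.map hf).IsSingularKnot}

/-- The map `[δ] ↦ [f ∘ δ]` from unparametrized loops in `S` to unparametrized singular knots
in `M`. -/
def pushKnot {f : S → M} (hf : ContMDiff J I ∞ f) :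
    Unparam (loopsOver hf) → KnotSpace I M :=
  Quotient.map (fun δ => (⟨δ.1.map hf, δ.2⟩ : {γ : Loop I M // γ ∈ singularKnots I M})) <| by
    rintro δ δ' ⟨φ, hmono, hper, h⟩
    exact ⟨φ, hmono, hper, fun t => congrArg f (h t)⟩

variable (I) in
/-- The set of unparametrized singular knots contained in the subset `T` of `M`. -/
def knotsIn (T : Set M) : Set (KnotSpace I M) :=
  {y | ∃ γ : {γ : Loop I M // γ ∈ singularKnots I M}, y = Unparam.mk γ ∧ ∀ t, γ.1.toFun t ∈ T}

/-! ### Tangent spaces -/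

section Tangent

theorem tangentBundle_mk_add {p q : M} (h : p = q) {a b : TangentSpace I p}
    {a' b' : TangentSpace I q} (ha : (⟨p, a⟩ : TangentBundle I M) = ⟨q, a'⟩)
    (hb : (⟨p, b⟩ : TangentBundle I M) = ⟨q, b'⟩) :
    (⟨p, a + b⟩ : TangentBundle I M) = ⟨q, a' + b'⟩ := by
  subst h
  simp only [Bundle.TotalSpace.mk.injEq, heq_eq_eq, true_and] at ha hb ⊢
  rw [ha, hb]

theorem tangentBundle_mk_smul {p q : M} (h : p = q) (r : ℝ) {a : TangentSpace I p}
    {a' : TangentSpace I q} (ha : (⟨p, a⟩ : TangentBundle I M) = ⟨q, a'⟩) :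
    (⟨p, r • a⟩ : TangentBundle I M) = ⟨q, r • a'⟩ := by
  subst h
  simp only [Bundle.TotalSpace.mk.injEq, heq_eq_eq, true_and] at ha ⊢
  rw [ha]

theorem tangentBundle_mk_zero {p q : M} (h : p = q) :
    (⟨p, 0⟩ : TangentBundle I M) = ⟨q, 0⟩ := by
  subst h
  rfl

variable [IsManifold I ∞ M]

theorem contMDiff_along_add {N : Type*} [TopologicalSpace N] {EN HN : Type*}
    [NormedAddCommGroup EN] [NormedSpace ℝ EN] [TopologicalSpace HN]
    {K : ModelWithCorners ℝ EN HN} [ChartedSpace HN N] {b : N → M}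
    {X Y : ∀ t, TangentSpace I (b t)}
    (hX : ContMDiff K I.tangent ∞ fun t => (⟨b t, X t⟩ : TangentBundle I M))
    (hY : ContMDiff K I.tangent ∞ fun t => (⟨b t, Y t⟩ : TangentBundle I M)) :
    ContMDiff K I.tangent ∞ fun t => (⟨b t, X t + Y t⟩ : TangentBundle I M) := by
  intro t₀
  have hX' := Bundle.contMDiffAt_totalSpace.1 (hX t₀)
  have hY' := Bundle.contMDiffAt_totalSpace.1 (hY t₀)
  refine Bundle.contMDiffAt_totalSpace.2 ⟨hX'.1, (hX'.2.add hY'.2).congr_of_eventuallyEq ?_⟩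
  set e := trivializationAt E (TangentSpace I : M → Type _) (b t₀)
  have hb : ∀ᶠ t in 𝓝 t₀, b t ∈ e.baseSet :=
    hX'.1.continuousAt.eventually
      (e.open_baseSet.mem_nhds (FiberBundle.mem_baseSet_trivializationAt' (b t₀)))
  filter_upwards [hb] with t ht
  exact (e.linear ℝ ht).1 (X t) (Y t)

theorem contMDiff_along_smul {N : Type*} [TopologicalSpace N] {EN HN : Type*}
    [NormedAddCommGroup EN] [NormedSpace ℝ EN] [TopologicalSpace HN]
    {K : ModelWithCorners ℝ EN HN} [ChartedSpace HN N] {b : N → M}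
    {X : ∀ t, TangentSpace I (b t)} (a : ℝ)
    (hX : ContMDiff K I.tangent ∞ fun t => (⟨b t, X t⟩ : TangentBundle I M)) :
    ContMDiff K I.tangent ∞ fun t => (⟨b t, a • X t⟩ : TangentBundle I M) := by
  intro t₀
  have hX' := Bundle.contMDiffAt_totalSpace.1 (hX t₀)
  refine Bundle.contMDiffAt_totalSpace.2
    ⟨hX'.1, ((contMDiffAt_const (c := a) : ContMDiffAt K 𝓘(ℝ, ℝ) ∞ (fun _ => a) t₀).smul hX'.2).congr_of_eventuallyEq ?_⟩
  set e := trivializationAt E (TangentSpace I : M → Type _) (b t₀)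
  have hb : ∀ᶠ t in 𝓝 t₀, b t ∈ e.baseSet :=
    hX'.1.continuousAt.eventually
      (e.open_baseSet.mem_nhds (FiberBundle.mem_baseSet_trivializationAt' (b t₀)))
  filter_upwards [hb] with t ht
  exact (e.linear ℝ ht).2 a (X t)

/-- The smooth (periodic) vector fields along a loop. -/
def Loop.fields (γ : Loop I M) : Submodule ℝ (∀ t : ℝ, TangentSpace I (γ.toFun t)) where
  carrier := {X | ContMDiff 𝓘(ℝ, ℝ) I.tangent ∞
      (fun t => (⟨γ.toFun t, X t⟩ : TangentBundle I M)) ∧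
    ∀ t, (⟨γ.toFun (t + 1), X (t + 1)⟩ : TangentBundle I M) = ⟨γ.toFun t, X t⟩}
  add_mem' hX hY := ⟨contMDiff_along_add hX.1 hY.1, fun t =>
    tangentBundle_mk_add (γ.periodic t) (hX.2 t) (hY.2 t)⟩
  zero_mem' :=
    ⟨(Bundle.contMDiff_zeroSection ℝ (TangentSpace I : M → Type _)).comp γ.smooth,
      fun t => tangentBundle_mk_zero (γ.periodic t)⟩
  smul_mem' r _ hX := ⟨contMDiff_along_smul r hX.1, fun t =>
    tangentBundle_mk_smul (γ.periodic t) r (hX.2 t)⟩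

/-- The vector fields along a loop that are tangent to the loop. -/
def Loop.tangentialFields (γ : Loop I M) : Submodule ℝ γ.fields where
  carrier := {X | ∀ t, X.1 t ∈ Submodule.span ℝ {γ.velocity t}}
  add_mem' hX hY t := Submodule.add_mem _ (hX t) (hY t)
  zero_mem' _ := Submodule.zero_mem _
  smul_mem' r _ hX t := Submodule.smul_mem _ r (hX t)

/-- The sections of the normal bundle of a loop: this is the tangent space at (the class of) the
loop to the space of unparametrized knots. -/
abbrev Loop.NormalSections (γ : Loop I M) : Type _ := γ.fields ⧸ γ.tangentialFields

/-- A curve of normal sections is smooth if it is represented by vector fields that depend smoothly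
on the curve parameter and the loop parameter together. -/
instance (γ : Loop I M) : SmoothCurves γ.NormalSections where
  curves := {c | ∃ X : ℝ → γ.fields,
    ContMDiff 𝓘(ℝ, ℝ × ℝ) I.tangent ∞
      (fun q : ℝ × ℝ => (⟨γ.toFun q.2, (X q.1).1 q.2⟩ : TangentBundle I M)) ∧
    ∀ u, c u = γ.tangentialFields.mkQ (X u)}

/-- The curve `g` of loops starts at the loop `γ`, with velocity the vector field `X` along `γ`. -/
def HasInitialVelocity (g : ℝ → Loop I M) (γ : Loop I M) (X : γ.fields) : Prop :=
  ∀ t, (⟨γ.toFun t, X.1 t⟩ : TangentBundle I M) =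
    ⟨(g 0).toFun t, mfderiv 𝓘(ℝ, ℝ) I (fun u => (g u).toFun t) 0 (1 : ℝ)⟩

/-- The tangent vectors at `γ` to a set `L` of unparametrized knots: the velocities at `γ` of the
smooth curves of knots that lie in `L`. -/
def tangentSet (L : Set (KnotSpace I M)) (γ : Loop I M) : Set γ.NormalSections :=
  {x | ∃ (g : ℝ → {γ : Loop I M // γ ∈ singularKnots I M}) (X : γ.fields), IsSmoothCurve g ∧
    (∀ u, Unparam.mk (g u) ∈ L) ∧ HasInitialVelocity (fun u => (g u).1) γ X ∧
    x = γ.tangentialFields.mkQ X}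

/-- The image of the tangent space at `δ` under the differential of `[δ] ↦ [f ∘ δ]`. -/
def tangentImage {f : S → M} (hf : ContMDiff J I ∞ f) (δ : Loop J S) :
    Set (δ.map hf).NormalSections :=
  {x | ∃ (g : ℝ → {δ : Loop J S // δ ∈ loopsOver hf}) (X : (δ.map hf).fields), IsSmoothCurve g ∧
    g 0 = δ ∧ HasInitialVelocity (fun u => (g u).1.map hf) (δ.map hf) X ∧
    x = (δ.map hf).tangentialFields.mkQ X}

/-! ### The transgressed form and Lagrangian submanifolds -/

theorem form_eq_of_sub_mem_span {V : Type*} [AddCommGroup V] [Module ℝ V] [TopologicalSpace V]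
    (l : V [⋀^Fin 3]→L[ℝ] ℝ) {v x x' y y' : V} (hx : x - x' ∈ Submodule.span ℝ {v})
    (hy : y - y' ∈ Submodule.span ℝ {v}) : l ![v, x, y] = l ![v, x', y'] := by
  obtain ⟨a, ha⟩ := Submodule.mem_span_singleton.1 hx
  obtain ⟨b, hb⟩ := Submodule.mem_span_singleton.1 hy
  have hx' : x = x' + a • v := by rw [ha]; abel
  have hy' : y = y' + b • v := by rw [hb]; abel
  have h1 : ∀ z, l ![v, x' + a • v, z] = l ![v, x', z] := by
    intro z
    have e1 := l.map_update_add ![v, x', z] 1 x' (a • v)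
    have e2 := l.map_update_smul ![v, x', z] 1 a v
    have e3 : l ![v, v, z] = 0 := l.map_eq_zero_of_eq _ (i := 0) (j := 1) rfl (by decide)
    have u : ∀ w, Function.update ![v, x', z] 1 w = ![v, w, z] := by
      intro w; ext i; fin_cases i <;> rfl
    simp only [u] at e1 e2
    rw [e1, e2, e3, smul_zero, add_zero]
  have h2 : l ![v, x', y' + b • v] = l ![v, x', y'] := by
    have e1 := l.map_update_add ![v, x', y'] 2 y' (b • v)
    have e2 := l.map_update_smul ![v, x', y'] 2 b v
    have e3 : l ![v, x', v] = 0 := l.map_eq_zero_of_eq _ (i := 0) (j := 2) rfl (by decide)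
    have u : ∀ w, Function.update ![v, x', y'] 2 w = ![v, x', w] := by
      intro w; ext i; fin_cases i <;> rfl
    simp only [u] at e1 e2
    rw [e1, e2, e3, smul_zero, add_zero]
  rw [hx', hy', h1, h2]

/-- The transgression of a 3-form `lam`: the 2-form `ω (x, y) = ∮_γ lam (γ', x, y)` on normal
sections. -/
def transgression (lam : ∀ p : M, (TangentSpace I p) [⋀^Fin 3]→L[ℝ] ℝ) (γ : Loop I M)
    (x y : γ.NormalSections) : ℝ :=
  Quotient.liftOn₂ x y
    (fun X Y => ∫ t in (0 : ℝ)..1, lam (γ.toFun t) ![γ.velocity t, X.1 t, Y.1 t])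
    (by
      intro X Y X' Y' hX hY
      have hX' := (Submodule.quotientRel_def γ.tangentialFields).1 hX
      have hY' := (Submodule.quotientRel_def γ.tangentialFields).1 hY
      exact congrArg (fun F : ℝ → ℝ => ∫ t in (0 : ℝ)..1, F t)
        (funext fun t => form_eq_of_sub_mem_span (lam (γ.toFun t)) (hX' t) (hY' t)))

/-- `F` is a Lagrangian subspace of the tangent space at `γ`: it equals its own orthogonal with
respect to the transgressed form. -/
def IsLagrangianSubspace (lam : ∀ p : M, (TangentSpace I p) [⋀^Fin 3]→L[ℝ] ℝ) (γ : Loop I M)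
    (F : Submodule ℝ γ.NormalSections) : Prop :=
  ∀ x, x ∈ F ↔ ∀ y ∈ F, transgression lam γ x y = 0

/-- `L` is a Lagrangian submanifold of the space of unparametrized knots: near each of its points
there is a chart of the knot space in which `L` is a closed complemented linear subspace `F`, the
tangent space of `L`, and `F` is Lagrangian for the transgressed form. -/
def IsLagrangianSubmanifold (lam : ∀ p : M, (TangentSpace I p) [⋀^Fin 3]→L[ℝ] ℝ)
    (L : Set (KnotSpace I M)) : Prop :=
  ∀ γ : {γ : Loop I M // γ ∈ singularKnots I M}, Unparam.mk γ ∈ L →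
    ∃ F : Submodule ℝ γ.1.NormalSections,
      (F : Set γ.1.NormalSections) = tangentSet L γ.1 ∧ IsSplit F ∧
      IsLagrangianSubspace lam γ.1 F ∧
      ∃ (V : Set γ.1.NormalSections) (φ : γ.1.NormalSections → KnotSpace I M),
        IsSmoothChart V φ ∧ 0 ∈ V ∧ φ 0 = Unparam.mk γ ∧ ∀ x ∈ V, φ x ∈ L ↔ x ∈ F

/-- The map `[δ] ↦ [f ∘ δ]` is a Lagrangian immersion into the space of unparametrized knots of
`M`: around each point there are charts `ψ` and `φ` of its source and target in which it is the
inclusion of a closed complemented linear subspace `F`, the image of its differential, and `F` is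
Lagrangian for the transgressed form. -/
def IsLagrangianImmersion (lam : ∀ p : M, (TangentSpace I p) [⋀^Fin 3]→L[ℝ] ℝ) {f : S → M}
    (hf : ContMDiff J I ∞ f) : Prop :=
  ∀ δ : {δ : Loop J S // δ ∈ loopsOver hf},
    ∃ F : Submodule ℝ (δ.1.map hf).NormalSections,
      (F : Set (δ.1.map hf).NormalSections) = tangentImage hf δ.1 ∧ IsSplit F ∧
      IsLagrangianSubspace lam (δ.1.map hf) F ∧
      ∃ (V : Set (δ.1.map hf).NormalSections) (φ : (δ.1.map hf).NormalSections → KnotSpace I M)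
        (ψ : F → Unparam (loopsOver hf)),
        IsSmoothChart V φ ∧ 0 ∈ V ∧ IsSmoothChart {x : F | (x : (δ.1.map hf).NormalSections) ∈ V} ψ ∧
        ψ 0 = Unparam.mk δ ∧ ∀ x : F, (x : (δ.1.map hf).NormalSections) ∈ V →
          pushKnot hf (ψ x) = φ x

end Tangent

end Loops

end

noncomputable section

/-! ### Local diffeomorphisms -/

section LocalDiffeomorphisms

variable {P : Type*} [NormedAddCommGroup P] [NormedSpace ℝ P]
  {Q : Type*} [NormedAddCommGroup Q] [NormedSpace ℝ Q]

/-! Up to reparametrization, a knot near `γ` is a small section of the normal bundle of `γ`. The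
proof builds charts of the knot space from this, chooses them so that loops in `Σ` are the sections
lying in a subbundle, and checks that this subbundle is pointwise Lagrangian.

Tubes. The normal bundle over the circle may be twisted, and `γ` may cross itself. Both are handled
by working upstairs: a tube is a map `Φ : ℝ × F → M`, a local diffeomorphism along `ℝ × 0`, with `Φ
(t + 1, x) = Φ (t, A x)` for a linear isomorphism `A`, and a section is a function with `A (x (t +
1)) = x t`. The tube is an immersed rather than an embedded neighbourhood, so `Φ` is only locally
injective.

Charts. A smooth family of loops starting at a loop in the tube lifts to `ℝ × F`
(`exists_smooth_lift`); inverting the first component of the lift turns it into a family of sections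
(`exists_smooth_sections`). Being a singular knot is an open condition
(`eventually_isSingularKnot`): the finite order of contact at a double point is the nonvanishing of
some derivative, which persists under perturbation and by Rolle allows only finitely many double
points nearby. Small sections giving the same unparametrized knot are equal, because a point of `γ`
that is not a double point fixes the parametrization (`injOn_tubeChart`). Together these give
`isSmoothChart_tubeChart`.

Adapted tubes. For a loop `δ` in `Σ`, let `F = F₁ × F₂`, where `ℝ × F₁` models a tube `Ψ` of `δ` in
`Σ` and `Φ (t, x, 0) = f (Ψ (t, x))` near the core. Such pairs exist locally by the normal form of
immersions; they are glued along the circle by interpolating the transition map with its block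
diagonal linear part (`IsTubeAt.exists_glue`, `exists_isTubeAt_periodic`). In the resulting charts,
`[δ] ↦ [f ∘ δ]` is the inclusion of the sections with vanishing `F₂`-component. If `f` is an
embedding, no other points of `f(Σ)` lie near the core, so these sections are exactly the loops in
`f(Σ)`.

Lagrangian. For imaginary Cayley numbers, `[a, [a, b]]` is a combination of `a` and `b` in which `b`
has the coefficient `-4 (a, a)`; hence the contraction of `λ` with `v ≠ 0` has radical `ℝ v` and is
symplectic on the 6-dimensional quotient. The tangent spaces of `Σ` are isotropic, and modulo the
velocity they have dimension 3, so they are their own orthogonals (`mem_of_forall_form_eq_zero`).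
Testing against sections supported in small intervals carries this from each `t` to the integral
(`isLagrangianSubspace_comap_normalEquiv`). -/

theorem isLocalDiffeomorphAt_of_hasFDerivAt [CompleteSpace P] {f : P → Q} {a : P}
    (hf : ∀ᶠ z in 𝓝 a, ContDiffAt ℝ ∞ f z) (e : P ≃L[ℝ] Q)
    (he : HasFDerivAt f (e : P →L[ℝ] Q) a) :
    IsLocalDiffeomorphAt 𝓘(ℝ, P) 𝓘(ℝ, Q) ∞ f a := by
  have hn : (∞ : WithTop ℕ∞) ≠ 0 := by simp
  have ha : ContDiffAt ℝ ∞ f a := hf.self_of_nhds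
  set h := ha.toOpenPartialHomeomorph f he hn with hh
  have hcoe : (h : P → Q) = f := rfl
  have hmem : a ∈ h.source := ha.mem_toOpenPartialHomeomorph_source he hn
  have hcont : ContinuousAt (fderiv ℝ f) a :=
    (ha.fderiv_right (m := 0) (by simp)).continuousAt
  -- Invertibility of the derivative is an open condition; it is needed near `a`, because the local
  -- inverse has to be smooth on its whole domain and not only at `f a`.
  have hinv : ∀ᶠ z in 𝓝 a, fderiv ℝ f z ∈ range ((↑) : (P ≃L[ℝ] Q) → P →L[ℝ] Q) := by
    apply hcont.eventually_mem
    rw [he.fderiv]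
    exact ContinuousLinearEquiv.nhds e
  obtain ⟨U, hU, hUo, haU⟩ := mem_nhds_iff.1 (hf.and hinv)
  set k := h.restrOpen U hUo with hk
  have hks : k.source = h.source ∩ U := h.restrOpen_source U hUo
  refine ⟨⟨k.toPartialEquiv, k.open_source, k.open_target, ?_, ?_⟩, ?_, ?_⟩
  · intro z hz
    have hz' : z ∈ h.source ∩ U := hks ▸ hz
    exact (hU hz'.2).1.contMDiffAt.contMDiffWithinAt
  · intro y hy
    have hz : k.symm y ∈ h.source ∩ U := hks ▸ k.map_target hy
    obtain ⟨h1, e', he'⟩ := hU hz.2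
    have hd : HasFDerivAt f (e' : P →L[ℝ] Q) (k.symm y) := by
      rw [he']; exact (h1.differentiableAt hn).hasFDerivAt
    exact (k.contDiffAt_symm hy hd h1).contMDiffAt.contMDiffWithinAt
  · exact (hks ▸ ⟨hmem, haU⟩ : a ∈ k.source)
  · intro z _
    rfl

variable {E : Type*} [NormedAddCommGroup E] [NormedSpace ℝ E]
  {M : Type*} [TopologicalSpace M] [ChartedSpace E M] {Φ : P → M} {z : P}

theorem IsLocalDiffeomorphAt.eventually (h : IsLocalDiffeomorphAt 𝓘(ℝ, P) 𝓘(ℝ, E) ∞ Φ z) :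
    ∀ᶠ w in 𝓝 z, IsLocalDiffeomorphAt 𝓘(ℝ, P) 𝓘(ℝ, E) ∞ Φ w := by
  obtain ⟨Ψ, hz, heq⟩ := h
  filter_upwards [Ψ.open_source.mem_nhds hz] with w hw using ⟨Ψ, hw, heq⟩

theorem IsLocalDiffeomorphAt.congr_of_eventuallyEq {Φ' : P → M}
    (h : IsLocalDiffeomorphAt 𝓘(ℝ, P) 𝓘(ℝ, E) ∞ Φ z) (h' : Φ' =ᶠ[𝓝 z] Φ) :
    IsLocalDiffeomorphAt 𝓘(ℝ, P) 𝓘(ℝ, E) ∞ Φ' z := by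
  obtain ⟨Ψ, hz, heq⟩ := h
  obtain ⟨U, hU, hUo, hzU⟩ := mem_nhds_iff.1 h'
  set k := Ψ.toOpenPartialHomeomorph.restrOpen U hUo
  have hks : k.source = Ψ.source ∩ U := Ψ.toOpenPartialHomeomorph.restrOpen_source U hUo
  refine ⟨⟨k.toPartialEquiv, k.open_source, k.open_target, ?_, ?_⟩, ?_, ?_⟩
  · exact Ψ.contMDiffOn_toFun.mono (hks ▸ inter_subset_left)
  · exact Ψ.contMDiffOn_invFun.mono fun y hy => hy.1
  · exact (hks ▸ ⟨hz, hzU⟩ : z ∈ k.source)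
  · intro w hw
    have hw' : w ∈ Ψ.source ∩ U := hks ▸ hw
    exact (hU hw'.2).trans (heq hw'.1)

/-- A local diffeomorphism has a smooth local inverse. -/
theorem IsLocalDiffeomorphAt.exists_inverse
    (h : IsLocalDiffeomorphAt 𝓘(ℝ, P) 𝓘(ℝ, E) ∞ Φ z) :
    ∃ G : M → P, (∀ᶠ q in 𝓝 (Φ z), ContMDiffAt 𝓘(ℝ, E) 𝓘(ℝ, P) ∞ G q) ∧
      (∀ᶠ w in 𝓝 z, G (Φ w) = w) ∧ (∀ᶠ q in 𝓝 (Φ z), Φ (G q) = q) := by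
  refine ⟨h.localInverse, ?_, h.localInverse_eventuallyEq_left, h.localInverse_eventuallyEq_right⟩
  filter_upwards [h.localInverse_open_source.mem_nhds h.localInverse_mem_source] with q hq
  exact h.localInverse_contMDiffOn.contMDiffAt (h.localInverse_open_source.mem_nhds hq)

theorem IsLocalDiffeomorphAt.exists_injOn
    (h : IsLocalDiffeomorphAt 𝓘(ℝ, P) 𝓘(ℝ, E) ∞ Φ z) : ∃ U ∈ 𝓝 z, InjOn Φ U := by
  obtain ⟨G, -, hG, -⟩ := h.exists_inverse
  exact ⟨_, hG, fun a ha b hb hab => by rw [← mem_ofPred.1 ha, ← mem_ofPred.1 hb, hab]⟩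

theorem OpenPartialHomeomorph.isLocalDiffeomorphAt_symm {e : OpenPartialHomeomorph M E}
    (he : e ∈ IsManifold.maximalAtlas 𝓘(ℝ, E) ∞ M) {y : E} (hy : y ∈ e.target) :
    IsLocalDiffeomorphAt 𝓘(ℝ, E) 𝓘(ℝ, E) ∞ e.symm y :=
  ⟨⟨e.symm.toPartialEquiv, e.open_target, e.open_source,
    contMDiffOn_symm_of_mem_maximalAtlas he, contMDiffOn_of_mem_maximalAtlas he⟩, hy,
    fun _ _ => rfl⟩

theorem Diffeomorph.isLocalDiffeomorphAt_comp_iff (T : P ≃ₘ^∞⟮𝓘(ℝ, P), 𝓘(ℝ, P)⟯ P) :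
    IsLocalDiffeomorphAt 𝓘(ℝ, P) 𝓘(ℝ, E) ∞ (Φ ∘ T) z ↔
      IsLocalDiffeomorphAt 𝓘(ℝ, P) 𝓘(ℝ, E) ∞ Φ (T z) := by
  refine ⟨fun h => ?_, fun h => (T.isLocalDiffeomorph z).comp _ _ h⟩
  have h2 : IsLocalDiffeomorphAt 𝓘(ℝ, P) 𝓘(ℝ, E) ∞ (Φ ∘ T) (T.symm (T z)) := by simpa using h
  have h3 := (T.symm.isLocalDiffeomorph (T z)).comp _ _ h2
  have h4 : (Φ ∘ T) ∘ T.symm = Φ := by ext w; simp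
  rwa [h4] at h3

end LocalDiffeomorphisms

/-! ### Twisted periodic sections -/

section TwistedSections

variable {F : Type*} [NormedAddCommGroup F] [NormedSpace ℝ F]

/-- The smooth sections of the vector bundle over `ℝ/ℤ` with monodromy `A`. -/
def twistedSections (A : F ≃L[ℝ] F) : Submodule ℝ (ℝ → F) where
  carrier := {x | ContDiff ℝ ∞ x ∧ ∀ t, A (x (t + 1)) = x t}
  add_mem' hx hy := ⟨hx.1.add hy.1, fun t => by simp [hx.2 t, hy.2 t]⟩
  zero_mem' := ⟨contDiff_const, fun t => by simp⟩
  smul_mem' r x hx := ⟨hx.1.const_smul r, fun t => by simp [hx.2 t]⟩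

/-- Smooth curves of sections. -/
instance (A : F ≃L[ℝ] F) : SmoothCurves (twistedSections A) where
  curves := {c | ContDiff ℝ ∞ fun q : ℝ × ℝ => (c q.1).1 q.2}

variable {A : F ≃L[ℝ] F}

theorem twistedSections_apply_sub_intCast (x : twistedSections A) (n : ℤ) (t : ℝ) :
    x.1 (t - n) = (A ^ n) (x.1 t) := by
  induction n using Int.induction_on generalizing t with
  | zero => simp; rfl
  | succ n ih =>
    have h1 := x.2.2 (t - (n + 1))
    rw [show t - ((n : ℝ) + 1) + 1 = t - (n : ℤ) by push_cast; ring, ih] at h1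
    push_cast
    rw [← h1, add_comm, zpow_add, zpow_one]
    rfl
  | pred n ih =>
    have h1 := x.2.2 (t - (-n : ℤ))
    have h2 : x.1 (t - ((-n - 1 : ℤ) : ℝ)) = A.symm (x.1 (t - (-n : ℤ))) := by
      rw [← h1, A.symm_apply_apply]
      exact congrArg x.1 (by push_cast; ring)
    rw [h2, ih, sub_eq_add_neg, add_comm, zpow_add, zpow_neg_one]
    rfl

/-- The deck transformations `(t, x) ↦ (t - n, A ^ n x)` leave `Φ` invariant and, by
`twistedSections_apply_sub_intCast`, preserve the graph of every section. This reduces questions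
about all `t` to the compact interval `[0, 1]`. -/
theorem apply_shift_intCast {X : Type*} {Φ : ℝ × F → X}
    (hΦ : ∀ t x, Φ (t + 1, x) = Φ (t, A x)) (n : ℤ) (t : ℝ) (x : F) :
    Φ (t - n, (A ^ n) x) = Φ (t, x) := by
  induction n using Int.induction_on generalizing t x with
  | zero => simp; rfl
  | succ n ih =>
    rw [← ih t x, show t - ((n : ℤ) : ℝ) = (t - (n + 1 : ℤ)) + 1 by push_cast; ring, hΦ,
      add_comm (n : ℤ), zpow_add, zpow_one]
    rfl
  | pred n ih =>
    rw [← ih t x, show t - ((-n - 1 : ℤ) : ℝ) = (t - (-n : ℤ)) + 1 by push_cast; ring, hΦ]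
    have h1 : (A ^ (-(n : ℤ))) x = A ((A ^ (-(n : ℤ) - 1)) x) := by
      conv_lhs => rw [show -(n : ℤ) = 1 + (-n - 1) by ring, zpow_add, zpow_one]
      rfl
    rw [h1]

theorem isLocalDiffeomorphAt_comp_shift_iff {E : Type*} [NormedAddCommGroup E] [NormedSpace ℝ E]
    {M : Type*} [TopologicalSpace M] [ChartedSpace E M] {Φ : ℝ × F → M} (c : ℝ) (B : F ≃L[ℝ] F)
    (t : ℝ) (x : F) :
    IsLocalDiffeomorphAt 𝓘(ℝ, ℝ × F) 𝓘(ℝ, E) ∞ (fun z : ℝ × F => Φ (z.1 - c, B z.2)) (t, x) ↔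
      IsLocalDiffeomorphAt 𝓘(ℝ, ℝ × F) 𝓘(ℝ, E) ∞ Φ (t - c, B x) := by
  have hT : ContDiff ℝ ∞ fun z : ℝ × F => (z.1 - c, B z.2) := by fun_prop
  have hT' : ContDiff ℝ ∞ fun z : ℝ × F => (z.1 + c, B.symm z.2) := by fun_prop
  let T : (ℝ × F) ≃ₘ^∞⟮𝓘(ℝ, ℝ × F), 𝓘(ℝ, ℝ × F)⟯ (ℝ × F) :=
    { toFun := fun z => (z.1 - c, B z.2)
      invFun := fun z => (z.1 + c, B.symm z.2)
      left_inv := fun z => by simp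
      right_inv := fun z => by simp
      contMDiff_toFun := hT.contMDiff
      contMDiff_invFun := hT'.contMDiff }
  exact T.isLocalDiffeomorphAt_comp_iff (Φ := Φ) (z := (t, x))

theorem isLocalDiffeomorphAt_shift_iff {E : Type*} [NormedAddCommGroup E] [NormedSpace ℝ E]
    {M : Type*} [TopologicalSpace M] [ChartedSpace E M] {Φ : ℝ × F → M}
    (hΦ : ∀ t x, Φ (t + 1, x) = Φ (t, A x)) (n : ℤ) (t : ℝ) (x : F) :
    IsLocalDiffeomorphAt 𝓘(ℝ, ℝ × F) 𝓘(ℝ, E) ∞ Φ (t - n, (A ^ n) x) ↔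
      IsLocalDiffeomorphAt 𝓘(ℝ, ℝ × F) 𝓘(ℝ, E) ∞ Φ (t, x) := by
  have h1 := isLocalDiffeomorphAt_comp_shift_iff (E := E) (Φ := Φ) (n : ℝ) (A ^ n) t x
  have h2 : (fun z : ℝ × F => Φ (z.1 - n, (A ^ n) z.2)) = Φ :=
    funext fun z => apply_shift_intCast hΦ n z.1 z.2
  rw [h2] at h1
  exact h1.symm

/-- Only finitely many `n` matter near a given point, so the bad sets form a locally finite family
of closed sets, and their union is closed. -/
theorem isOpen_forall_sub_intCast_mem_Icc {Z : Type*} [TopologicalSpace Z] (R : ℤ → ℝ × Z → Prop)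
    (hR : ∀ n, IsOpen {q | R n q}) :
    IsOpen {q : ℝ × Z | ∀ n : ℤ, q.1 - n ∈ Icc (0 : ℝ) 1 → R n q} := by
  have h : {q : ℝ × Z | ∀ n : ℤ, q.1 - n ∈ Icc (0 : ℝ) 1 → R n q} =
      (⋃ n : ℤ, {q : ℝ × Z | q.1 - n ∈ Icc (0 : ℝ) 1 ∧ ¬ R n q})ᶜ := by
    ext q; simp [and_imp]
  rw [h, isOpen_compl_iff]
  refine LocallyFinite.isClosed_iUnion ?_ ?_
  · intro q
    refine ⟨{p | p.1 ∈ Ioo (q.1 - 1) (q.1 + 1)}, ?_, ?_⟩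
    · exact continuous_fst.continuousAt.preimage_mem_nhds (Ioo_mem_nhds (by linarith) (by linarith))
    · refine (Set.finite_Icc (⌊q.1 - 3⌋) (⌈q.1 + 3⌉)).subset ?_
      rintro n ⟨p, ⟨hp, -⟩, hp2⟩
      simp only [mem_Icc, mem_ofPred_eq, mem_Ioo] at hp hp2 ⊢
      constructor
      · rw [← Int.cast_le (R := ℝ)]
        linarith [Int.floor_le (q.1 - 3)]
      · rw [← Int.cast_le (R := ℝ)]
        linarith [Int.le_ceil (q.1 + 3)]
  · intro n
    refine IsClosed.inter ?_ (isClosed_compl_iff.2 (hR n))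
    exact isClosed_Icc.preimage (continuous_fst.sub continuous_const)

end TwistedSections

/-! ### Deformations of loops in a tube -/

section Lifting

variable {F : Type*} [NormedAddCommGroup F] [NormedSpace ℝ F] {A : F ≃L[ℝ] F}
  {E : Type*} [NormedAddCommGroup E] [NormedSpace ℝ E]
  {M : Type*} [TopologicalSpace M] [ChartedSpace E M] {Φ : ℝ × F → M}

/-- Deformations of a loop lift uniquely through a local diffeomorphism from a vector bundle over
the circle. -/
theorem exists_smooth_lift (hΦ : ∀ t x, Φ (t + 1, x) = Φ (t, A x)) (x₀ : twistedSections A)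
    (h₀ : ∀ t, IsLocalDiffeomorphAt 𝓘(ℝ, ℝ × F) 𝓘(ℝ, E) ∞ Φ (t, x₀.1 t)) {g : ℝ × ℝ → M}
    (hg : ContMDiff 𝓘(ℝ, ℝ × ℝ) 𝓘(ℝ, E) ∞ g) (hper : ∀ u t, g (u, t + 1) = g (u, t)) {u₀ : ℝ}
    (hg₀ : ∀ t, g (u₀, t) = Φ (t, x₀.1 t)) :
    ∃ U ∈ 𝓝 u₀, IsOpen U ∧ ∃ l : ℝ × ℝ → ℝ × F, ContDiffOn ℝ ∞ l (U ×ˢ univ) ∧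
      (∀ u ∈ U, ∀ t, Φ (l (u, t)) = g (u, t)) ∧
      (∀ u ∈ U, ∀ t, IsLocalDiffeomorphAt 𝓘(ℝ, ℝ × F) 𝓘(ℝ, E) ∞ Φ (l (u, t))) ∧
      (∀ t, l (u₀, t) = (t, x₀.1 t)) ∧
      ∀ u ∈ U, ∀ t, l (u, t + 1) = ((l (u, t)).1 + 1, A.symm (l (u, t)).2) := by
  have hx₀c : Continuous x₀.1 := x₀.2.1.continuous
  -- The Lebesgue number lemma, on the compact piece of the graph over `[0, 1]`, gives one radius on
  -- which `Φ` is injective and a local diffeomorphism.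
  obtain ⟨r, hr, hball⟩ : ∃ r > 0, ∀ s ∈ Icc (0 : ℝ) 1,
      InjOn Φ (Metric.ball (s, x₀.1 s) r) ∧ Metric.ball (s, x₀.1 s) r ⊆
        {z | IsLocalDiffeomorphAt 𝓘(ℝ, ℝ × F) 𝓘(ℝ, E) ∞ Φ z} := by
    have hK : IsCompact ((fun s => (s, x₀.1 s)) '' Icc (0 : ℝ) 1) :=
      isCompact_Icc.image (by fun_prop)
    have hU : ∀ s : ℝ, ∃ U : Set (ℝ × F), IsOpen U ∧ (s, x₀.1 s) ∈ U ∧ InjOn Φ U ∧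
        U ⊆ {z | IsLocalDiffeomorphAt 𝓘(ℝ, ℝ × F) 𝓘(ℝ, E) ∞ Φ z} := by
      intro s
      obtain ⟨U, hU, hinj⟩ := (h₀ s).exists_injOn
      obtain ⟨V, hV, hVo, hsV⟩ := mem_nhds_iff.1 (inter_mem hU (h₀ s).eventually)
      exact ⟨V, hVo, hsV, hinj.mono fun z hz => (hV hz).1, fun z hz => (hV hz).2⟩
    choose U hUo hsU hinj hgood using hU
    obtain ⟨r, hr, h⟩ := lebesgue_number_lemma_of_metric hK hUo (by
      rintro _ ⟨s, -, rfl⟩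
      exact mem_iUnion.2 ⟨s, hsU s⟩)
    refine ⟨r, hr, fun s hs => ?_⟩
    obtain ⟨i, hi⟩ := h _ ⟨s, hs, rfl⟩
    exact ⟨(hinj i).mono hi, hi.trans (hgood i)⟩
  -- `(s, z) ∈ R` says that `z` is `r`-close to the graph point over `s`, measured after a deck
  -- transformation that moves `s` into `[0, 1]`. At integers there are two such transformations,
  -- and asking for both makes `R` open; any one of them suffices for uniqueness.
  set R : Set (ℝ × (ℝ × F)) := {q | ∀ n : ℤ, q.1 - n ∈ Icc (0 : ℝ) 1 →
    (q.2.1 - n, (A ^ n) q.2.2) ∈ Metric.ball (q.1 - n, x₀.1 (q.1 - n)) r} with hR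
  have hRo : IsOpen R := by
    refine isOpen_forall_sub_intCast_mem_Icc _ fun n => ?_
    simp only [Metric.mem_ball]
    exact isOpen_lt (by fun_prop) continuous_const
  have hRuniq : ∀ s z z', (s, z) ∈ R → (s, z') ∈ R → Φ z = Φ z' → z = z' := by
    intro s z z' hz hz' h
    have hn : s - (⌊s⌋ : ℤ) ∈ Icc (0 : ℝ) 1 :=
      ⟨Int.fract_nonneg s, (Int.fract_lt_one s).le⟩
    have h1 := (hball _ hn).1 (hz _ hn) (hz' _ hn) (by
      simpa only [apply_shift_intCast hΦ] using h)
    simp only [Prod.mk.injEq, sub_left_inj, EmbeddingLike.apply_eq_iff_eq] at h1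
    exact Prod.ext h1.1 h1.2
  have hRgood : ∀ s z, (s, z) ∈ R → IsLocalDiffeomorphAt 𝓘(ℝ, ℝ × F) 𝓘(ℝ, E) ∞ Φ z := by
    intro s z hz
    have hn : s - (⌊s⌋ : ℤ) ∈ Icc (0 : ℝ) 1 :=
      ⟨Int.fract_nonneg s, (Int.fract_lt_one s).le⟩
    exact (isLocalDiffeomorphAt_shift_iff hΦ _ z.1 z.2).1 ((hball _ hn).2 (hz _ hn))
  have hR₀ : ∀ s, (s, (s, x₀.1 s)) ∈ R := by
    intro s n _
    simp only [twistedSections_apply_sub_intCast]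
    exact Metric.mem_ball_self hr
  have hRper : ∀ s z, (s, z) ∈ R → (s + 1, (z.1 + 1, A.symm z.2)) ∈ R := by
    intro s z hz n hn
    have h1 := hz (n - 1) (by push_cast; convert hn using 1; ring)
    push_cast at h1
    have h2 : (A ^ n) (A.symm z.2) = (A ^ (n - 1)) z.2 := by
      rw [zpow_sub_one]; rfl
    simp only [h2, show z.1 + 1 - (n : ℝ) = z.1 - (n - 1) by ring,
      show s + 1 - (n : ℝ) = s - (n - 1) by ring]
    exact h1
  -- Existence of a lift close to the core: apply a local inverse of `Φ` to `g`, uniformly in `s` by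
  -- compactness.
  have hex : ∀ᶠ u in 𝓝 u₀, ∀ s ∈ Icc (0 : ℝ) 1, ∃ z, (s, z) ∈ R ∧ Φ z = g (u, s) := by
    refine isCompact_Icc.eventually_forall_of_forall_eventually fun s hs => ?_
    obtain ⟨G, hG, hG1, hG2⟩ := (h₀ s).exists_inverse
    have hgc : ContinuousAt g (u₀, s) := hg.continuous.continuousAt
    have hGc : ContinuousAt (fun p : ℝ × ℝ => G (g p)) (u₀, s) := by
      refine ContinuousAt.comp (g := G) ?_ hgc
      rw [hg₀]
      exact hG.self_of_nhds.continuousAt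
    have h1 : ∀ᶠ p : ℝ × ℝ in 𝓝 (u₀, s), (p.2, G (g p)) ∈ R := by
      refine (continuousAt_snd.prodMk hGc).eventually_mem (hRo.mem_nhds ?_)
      simp only [hg₀, hG1.self_of_nhds]
      exact hR₀ s
    have h2 : ∀ᶠ p : ℝ × ℝ in 𝓝 (u₀, s), Φ (G (g p)) = g p := by
      rw [← hg₀] at hG2
      exact hgc.eventually hG2
    filter_upwards [h1, h2] with p hp hp'
    exact ⟨_, hp, hp'⟩
  obtain ⟨U, hU, hUo, hu₀⟩ := mem_nhds_iff.1 hex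
  have hexall : ∀ u ∈ U, ∀ s, ∃ z, (s, z) ∈ R ∧ Φ z = g (u, s) := by
    intro u hu s
    have key : ∀ n : ℤ, ∀ s, (∃ z, (s, z) ∈ R ∧ Φ z = g (u, s)) →
        ∃ z, (s + n, z) ∈ R ∧ Φ z = g (u, s + n) := by
      have hp : Function.Periodic (fun t => g (u, t)) 1 := fun t => hper u t
      intro n s ⟨z, hz, hz'⟩
      refine ⟨(z.1 + n, (A ^ n).symm z.2), fun m hm => ?_, ?_⟩
      · have h1 := hz (m - n) (by push_cast; convert hm using 1; ring)
        push_cast at h1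
        have h2 : (A ^ m) ((A ^ n).symm z.2) = (A ^ (m - n)) z.2 := by
          rw [zpow_sub]; rfl
        simp only [h2, show z.1 + n - (m : ℝ) = z.1 - (m - n) by ring,
          show s + n - (m : ℝ) = s - (m - n) by ring]
        exact h1
      · rw [show g (u, s + n) = g (u, s) from by simpa using hp.int_mul n s, ← hz',
          ← apply_shift_intCast hΦ n]
        simp
    have := key ⌊s⌋ (Int.fract s) (hU hu _ ⟨Int.fract_nonneg s, (Int.fract_lt_one s).le⟩)
    rwa [Int.fract_add_floor] at this
  -- The lift in `R` is unique, so this choice agrees near each point with a local inverse of `Φ`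
  -- composed with `g`. Smoothness and equivariance both follow from uniqueness.
  choose! L hL1 hL2 using hexall
  refine ⟨U, hUo.mem_nhds hu₀, hUo, fun q => L q.1 q.2, ?_, fun u hu t => hL2 u hu t,
    fun u hu t => hRgood _ _ (hL1 u hu t), ?_, ?_⟩
  · rintro ⟨u, s⟩ ⟨hu, -⟩
    simp only at hu
    refine ContDiffAt.contDiffWithinAt ?_
    obtain ⟨G, hG, hG1, hG2⟩ := (hRgood s _ (hL1 u hu s)).exists_inverse
    rw [hL2 u hu] at hG hG2
    have hgc : ContinuousAt g (u, s) := hg.continuous.continuousAt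
    have hGs : ContMDiffAt 𝓘(ℝ, ℝ × ℝ) 𝓘(ℝ, ℝ × F) ∞ (G ∘ g) (u, s) :=
      ContMDiffAt.comp (u, s) hG.self_of_nhds hg.contMDiffAt
    have h1 : ∀ᶠ p : ℝ × ℝ in 𝓝 (u, s), (p.2, G (g p)) ∈ R := by
      refine (continuousAt_snd.prodMk hGs.continuousAt).eventually_mem (hRo.mem_nhds ?_)
      have := hG1.self_of_nhds
      rw [hL2 u hu] at this
      simp only [Function.comp, this]
      exact hL1 u hu s
    refine hGs.contDiffAt.congr_of_eventuallyEq ?_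
    filter_upwards [h1, hgc.eventually hG2,
      continuousAt_fst.preimage_mem_nhds (hUo.mem_nhds hu)] with p hp hp' hpU
    exact hRuniq p.2 _ _ (hL1 p.1 hpU p.2) hp ((hL2 p.1 hpU p.2).trans hp'.symm)
  · intro t
    exact hRuniq t _ _ (hL1 u₀ hu₀ t) (hR₀ t) ((hL2 u₀ hu₀ t).trans (hg₀ t))
  · intro u hu t
    refine hRuniq (t + 1) _ _ (hL1 u hu _) (hRper t _ (hL1 u hu t)) ?_
    rw [hL2 u hu, hper, hΦ, A.apply_symm_apply]
    exact (hL2 u hu t).symm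

end Lifting

/-! ### Families of diffeomorphisms of the circle -/

section InverseFamily

/-- Fibrewise inversion of a smooth family of increasing diffeomorphisms of the circle. -/
theorem exists_smooth_fibrewise_inverse {U : Set ℝ} (hU : IsOpen U) {τ : ℝ × ℝ → ℝ}
    (hτ : ContDiffOn ℝ ∞ τ (U ×ˢ univ)) (hpos : ∀ u ∈ U, ∀ t, 0 < fderiv ℝ τ (u, t) (0, 1))
    (hper : ∀ u ∈ U, ∀ t, τ (u, t + 1) = τ (u, t) + 1) :
    ∃ σ : ℝ × ℝ → ℝ, ContDiffOn ℝ ∞ σ (U ×ˢ univ) ∧ (∀ u ∈ U, ∀ t, σ (u, τ (u, t)) = t) ∧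
      (∀ u ∈ U, ∀ t, τ (u, σ (u, t)) = t) ∧ ∀ u ∈ U, StrictMono fun t => τ (u, t) := by
  have hO : IsOpen (U ×ˢ (univ : Set ℝ)) := hU.prod isOpen_univ
  have hat : ∀ u ∈ U, ∀ t, ContDiffAt ℝ ∞ τ (u, t) := fun u hu t =>
    hτ.contDiffAt (hO.mem_nhds ⟨hu, mem_univ _⟩)
  have hderiv : ∀ u ∈ U, ∀ t, HasDerivAt (fun t => τ (u, t)) (fderiv ℝ τ (u, t) (0, 1)) t := by
    intro u hu t
    have h1 : HasFDerivAt τ (fderiv ℝ τ (u, t)) (u, t) :=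
      ((hat u hu t).differentiableAt (by simp)).hasFDerivAt
    have h2 : HasDerivAt (fun t : ℝ => ((u, t) : ℝ × ℝ)) (0, 1) t :=
      (hasDerivAt_const t u).prodMk (hasDerivAt_id t)
    exact h1.comp_hasDerivAt t h2
  have hmono : ∀ u ∈ U, StrictMono fun t => τ (u, t) := by
    intro u hu
    refine strictMono_of_deriv_pos fun t => ?_
    rw [(hderiv u hu t).deriv]
    exact hpos u hu t
  have hsurj : ∀ u ∈ U, ∀ y, ∃ t, τ (u, t) = y := by
    intro u hu
    -- Values at integers are unbounded in both directions, so the intermediate value theorem gives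
    -- surjectivity.
    have hint : ∀ n : ℤ, τ (u, n) = τ (u, 0) + n := by
      intro n
      induction n using Int.induction_on with
      | zero => simp
      | succ n ih => push_cast at ih ⊢; rw [hper u hu, ih]; ring
      | pred n ih =>
        have := hper u hu (-n - 1)
        push_cast at ih ⊢
        rw [sub_add_cancel, ih] at this
        linarith
    have hcont : Continuous fun t => τ (u, t) :=
      continuous_iff_continuousAt.2 fun t => (hderiv u hu t).continuousAt
    intro y
    have h1 : τ (u, (⌊y - τ (u, 0)⌋ : ℤ)) ≤ y := by
      rw [hint]; linarith [Int.floor_le (y - τ (u, 0))]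
    have h2 : y ≤ τ (u, (⌈y - τ (u, 0)⌉ : ℤ)) := by
      rw [hint]; linarith [Int.le_ceil (y - τ (u, 0))]
    exact mem_range_of_exists_le_of_exists_ge hcont ⟨_, h1⟩ ⟨_, h2⟩
  choose! σ hσ using hsurj
  have hinv : ∀ u ∈ U, ∀ t, σ u (τ (u, t)) = t := fun u hu t =>
    (hmono u hu).injective (hσ u hu _)
  refine ⟨fun q => σ q.1 q.2, ?_, hinv, fun u hu t => hσ u hu t, hmono⟩
  rintro ⟨u, y⟩ ⟨hu, -⟩
  simp only at hu
  refine ContDiffAt.contDiffWithinAt ?_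
  set t := σ u y with ht
  set c := fderiv ℝ τ (u, t) (0, 1) with hc
  have hc0 : c ≠ 0 := (hpos u hu t).ne'
  set d := fderiv ℝ τ (u, t) (1, 0) with hd
  -- Keeping `u` as a coordinate makes the derivative triangular with diagonal entries `1` and
  -- `∂τ/∂t > 0`; the inverse function theorem for `Λ` then gives smoothness of the fibrewise
  -- inverse jointly in both variables.
  let Λ : ℝ × ℝ → ℝ × ℝ := fun q => (q.1, τ q)
  have hΛ : ContDiffAt ℝ ∞ Λ (u, t) := contDiffAt_fst.prodMk (hat u hu t)
  let e : (ℝ × ℝ) ≃L[ℝ] (ℝ × ℝ) := LinearEquiv.toContinuousLinearEquiv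
    { toFun := fun q => (q.1, d * q.1 + c * q.2)
      invFun := fun q => (q.1, (q.2 - d * q.1) / c)
      map_add' := fun p q => by ext <;> simp; ring
      map_smul' := fun r q => by ext <;> simp; ring
      left_inv := fun q => by ext <;> simp; field_simp
      right_inv := fun q => by ext <;> simp; field_simp; ring }
  have hτ1 : HasFDerivAt τ (fderiv ℝ τ (u, t)) (u, t) :=
    ((hat u hu t).differentiableAt (by simp)).hasFDerivAt
  have he : HasFDerivAt Λ (e : (ℝ × ℝ) →L[ℝ] ℝ × ℝ) (u, t) := by
    have h1 : HasFDerivAt Λ ((ContinuousLinearMap.fst ℝ ℝ ℝ).prod (fderiv ℝ τ (u, t))) (u, t) :=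
      hasFDerivAt_fst.prodMk hτ1
    refine h1.congr_fderiv ?_
    ext <;> simp [e, hc, hd]
  have hn : (∞ : WithTop ℕ∞) ≠ 0 := by simp
  have hyt : Λ (u, t) = (u, y) := Prod.ext rfl (hσ u hu y)
  have hs : HasStrictFDerivAt Λ (e : (ℝ × ℝ) →L[ℝ] ℝ × ℝ) (u, t) := hΛ.hasStrictFDerivAt' he hn
  have hloc := hΛ.to_localInverse he hn
  rw [hyt] at hloc
  have hright := hs.eventually_right_inverse
  rw [hyt] at hright
  refine (contDiffAt_snd.comp _ hloc).congr_of_eventuallyEq ?_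
  filter_upwards [hright, continuousAt_fst.preimage_mem_nhds (hU.mem_nhds hu)] with q hq hqU
  have h1 : (hs.localInverse Λ e (u, t) q).1 = q.1 :=
    (congrArg Prod.fst hq : (Λ _).1 = q.1)
  have h2 : τ (hs.localInverse Λ e (u, t) q) = q.2 :=
    (congrArg Prod.snd hq : (Λ _).2 = q.2)
  have h3 : hs.localInverse Λ e (u, t) q = (q.1, (hs.localInverse Λ e (u, t) q).2) :=
    Prod.ext h1 rfl
  rw [h3] at h2
  have h4 := hinv q.1 hqU (hs.localInverse Λ e (u, t) q).2
  rw [h2] at h4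
  exact h4

end InverseFamily

theorem ContDiffOn.contDiff_slice {X : Type*} [NormedAddCommGroup X] [NormedSpace ℝ X]
    {k : ℝ × ℝ → X} {W : Set ℝ} (hk : ContDiffOn ℝ ∞ k (W ×ˢ univ)) {u : ℝ} (hu : u ∈ W) :
    ContDiff ℝ ∞ fun t => k (u, t) := by
  rw [← contDiffOn_univ]
  exact hk.comp (contDiff_const.prodMk contDiff_id).contDiffOn fun t _ => ⟨hu, mem_univ _⟩

/-! ### From families of loops to families of sections -/

section TubeLoops

variable {F : Type*} [NormedAddCommGroup F] [NormedSpace ℝ F] {A : F ≃L[ℝ] F}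
  {E : Type*} [NormedAddCommGroup E] [NormedSpace ℝ E]
  {M : Type*} [TopologicalSpace M] [ChartedSpace E M] {Φ : ℝ × F → M}

/-- The loop obtained by composing a section with a local diffeomorphism from the total space. -/
def tubeLoop (hΦ : ∀ t x, Φ (t + 1, x) = Φ (t, A x)) (x : twistedSections A)
    (h : ∀ t, IsLocalDiffeomorphAt 𝓘(ℝ, ℝ × F) 𝓘(ℝ, E) ∞ Φ (t, x.1 t)) : Loop 𝓘(ℝ, E) M where
  toFun t := Φ (t, x.1 t)
  smooth t := ContMDiffAt.comp t (h t).contMDiffAt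
    (contDiff_id.prodMk x.2.1).contDiffAt.contMDiffAt
  periodic t := by simp only [hΦ, x.2.2]

/-- A smooth deformation of a loop in a tube consists, up to reparametrization, of loops given by a
smooth family of sections. -/
theorem exists_smooth_sections (hΦ : ∀ t x, Φ (t + 1, x) = Φ (t, A x)) (x₀ : twistedSections A)
    (h₀ : ∀ t, IsLocalDiffeomorphAt 𝓘(ℝ, ℝ × F) 𝓘(ℝ, E) ∞ Φ (t, x₀.1 t))
    {g : ℝ → Loop 𝓘(ℝ, E) M} (hg : IsSmoothCurve g) {u₀ : ℝ}
    (hg₀ : Loop.Reparam (tubeLoop hΦ x₀ h₀) (g u₀)) :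
    ∃ U ∈ 𝓝 u₀, IsOpen U ∧ ∃ x : ℝ → twistedSections A, x u₀ = x₀ ∧
      ContDiffOn ℝ ∞ (fun q : ℝ × ℝ => (x q.1).1 q.2) (U ×ˢ univ) ∧
      ∀ᶠ u in 𝓝 u₀, ∃ h : ∀ t, IsLocalDiffeomorphAt 𝓘(ℝ, ℝ × F) 𝓘(ℝ, E) ∞ Φ (t, (x u).1 t),
        Loop.Reparam (tubeLoop hΦ (x u) h) (g u) := by
  obtain ⟨φ, hφm, hφp, hφ⟩ := hg₀
  have hφp' : ∀ t, φ.symm (t + 1) = φ.symm t + 1 := fun t => φ.injective (by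
    simp [hφp, Diffeomorph.apply_symm_apply])
  -- Undoing `φ` for all `u` at once makes the family start exactly at the parametrized loop `t ↦ Φ
  -- (t, x₀ t)`, as the lifting theorem requires.
  have hg' : ContMDiff 𝓘(ℝ, ℝ × ℝ) 𝓘(ℝ, E) ∞
      fun q : ℝ × ℝ => (g q.1).toFun (φ.symm q.2) := by
    have h1 : ContDiff ℝ ∞ fun q : ℝ × ℝ => (q.1, φ.symm q.2) :=
      contDiff_fst.prodMk (φ.symm.contMDiff.contDiff.comp contDiff_snd)
    exact ContMDiff.comp (g := fun q : ℝ × ℝ => (g q.1).toFun q.2) hg h1.contMDiff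
  obtain ⟨U, hU, hUo, l, hl, hlg, hlgood, hl₀, hlp⟩ := exists_smooth_lift hΦ x₀ h₀ hg'
    (fun u t => by simp only [hφp']; exact (g u).periodic _) (u₀ := u₀)
    (fun t => by simp only [hφ, Diffeomorph.apply_symm_apply]; rfl)
  have hO : IsOpen (U ×ˢ (univ : Set ℝ)) := hUo.prod isOpen_univ
  -- The lift `l (u, ·)` is a graph up to the parameter change `τ (u, ·)`. This is the identity at
  -- `u₀`, hence an increasing diffeomorphism for nearby `u`.
  set τ : ℝ × ℝ → ℝ := fun q => (l q).1 with hτdef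
  have hτ : ContDiffOn ℝ ∞ τ (U ×ˢ univ) := contDiff_fst.comp_contDiffOn hl
  have hτp : ∀ u ∈ U, ∀ t, τ (u, t + 1) = τ (u, t) + 1 := fun u hu t => by
    simp only [hτdef, hlp u hu]
  have hat : ∀ u ∈ U, ∀ t, ContDiffAt ℝ ∞ τ (u, t) := fun u hu t =>
    hτ.contDiffAt (hO.mem_nhds ⟨hu, mem_univ _⟩)
  have hderiv : ∀ u ∈ U, ∀ t, HasDerivAt (fun t => τ (u, t)) (fderiv ℝ τ (u, t) (0, 1)) t := by
    intro u hu t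
    have h1 : HasFDerivAt τ (fderiv ℝ τ (u, t)) (u, t) :=
      ((hat u hu t).differentiableAt (by simp)).hasFDerivAt
    have h2 : HasDerivAt (fun t : ℝ => ((u, t) : ℝ × ℝ)) (0, 1) t :=
      (hasDerivAt_const t u).prodMk (hasDerivAt_id t)
    exact h1.comp_hasDerivAt t h2
  have hu₀ : u₀ ∈ U := mem_of_mem_nhds hU
  have hpos : ∀ᶠ u in 𝓝 u₀, ∀ t ∈ Icc (0 : ℝ) 1, 0 < fderiv ℝ τ (u, t) (0, 1) := by
    refine isCompact_Icc.eventually_forall_of_forall_eventually fun t _ => ?_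
    have h1 : ContinuousAt (fun q => fderiv ℝ τ q (0, 1)) (u₀, t) :=
      ((hat u₀ hu₀ t).fderiv_right (m := 0) (by simp)).continuousAt.clm_apply continuousAt_const
    refine h1.eventually (lt_mem_nhds ?_)
    have h2 : (fun t => τ (u₀, t)) = id := funext fun t => by simp [hτdef, hl₀]
    have h3 := hderiv u₀ hu₀ t
    rw [h2] at h3
    simp only [h3.unique (hasDerivAt_id t), one_pos]
  obtain ⟨W, hW, hWo, hu₀W⟩ := mem_nhds_iff.1 (inter_mem hU hpos)
  have hWU : W ⊆ U := fun u hu => (hW hu).1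
  have hpos' : ∀ u ∈ W, ∀ t, 0 < fderiv ℝ τ (u, t) (0, 1) := by
    intro u hu t
    have hp : Function.Periodic (fun t => fderiv ℝ τ (u, t) (0, 1)) 1 := by
      intro t
      have h1 := (hderiv u (hWU hu) (t + 1)).comp_add_const t 1
      have h2 := (hderiv u (hWU hu) t).add_const 1
      have h3 : (fun t => τ (u, t + 1)) = fun t => τ (u, t) + 1 :=
        funext fun t => hτp u (hWU hu) t
      rw [h3] at h1
      exact h1.unique h2
    have h1 := hp.int_mul ⌊t⌋ (Int.fract t)
    simp only [mul_one, Int.fract_add_floor] at h1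
    rw [h1]
    exact (hW hu).2 _ ⟨Int.fract_nonneg t, (Int.fract_lt_one t).le⟩
  have hsub : W ×ˢ (univ : Set ℝ) ⊆ U ×ˢ univ := prod_mono hWU subset_rfl
  obtain ⟨σ, hσ, hσl, hσr, hmono⟩ := exists_smooth_fibrewise_inverse hWo (hτ.mono hsub) hpos'
    fun u hu => hτp u (hWU hu)
  have hσp : ∀ u ∈ W, ∀ t, σ (u, t + 1) = σ (u, t) + 1 := by
    intro u hu t
    rw [← hσl u hu (σ (u, t) + 1), hτp u (hWU hu), hσr u hu]
  have hσc : ContDiffOn ℝ ∞ (fun q : ℝ × ℝ => ((q.1, σ q) : ℝ × ℝ)) (W ×ˢ univ) :=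
    contDiffOn_fst.prodMk hσ
  have hx : ContDiffOn ℝ ∞ (fun q : ℝ × ℝ => (l (q.1, σ q)).2) (W ×ˢ univ) :=
    contDiff_snd.comp_contDiffOn (hl.comp hσc fun q hq => ⟨hWU hq.1, mem_univ _⟩)
  have hsec : ∀ u ∈ W, (fun t => (l (u, σ (u, t))).2) ∈ twistedSections A := by
    intro u hu
    refine ⟨hx.contDiff_slice hu, fun t => ?_⟩
    simp only [hσp u hu, hlp u (hWU hu), A.apply_symm_apply]
  classical
  refine ⟨W, hWo.mem_nhds hu₀W, hWo, fun u => if hu : u ∈ W then ⟨_, hsec u hu⟩ else x₀, ?_, ?_, ?_⟩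
  · simp only [hu₀W, dif_pos]
    refine Subtype.ext (funext fun t => ?_)
    have := hσl u₀ hu₀W t
    simp only [hτdef, hl₀] at this
    simp only [hl₀, this]
  · refine hx.congr ?_
    rintro ⟨u, t⟩ ⟨hu, -⟩
    simp only at hu
    simp [hu]
  · filter_upwards [hWo.mem_nhds hu₀W] with u hu
    simp only [hu, dif_pos]
    have hl1 : ∀ t, (t, (l (u, σ (u, t))).2) = l (u, σ (u, t)) := fun t =>
      Prod.ext (hσr u hu t).symm rfl
    refine ⟨fun t => ?_, ?_⟩
    · rw [hl1]
      exact hlgood u (hWU hu) _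
    · let ψ : ℝ ≃ₘ^∞⟮𝓘(ℝ, ℝ), 𝓘(ℝ, ℝ)⟯ ℝ :=
        { toFun := fun t => τ (u, t)
          invFun := fun t => σ (u, t)
          left_inv := hσl u hu
          right_inv := hσr u hu
          contMDiff_toFun := ((hτ.mono hsub).contDiff_slice hu).contMDiff
          contMDiff_invFun := (hσ.contDiff_slice hu).contMDiff }
      refine ⟨φ.trans ψ, (hmono u hu).comp hφm, fun t => ?_, fun t => ?_⟩
      · change τ (u, φ (t + 1)) = τ (u, φ t) + 1
        rw [hφp, hτp u (hWU hu)]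
      · change (g u).toFun t = Φ (τ (u, φ t), (l (u, σ (u, τ (u, φ t)))).2)
        rw [hl1, hσl u hu, hlg u (hWU hu), φ.symm_apply_apply]

end TubeLoops

/-! ### Stability of singular knots -/

/-! ### Zeros of functions of finite order -/

section Analysis

theorem ContDiffOn.iteratedDeriv_snd {O : Set (ℝ × ℝ)} (hO : IsOpen O) {h : ℝ × ℝ → ℝ}
    (hh : ContDiffOn ℝ ∞ h O) (n : ℕ) :
    ContDiffOn ℝ ∞ (fun q : ℝ × ℝ => iteratedDeriv n (fun s => h (q.1, s)) q.2) O := by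
  induction n with
  | zero => simpa using hh
  | succ n ih =>
    simp only [iteratedDeriv_succ]
    set k : ℝ × ℝ → ℝ := fun q => iteratedDeriv n (fun s => h (q.1, s)) q.2 with hk
    have h1 : ContDiffOn ℝ ∞ (fun q => fderiv ℝ k q (0, 1)) O :=
      (ih.fderiv_of_isOpen hO (by simp)).clm_apply contDiffOn_const
    refine h1.congr fun q hq => ?_
    have h2 : HasFDerivAt k (fderiv ℝ k q) (q.1, q.2) :=
      ((ih.contDiffAt (hO.mem_nhds hq)).differentiableAt (by simp)).hasFDerivAt
    have h3 : HasDerivAt (fun t : ℝ => ((q.1, t) : ℝ × ℝ)) (0, 1) q.2 :=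
      (hasDerivAt_const _ _).prodMk (hasDerivAt_id _)
    exact (h2.comp_hasDerivAt q.2 h3).deriv

/-- Rolle: by continuity `p` is itself a zero, and strictly between `p` and a nearby zero lies a
zero of the derivative, different from `p`. -/
theorem AccPt.zeros_deriv {h : ℝ → ℝ} {p : ℝ} (hc : ∀ᶠ y in 𝓝 p, ContinuousAt h y)
    (hp : AccPt p (𝓟 {y | h y = 0})) : AccPt p (𝓟 {y | deriv h y = 0}) := by
  rw [accPt_iff_nhds] at hp ⊢
  have hp0 : h p = 0 := by
    by_contra hne
    have h1 : ∀ᶠ y in 𝓝 p, h y ≠ 0 :=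
      hc.self_of_nhds.eventually_ne hne
    obtain ⟨y, ⟨hy, hy0⟩, -⟩ := hp _ h1
    exact hy hy0
  intro U hU
  obtain ⟨ε, hε, hball⟩ := Metric.mem_nhds_iff.1 (inter_mem hU hc)
  obtain ⟨y, ⟨hy, hy0⟩, hne⟩ := hp _ (Metric.ball_mem_nhds p hε)
  have hsub : ∀ z ∈ uIcc p y, z ∈ Metric.ball p ε := fun z hz => by
    have h1 := abs_sub_left_of_mem_uIcc hz
    rw [Metric.mem_ball, Real.dist_eq] at hy ⊢
    rw [abs_sub_comm] at hy
    rw [abs_sub_comm p y] at hy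
    exact h1.trans_lt hy
  have hcont : ContinuousOn h (uIcc p y) := fun z hz =>
    (hball (hsub z hz)).2.continuousWithinAt
  rcases lt_or_gt_of_ne hne with hlt | hlt
  · rw [uIcc_of_ge hlt.le] at hcont hsub
    obtain ⟨c, hc, hc0⟩ := exists_deriv_eq_zero hlt hcont (hy0.trans hp0.symm)
    exact ⟨c, ⟨(hball (hsub c (Ioo_subset_Icc_self hc))).1, hc0⟩, hc.2.ne⟩
  · rw [uIcc_of_le hlt.le] at hcont hsub
    obtain ⟨c, hc, hc0⟩ := exists_deriv_eq_zero hlt hcont (hp0.trans hy0.symm)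
    exact ⟨c, ⟨(hball (hsub c (Ioo_subset_Icc_self hc))).1, hc0⟩, hc.1.ne'⟩

/-- A function with a nowhere vanishing higher derivative has finitely many zeros on a compact
set. -/
theorem finite_zeros_of_iteratedDeriv_ne_zero {h : ℝ → ℝ} {K : Set ℝ} (hK : IsCompact K) {n : ℕ}
    (hc : ∀ k ≤ n, ∀ x ∈ K, ∀ᶠ y in 𝓝 x, ContinuousAt (iteratedDeriv k h) y)
    (hne : ∀ x ∈ K, iteratedDeriv n h x ≠ 0) : {x ∈ K | h x = 0}.Finite := by
  by_contra hinf
  obtain ⟨p, hpK, hp⟩ := Set.Infinite.exists_accPt_of_subset_isCompact hinf hK (sep_subset _ _)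
  have hp' : AccPt p (𝓟 {x | h x = 0}) := hp.mono (principal_mono.2 fun x hx => hx.2)
  have key : ∀ k ≤ n, AccPt p (𝓟 {x | iteratedDeriv k h x = 0}) := by
    intro k hk
    induction k with
    | zero => simpa using hp'
    | succ k ih =>
      rw [iteratedDeriv_succ]
      exact (ih (by omega)).zeros_deriv (hc k (by omega) p hpK)
  have h1 := accPt_iff_nhds.1 (key n le_rfl) _
    ((hc n le_rfl p hpK).self_of_nhds.eventually_ne (hne p hpK))
  obtain ⟨y, ⟨hy, hy0⟩, -⟩ := h1
  exact hy hy0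

end Analysis

/-! ### Extension of germs of functions -/

section Extension

variable {E : Type*} [NormedAddCommGroup E] [NormedSpace ℝ E] [FiniteDimensional ℝ E]
  {M : Type*} [TopologicalSpace M] [ChartedSpace E M] [IsManifold 𝓘(ℝ, E) ∞ M] [T2Space M]

/-- Multiplication by a bump function supported where `k` is smooth. Finite contact is tested by
globally defined functions, while perturbation yields only germs. -/
theorem exists_contMDiff_eventuallyEq {k : M → ℝ} {p : M}
    (hk : ∀ᶠ q in 𝓝 p, ContMDiffAt 𝓘(ℝ, E) 𝓘(ℝ, ℝ) ∞ k q) :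
    ∃ k' : M → ℝ, ContMDiff 𝓘(ℝ, E) 𝓘(ℝ, ℝ) ∞ k' ∧ k' =ᶠ[𝓝 p] k := by
  obtain ⟨f, -, hf⟩ := (SmoothBumpFunction.nhds_basis_tsupport (I := 𝓘(ℝ, E)) p).mem_iff.1 hk
  refine ⟨fun q => f q • k q, ?_, ?_⟩
  · refine contMDiff_of_tsupport fun q hq => ?_
    exact f.contMDiffAt.smul (hf (tsupport_smul_subset_left f k hq))
  · filter_upwards [f.eventuallyEq_one] with q hq
    simp [hq]

end Extension

/-! ### Double points of singular knots -/

section SingularKnots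

variable {E : Type*} [NormedAddCommGroup E] [NormedSpace ℝ E]
  {M : Type*} [TopologicalSpace M] [ChartedSpace E M]

theorem Loop.onCircle_coe (γ : Loop 𝓘(ℝ, E) M) (t : ℝ) :
    γ.onCircle (t : AddCircle (1 : ℝ)) = γ.toFun t :=
  γ.periodic.lift_coe t

theorem Loop.continuous_onCircle (γ : Loop 𝓘(ℝ, E) M) : Continuous γ.onCircle :=
  continuous_coinduced_dom.2 γ.smooth.continuous

theorem AddCircle.coe_eq_coe_iff_exists_int {s t : ℝ} :
    (s : AddCircle (1 : ℝ)) = t ↔ ∃ n : ℤ, s = t + n := by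
  rw [← sub_eq_zero, ← AddCircle.coe_sub, AddCircle.coe_eq_zero_iff]
  refine exists_congr fun n => ?_
  rw [zsmul_eq_mul, mul_one]
  constructor <;> intro h <;> linarith

/-- Points outside the exceptional set are not double points. -/
theorem Loop.onCircle_ne_of_notMem [T2Space M] (γ : Loop 𝓘(ℝ, E) M)
    {A : Set (AddCircle (1 : ℝ))} (hA : A.Finite) (hemb : IsEmbedding (Aᶜ.domRestrict γ.onCircle))
    {a b : AddCircle (1 : ℝ)} (ha : a ∉ A) (hab : b ≠ a) : γ.onCircle b ≠ γ.onCircle a := by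
  intro h
  -- If `γ b = γ a`, approach `b` by points outside the finite set `A`. Their images converge to `γ
  -- a`, so the embedding property forces them to converge to `a` as well, and `b = a`.
  have hdense : Dense Aᶜ := by
    have : Nontrivial (AddCircle (1 : ℝ)) := ⟨a, b, hab.symm⟩
    have := Dense.sdiff_finite (dense_univ (X := AddCircle (1 : ℝ))) hA
    rwa [← compl_eq_univ_sdiff] at this
  have hb : b ∈ closure Aᶜ := hdense b
  have hne : (comap ((↑) : (Aᶜ : Set (AddCircle (1 : ℝ))) → AddCircle (1 : ℝ)) (𝓝 b)).NeBot :=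
    mem_closure_iff_comap_neBot.1 hb
  set l := comap ((↑) : (Aᶜ : Set (AddCircle (1 : ℝ))) → AddCircle (1 : ℝ)) (𝓝 b)
  have h1 : Tendsto (Aᶜ.domRestrict γ.onCircle) l (𝓝 (Aᶜ.domRestrict γ.onCircle ⟨a, ha⟩)) := by
    change Tendsto (γ.onCircle ∘ (↑)) l (𝓝 (γ.onCircle a))
    rw [← h]
    exact (γ.continuous_onCircle.tendsto b).comp tendsto_comap
  have h2 : Tendsto id l (𝓝 (⟨a, ha⟩ : (Aᶜ : Set (AddCircle (1 : ℝ))))) :=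
    hemb.isInducing.tendsto_nhds_iff.2 h1
  have h3 : Tendsto (fun c : (Aᶜ : Set (AddCircle (1 : ℝ))) => (c : AddCircle (1 : ℝ))) l (𝓝 a) :=
    (continuous_subtype_val.tendsto _).comp h2
  exact hab (tendsto_nhds_unique tendsto_comap h3)

/-- Both parameters of a double point lie in the exceptional set, where the contact condition is
imposed; so the condition holds at every double point, whatever the exceptional set. -/
theorem Loop.IsSingularKnot.finiteContact [T2Space M] {γ : Loop 𝓘(ℝ, E) M}
    (hγ : γ.IsSingularKnot) {s t : ℝ} (hst : (s : AddCircle (1 : ℝ)) ≠ t)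
    (h : γ.toFun s = γ.toFun t) : γ.FiniteContact s t := by
  obtain ⟨A, hA, hemb, hcon⟩ := hγ.exceptional
  rw [← γ.onCircle_coe, ← γ.onCircle_coe] at h
  refine hcon s t ?_ ?_ hst (by rwa [γ.onCircle_coe, γ.onCircle_coe] at h)
  · by_contra hs
    exact γ.onCircle_ne_of_notMem hA hemb hs hst.symm h.symm
  · by_contra ht
    exact γ.onCircle_ne_of_notMem hA hemb ht hst h

/-- A finite exceptional set misses some point of the open interval. This point serves to anchor
parametrizations when charts are shown to be injective. -/
theorem Loop.IsSingularKnot.exists_simple_point [T2Space M] {γ : Loop 𝓘(ℝ, E) M}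
    (hγ : γ.IsSingularKnot) : ∃ t₀ ∈ Ioo (0 : ℝ) 1, ∀ t, γ.toFun t = γ.toFun t₀ →
      (t : AddCircle (1 : ℝ)) = t₀ := by
  obtain ⟨A, hA, hemb, -⟩ := hγ.exceptional
  have hinf : (((↑) : ℝ → AddCircle (1 : ℝ)) '' Ioo (0 : ℝ) 1).Infinite := by
    refine (Ioo_infinite one_pos).image ?_
    intro s hs t ht hst
    exact (AddCircle.coe_eq_coe_iff_of_mem_Ico (a := 0) (p := 1)
      ⟨hs.1.le, by simpa using hs.2⟩ ⟨ht.1.le, by simpa using ht.2⟩).1 hst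
  obtain ⟨_, ⟨t₀, ht₀, rfl⟩, hA₀⟩ := (hinf.sdiff hA).nonempty
  refine ⟨t₀, ht₀, fun t ht => ?_⟩
  by_contra hne
  rw [← γ.onCircle_coe, ← γ.onCircle_coe] at ht
  exact γ.onCircle_ne_of_notMem hA hemb hA₀ hne ht

theorem Loop.FiniteContact.add_int {γ : Loop 𝓘(ℝ, E) M} {s t : ℝ} (h : γ.FiniteContact s t)
    (m n : ℤ) : γ.FiniteContact (s + m) (t + n) := by
  obtain ⟨g, hg, hv, k, hk⟩ := h
  have hp : ∀ (m : ℤ) (t : ℝ), γ.toFun (t + m) = γ.toFun t := fun m t => by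
    simpa using γ.periodic.int_mul m t
  refine ⟨g, hg, ?_, k, ?_⟩
  · have h1 : Tendsto (fun r : ℝ => r + ((-n : ℤ) : ℝ)) (𝓝 (t + n)) (𝓝 t) := by
      have h2 : Continuous fun r : ℝ => r + ((-n : ℤ) : ℝ) := by fun_prop
      simpa using h2.tendsto (t + n)
    filter_upwards [h1.eventually hv] with r hr
    rwa [hp] at hr
  · have h1 : g ∘ γ.toFun = fun r => (g ∘ γ.toFun) (r + ((-m : ℤ) : ℝ)) := by
      ext r; simp only [Function.comp, hp]
    rw [h1, iteratedDeriv_comp_add_const]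
    simpa using hk

end SingularKnots

/-! ### Persistence of finite contact under deformation -/

section Stability

variable {F : Type*} [NormedAddCommGroup F] [NormedSpace ℝ F] {A : F ≃L[ℝ] F}
  {E : Type*} [NormedAddCommGroup E] [NormedSpace ℝ E]
  {M : Type*} [TopologicalSpace M] [ChartedSpace E M] {Φ : ℝ × F → M}

theorem mfderiv_comp_apply_one {P : Type*} [NormedAddCommGroup P] [NormedSpace ℝ P] {Ψ : P → M}
    {c : ℝ → P} {t : ℝ} {v : P} (hΨ : MDifferentiableAt 𝓘(ℝ, P) 𝓘(ℝ, E) Ψ (c t))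
    (hc : HasDerivAt c v t) :
    mfderiv 𝓘(ℝ, ℝ) 𝓘(ℝ, E) (Ψ ∘ c) t (1 : ℝ) = mfderiv 𝓘(ℝ, P) 𝓘(ℝ, E) Ψ (c t) v := by
  rw [(hΨ.hasMFDerivAt.comp t hc.hasFDerivAt.hasMFDerivAt).mfderiv]
  exact congrArg (mfderiv 𝓘(ℝ, P) 𝓘(ℝ, E) Ψ (c t)) (one_smul ℝ v)

theorem eventually_forall_isLocalDiffeomorphAt (hΦ : ∀ t x, Φ (t + 1, x) = Φ (t, A x))
    {x : ℝ → twistedSections A} {U : Set ℝ} (hU : IsOpen U) {u₀ : ℝ} (hu₀ : u₀ ∈ U)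
    (hx : ContDiffOn ℝ ∞ (fun q : ℝ × ℝ => (x q.1).1 q.2) (U ×ˢ univ))
    (h₀ : ∀ t, IsLocalDiffeomorphAt 𝓘(ℝ, ℝ × F) 𝓘(ℝ, E) ∞ Φ (t, (x u₀).1 t)) :
    ∀ᶠ u in 𝓝 u₀, ∀ t, IsLocalDiffeomorphAt 𝓘(ℝ, ℝ × F) 𝓘(ℝ, E) ∞ Φ (t, (x u).1 t) := by
  have h1 : ∀ᶠ u in 𝓝 u₀, ∀ t ∈ Icc (0 : ℝ) 1,
      IsLocalDiffeomorphAt 𝓘(ℝ, ℝ × F) 𝓘(ℝ, E) ∞ Φ (t, (x u).1 t) := by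
    refine isCompact_Icc.eventually_forall_of_forall_eventually fun t _ => ?_
    have hc : ContinuousAt (fun q : ℝ × ℝ => (x q.1).1 q.2) (u₀, t) :=
      (hx.contDiffAt ((hU.prod isOpen_univ).mem_nhds ⟨hu₀, mem_univ _⟩)).continuousAt
    exact (continuousAt_snd.prodMk hc).eventually (h₀ t).eventually
  filter_upwards [h1] with u hu t
  rw [← isLocalDiffeomorphAt_shift_iff hΦ ⌊t⌋ t, ← twistedSections_apply_sub_intCast]
  exact hu _ ⟨Int.fract_nonneg t, (Int.fract_lt_one t).le⟩

/-- The graph of a section has velocity with first coordinate `1`, and the differential of `Φ` is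
injective: loops coming from sections are automatically immersed. -/
theorem tubeLoop_velocity_ne_zero (hΦ : ∀ t x, Φ (t + 1, x) = Φ (t, A x)) (x : twistedSections A)
    (h : ∀ t, IsLocalDiffeomorphAt 𝓘(ℝ, ℝ × F) 𝓘(ℝ, E) ∞ Φ (t, x.1 t)) (t : ℝ) :
    (tubeLoop hΦ x h).velocity t ≠ 0 := by
  intro h0
  have hd : HasDerivAt (fun t => (t, x.1 t)) ((1 : ℝ), deriv x.1 t) t :=
    (hasDerivAt_id t).prodMk (x.2.1.differentiable (by simp)).differentiableAt.hasDerivAt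
  have h1 := mfderiv_comp_apply_one ((h t).mdifferentiableAt (by simp)) hd
  have h2 : mfderiv 𝓘(ℝ, ℝ × F) 𝓘(ℝ, E) Φ (t, x.1 t) ((1 : ℝ), deriv x.1 t) = 0 :=
    h1.symm.trans h0
  have h3 := ((h t).mfderivToContinuousLinearEquiv (by simp)).injective
    (h2.trans (map_zero _).symm)
  exact one_ne_zero (congrArg Prod.fst h3)

/-- Near a double point with finite order of contact, nearby loops of a smooth family have finitely
many double points, again with finite order of contact. -/
theorem exists_nhds_finite_double_points [FiniteDimensional ℝ E] [IsManifold 𝓘(ℝ, E) ∞ M]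
    [T2Space M] {x : ℝ → twistedSections A} {U : Set ℝ} (hU : IsOpen U) {u₀ : ℝ} (hu₀ : u₀ ∈ U)
    (hx : ContDiffOn ℝ ∞ (fun q : ℝ × ℝ => (x q.1).1 q.2) (U ×ˢ univ))
    (hgood : ∀ u ∈ U, ∀ t, IsLocalDiffeomorphAt 𝓘(ℝ, ℝ × F) 𝓘(ℝ, E) ∞ Φ (t, (x u).1 t))
    {s₀ t₀ : ℝ} (hst : Φ (s₀, (x u₀).1 s₀) = Φ (t₀, (x u₀).1 t₀)) {g : M → ℝ}
    (hg : ContMDiff 𝓘(ℝ, E) 𝓘(ℝ, ℝ) ∞ g) (hgv : ∀ᶠ t in 𝓝 t₀, g (Φ (t, (x u₀).1 t)) = 0) {n : ℕ}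
    (hn : iteratedDeriv n (fun s => g (Φ (s, (x u₀).1 s))) s₀ ≠ 0) :
    ∃ W₁ ∈ 𝓝 s₀, ∃ W₂ ∈ 𝓝 t₀, ∀ᶠ u in 𝓝 u₀,
      {s ∈ W₁ | ∃ t ∈ W₂, Φ (s, (x u).1 s) = Φ (t, (x u).1 t)}.Finite ∧
      ∀ s ∈ W₁, ∀ t ∈ W₂, Φ (s, (x u).1 s) = Φ (t, (x u).1 t) →
        ∃ g' : M → ℝ, ContMDiff 𝓘(ℝ, E) 𝓘(ℝ, ℝ) ∞ g' ∧
          (∀ᶠ r in 𝓝 t, g' (Φ (r, (x u).1 r)) = 0) ∧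
          iteratedDeriv n (fun r => g' (Φ (r, (x u).1 r))) s ≠ 0 := by
  have hO : IsOpen (U ×ˢ (univ : Set ℝ)) := hU.prod isOpen_univ
  have hxat : ∀ u ∈ U, ∀ t, ContDiffAt ℝ ∞ (fun q : ℝ × ℝ => (x q.1).1 q.2) (u, t) :=
    fun u hu t => hx.contDiffAt (hO.mem_nhds ⟨hu, mem_univ _⟩)
  set C : ℝ × ℝ → M := fun q => Φ (q.2, (x q.1).1 q.2) with hC
  have hCat : ∀ u ∈ U, ∀ t, ContMDiffAt 𝓘(ℝ, ℝ × ℝ) 𝓘(ℝ, E) ∞ C (u, t) := fun u hu t =>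
    ContMDiffAt.comp (u, t) (hgood u hu t).contMDiffAt
      (contDiffAt_snd.prodMk (hxat u hu t)).contMDiffAt
  obtain ⟨G, hG, hG1, hG2⟩ := (hgood u₀ hu₀ t₀).exists_inverse
  have hGz : G (Φ (t₀, (x u₀).1 t₀)) = (t₀, (x u₀).1 t₀) := hG1.self_of_nhds
  set p₀ := Φ (t₀, (x u₀).1 t₀) with hp₀
  -- A shear in tube coordinates, carrying the branch of the loop `u` near `t₀` to that of `u₀`.
  -- Pulled back by it, the defining function `g` of the old branch becomes a function `K (u, ·)`
  -- that vanishes on the new branch and equals `g` near `p₀` for `u = u₀`.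
  set Z : ℝ × M → ℝ × F := fun q =>
    ((G q.2).1, (G q.2).2 - (x q.1).1 (G q.2).1 + (x u₀).1 (G q.2).1) with hZ
  have hZ₀ : Z (u₀, p₀) = (t₀, (x u₀).1 t₀) := by simp [hZ, hGz]
  set K : ℝ × M → ℝ := fun q => g (Φ (Z q)) with hK
  have hU₀ : ∀ᶠ q : ℝ × M in 𝓝 (u₀, p₀), q.1 ∈ U :=
    continuousAt_fst.preimage_mem_nhds (hU.mem_nhds hu₀)
  have hGe : ∀ᶠ q : ℝ × M in 𝓝 (u₀, p₀), ContMDiffAt 𝓘(ℝ, E) 𝓘(ℝ, ℝ × F) ∞ G q.2 :=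
    (continuousAt_snd (p := (u₀, p₀))).eventually hG
  have hZc : ContinuousAt Z (u₀, p₀) := by
    have h1 : ContinuousAt (fun q : ℝ × M => G q.2) (u₀, p₀) :=
      ContinuousAt.comp (g := G) hG.self_of_nhds.continuousAt continuousAt_snd
    have h2 : ContinuousAt (fun q : ℝ × M => (x q.1).1 (G q.2).1) (u₀, p₀) :=
      ContinuousAt.comp (g := fun q : ℝ × ℝ => (x q.1).1 q.2)
        (f := fun q : ℝ × M => (q.1, (G q.2).1)) (hxat u₀ hu₀ _).continuousAt
        (continuousAt_fst.prodMk h1.fst)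
    have h3 : ContinuousAt (fun q : ℝ × M => (x u₀).1 (G q.2).1) (u₀, p₀) :=
      (x u₀).2.1.continuous.continuousAt.comp h1.fst
    exact h1.fst.prodMk ((h1.snd.sub h2).add h3)
  have hZgood : ∀ᶠ q in 𝓝 (u₀, p₀), IsLocalDiffeomorphAt 𝓘(ℝ, ℝ × F) 𝓘(ℝ, E) ∞ Φ (Z q) := by
    refine hZc.eventually ?_
    rw [hZ₀]
    exact (hgood u₀ hu₀ t₀).eventually
  have hCc : ∀ u ∈ U, ∀ t, ContinuousAt C (u, t) := fun u hu t => (hCat u hu t).continuousAt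
  have hCs : Tendsto (fun q : ℝ × ℝ => (q.1, C q)) (𝓝 (u₀, s₀)) (𝓝 (u₀, p₀)) := by
    have h1 : C (u₀, s₀) = p₀ := hst
    have h2 := continuousAt_fst.prodMk (hCc u₀ hu₀ s₀)
    rwa [ContinuousAt, h1] at h2
  -- the function `K` is smooth on the slices, and smooth along the family
  have hKslice : ∀ᶠ q in 𝓝 (u₀, p₀), ContMDiffAt 𝓘(ℝ, E) 𝓘(ℝ, ℝ) ∞ (fun p => K (q.1, p)) q.2 := by
    filter_upwards [hU₀, hGe, hZgood] with q hqU hqG hqZ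
    have hZs : ContMDiffAt 𝓘(ℝ, E) 𝓘(ℝ, ℝ × F) ∞ (fun p => Z (q.1, p)) q.2 := by
      have h1 : ContDiff ℝ ∞ fun w : ℝ × F => (w.1, w.2 - (x q.1).1 w.1 + (x u₀).1 w.1) :=
        contDiff_fst.prodMk ((contDiff_snd.sub ((x q.1).2.1.comp contDiff_fst)).add
          ((x u₀).2.1.comp contDiff_fst))
      exact ContMDiffAt.comp q.2 h1.contMDiff.contMDiffAt hqG
    exact ContMDiffAt.comp q.2 hg.contMDiffAt (ContMDiffAt.comp q.2 hqZ.contMDiffAt hZs)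
  -- `H (u, s)` measures the contact of the branch near `s₀` with the branch near `t₀`: its zeros
  -- contain the double points, and its `n`-th derivative in `s` is nonzero at `(u₀, s₀)`, hence
  -- nearby.
  set H : ℝ × ℝ → ℝ := fun q => K (q.1, C q) with hH
  have hHs : ∀ᶠ q in 𝓝 (u₀, s₀), ContDiffAt ℝ ∞ H q := by
    filter_upwards [hCs.eventually hU₀, hCs.eventually hGe, hCs.eventually hZgood] with q h1 h2 h3
    have hw : ContDiffAt ℝ ∞ (fun q => G (C q)) q :=
      (ContMDiffAt.comp q h2 (hCat q.1 h1 q.2)).contDiffAt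
    have hZs : ContDiffAt ℝ ∞ (fun q => Z (q.1, C q)) q := by
      have h4 : ContDiffAt ℝ ∞ (fun q : ℝ × ℝ => (x q.1).1 (G (C q)).1) q :=
        ContDiffAt.comp (g := fun q : ℝ × ℝ => (x q.1).1 q.2) q (hxat q.1 h1 _)
          (contDiffAt_fst.prodMk hw.fst)
      have h5 : ContDiffAt ℝ ∞ (fun q : ℝ × ℝ => (x u₀).1 (G (C q)).1) q :=
        (x u₀).2.1.contDiffAt.comp q hw.fst
      exact hw.fst.prodMk ((hw.snd.sub h4).add h5)
    exact (ContMDiffAt.comp q hg.contMDiffAt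
      (ContMDiffAt.comp (g := Φ) q h3.contMDiffAt hZs.contMDiffAt)).contDiffAt
  obtain ⟨O, hO1, hOo, hOm⟩ := mem_nhds_iff.1 hHs
  have hHO : ContDiffOn ℝ ∞ H O := fun q hq =>
    (show ContDiffAt ℝ ∞ H q from hO1 hq).contDiffWithinAt
  have hHn : ∀ᶠ q : ℝ × ℝ in 𝓝 (u₀, s₀), iteratedDeriv n (fun s => H (q.1, s)) q.2 ≠ 0 := by
    have h1 := ((hHO.iteratedDeriv_snd hOo n).contDiffAt (hOo.mem_nhds hOm)).continuousAt
    refine h1.eventually_ne ?_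
    have h2 : (fun s => H (u₀, s)) =ᶠ[𝓝 s₀] fun s => g (Φ (s, (x u₀).1 s)) := by
      have h3 : Tendsto (fun s => C (u₀, s)) (𝓝 s₀) (𝓝 p₀) := by
        have h4 : ContinuousAt (fun s => C (u₀, s)) s₀ :=
          (hCc u₀ hu₀ s₀).comp (f := fun s : ℝ => (u₀, s)) (by fun_prop)
        have h5 : C (u₀, s₀) = p₀ := hst
        rwa [ContinuousAt, h5] at h4
      filter_upwards [h3.eventually hG2] with s hs
      simp only [hH, hK, hZ, sub_add_cancel]
      rw [Prod.mk.eta, hs]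
    simp only [h2.iteratedDeriv_eq]
    exact hn
  have hKz : ∀ᶠ q : ℝ × ℝ in 𝓝 (u₀, t₀), K (q.1, C q) = 0 := by
    have h1 : ∀ᶠ q : ℝ × ℝ in 𝓝 (u₀, t₀), G (C q) = (q.2, (x q.1).1 q.2) :=
      (continuousAt_snd.prodMk (hxat u₀ hu₀ t₀).continuousAt).eventually hG1
    filter_upwards [h1, (continuousAt_snd (p := (u₀, t₀))).eventually hgv] with q hq hq2
    simp only [hK, hZ, hq, sub_self, zero_add, hq2]
  have hall₁ : ∀ᶠ q in 𝓝 (u₀, s₀), q ∈ O ∧ iteratedDeriv n (fun s => H (q.1, s)) q.2 ≠ 0 ∧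
      ∀ᶠ p in 𝓝 (C q), ContMDiffAt 𝓘(ℝ, E) 𝓘(ℝ, ℝ) ∞ (fun p => K (q.1, p)) p := by
    filter_upwards [hOo.mem_nhds hOm, hHn, hCs.eventually hKslice.eventually_nhds] with q h1 h2 h3
    have h4 : Tendsto (fun p => (q.1, p)) (𝓝 (C q)) (𝓝 (q.1, C q)) :=
      (Continuous.prodMk_right q.1).tendsto _
    exact ⟨h1, h2, h4.eventually h3⟩
  rw [nhds_prod_eq] at hall₁ hKz
  obtain ⟨P₁, hP₁, Q₁, hQ₁, hPQ₁⟩ := eventually_prod_iff.1 hall₁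
  obtain ⟨P₂, hP₂, Q₂, hQ₂, hPQ₂⟩ := eventually_prod_iff.1 hKz
  obtain ⟨ε, hε, hball⟩ := Metric.nhds_basis_closedBall.mem_iff.1 hQ₁
  obtain ⟨W₂, hW₂, hW₂o, ht₀W⟩ := mem_nhds_iff.1 hQ₂
  -- A closed ball, because finiteness of the zeros of `H (u, ·)` needs a compact set.
  refine ⟨Metric.closedBall s₀ ε, Metric.closedBall_mem_nhds _ hε, W₂, hW₂o.mem_nhds ht₀W, ?_⟩
  filter_upwards [hP₁, hP₂, hU.mem_nhds hu₀] with u hu₁ hu₂ huU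
  have hslice : Continuous fun s : ℝ => ((u, s) : ℝ × ℝ) := by fun_prop
  constructor
  · refine Set.Finite.subset (finite_zeros_of_iteratedDeriv_ne_zero
      (h := fun s => H (u, s)) (isCompact_closedBall s₀ ε) (n := n) ?_ ?_) ?_
    · intro k _ s hs
      have h1 : (u, s) ∈ O := (hPQ₁ hu₁ (hball hs)).1
      filter_upwards [hslice.continuousAt.preimage_mem_nhds (hOo.mem_nhds h1)] with r hr
      have h2 := ((hHO.iteratedDeriv_snd hOo k).contDiffAt (hOo.mem_nhds hr)).continuousAt
      exact h2.comp (f := fun s : ℝ => (u, s)) hslice.continuousAt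
    · intro s hs
      exact (hPQ₁ hu₁ (hball hs)).2.1
    · rintro s ⟨hs, t, ht, hst'⟩
      refine ⟨hs, ?_⟩
      have h1 : K (u, C (u, t)) = 0 := hPQ₂ hu₂ (hW₂ ht)
      have h2 : C (u, s) = C (u, t) := hst'
      simp only [hH, h2, h1]
  · intro s hs t ht hst'
    obtain ⟨-, h2, h3⟩ := hPQ₁ hu₁ (hball hs)
    obtain ⟨g', hg', hgK⟩ := exists_contMDiff_eventuallyEq h3
    have hCu : ∀ r, ContinuousAt (fun r => C (u, r)) r := fun r =>
      (hCc u huU r).comp (f := fun r : ℝ => (u, r)) hslice.continuousAt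
    refine ⟨g', hg', ?_, ?_⟩
    · have h4 : C (u, s) = C (u, t) := hst'
      simp only [h4] at hgK
      filter_upwards [(hCu t).eventually hgK, hW₂o.mem_nhds ht] with r hr hr2
      exact hr.trans (hPQ₂ hu₂ (hW₂ hr2))
    · have h4 : (fun r => g' (Φ (r, (x u).1 r))) =ᶠ[𝓝 s] fun r => H (u, r) := (hCu s).eventually hgK
      rw [h4.iteratedDeriv_eq]
      exact h2

/-- A loop whose double points are finite in number, with finite order of contact, is a singular
knot. -/
theorem Loop.isSingularKnot_of_finite [T2Space M] {γ : Loop 𝓘(ℝ, E) M}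
    (himm : ∀ t, γ.velocity t ≠ 0)
    (hfin : {s : ℝ | ∃ t, (s, t) ∈ Icc (0 : ℝ) 1 ×ˢ Icc (0 : ℝ) 1 ∧
      (s : AddCircle (1 : ℝ)) ≠ t ∧ γ.toFun s = γ.toFun t}.Finite)
    (hcon : ∀ s t, (s, t) ∈ Icc (0 : ℝ) 1 ×ˢ Icc (0 : ℝ) 1 → (s : AddCircle (1 : ℝ)) ≠ t →
      γ.toFun s = γ.toFun t → γ.FiniteContact s t) : γ.IsSingularKnot := by
  have hfr : ∀ s : ℝ, ((Int.fract s : ℝ) : AddCircle (1 : ℝ)) = s := fun s =>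
    AddCircle.coe_eq_coe_iff_exists_int.2 ⟨-⌊s⌋, by
      have := Int.fract_add_floor s; push_cast; linarith⟩
  have hI : ∀ s : ℝ, Int.fract s ∈ Icc (0 : ℝ) 1 := fun s =>
    ⟨Int.fract_nonneg s, (Int.fract_lt_one s).le⟩
  -- The exceptional set is the set of all double points.
  refine ⟨himm, {a | ∃ b, a ≠ b ∧ γ.onCircle a = γ.onCircle b}, ?_, ?_, ?_⟩
  · refine (hfin.image ((↑) : ℝ → AddCircle (1 : ℝ))).subset ?_
    rintro a ⟨b, hab, h⟩
    induction a using QuotientAddGroup.induction_on with | H s =>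
    induction b using QuotientAddGroup.induction_on with | H t =>
    refine ⟨Int.fract s, ⟨Int.fract t, ⟨hI s, hI t⟩, ?_, ?_⟩, hfr s⟩
    · rw [hfr, hfr]; exact hab
    · rw [← γ.onCircle_coe, ← γ.onCircle_coe, hfr, hfr]; exact h
  · set A : Set (AddCircle (1 : ℝ)) := {a | ∃ b, a ≠ b ∧ γ.onCircle a = γ.onCircle b} with hA
    have hAc : ∀ a ∈ Aᶜ, ∀ b, γ.onCircle a = γ.onCircle b → a = b := fun a ha b h => by
      by_contra hne
      exact ha ⟨b, hne, h⟩
    have hcont : Continuous (Aᶜ.domRestrict γ.onCircle) :=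
      γ.continuous_onCircle.comp continuous_subtype_val
    refine ⟨⟨le_antisymm hcont.le_induced fun U hU => ?_⟩, fun a b h =>
      Subtype.ext (hAc a.1 a.2 b.1 h)⟩
    obtain ⟨O, hO, rfl⟩ := isOpen_induced_iff.1 hU
    -- The image of the compact set `Oᶜ` is closed. Points outside the exceptional set share their
    -- image with no other point, so removing this image cuts out exactly `O` there.
    refine isOpen_induced_iff.2 ⟨(γ.onCircle '' Oᶜ)ᶜ, ?_, ?_⟩
    · exact (hO.isClosed_compl.isCompact.image γ.continuous_onCircle).isClosed.isOpen_compl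
    · ext a
      simp only [mem_preimage, mem_compl_iff, mem_image, not_exists, not_and, domRestrict_apply]
      refine ⟨fun h => ?_, fun ha b hb h => ?_⟩
      · by_contra ha
        exact h a.1 ha rfl
      · rw [← hAc a.1 a.2 b h.symm] at hb
        exact hb ha
  · intro s t _ _ hst h
    have h1 := (hcon (Int.fract s) (Int.fract t) ⟨hI s, hI t⟩ (by rwa [hfr, hfr])
      (by rwa [← γ.onCircle_coe, ← γ.onCircle_coe, hfr, hfr, γ.onCircle_coe,
        γ.onCircle_coe])).add_int ⌊s⌋ ⌊t⌋
    rwa [Int.fract_add_floor, Int.fract_add_floor] at h1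

/-- Being a singular knot is an open condition along smooth families of sections. -/
theorem eventually_isSingularKnot [FiniteDimensional ℝ E] [IsManifold 𝓘(ℝ, E) ∞ M] [T2Space M]
    (hΦ : ∀ t x, Φ (t + 1, x) = Φ (t, A x)) {x : ℝ → twistedSections A} {U : Set ℝ}
    (hU : IsOpen U) {u₀ : ℝ} (hu₀ : u₀ ∈ U)
    (hx : ContDiffOn ℝ ∞ (fun q : ℝ × ℝ => (x q.1).1 q.2) (U ×ˢ univ))
    (h₀ : ∀ t, IsLocalDiffeomorphAt 𝓘(ℝ, ℝ × F) 𝓘(ℝ, E) ∞ Φ (t, (x u₀).1 t))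
    (hk : (tubeLoop hΦ (x u₀) h₀).IsSingularKnot) :
    ∀ᶠ u in 𝓝 u₀, ∃ h : ∀ t, IsLocalDiffeomorphAt 𝓘(ℝ, ℝ × F) 𝓘(ℝ, E) ∞ Φ (t, (x u).1 t),
      (tubeLoop hΦ (x u) h).IsSingularKnot := by
  obtain ⟨V, hV, hVo, hu₀V⟩ := mem_nhds_iff.1 (inter_mem (hU.mem_nhds hu₀)
    (eventually_forall_isLocalDiffeomorphAt hΦ hU hu₀ hx h₀))
  have hxV : ContDiffOn ℝ ∞ (fun q : ℝ × ℝ => (x q.1).1 q.2) (V ×ˢ univ) :=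
    hx.mono (prod_mono (fun u hu => (hV hu).1) subset_rfl)
  have hgood : ∀ u ∈ V, ∀ t, IsLocalDiffeomorphAt 𝓘(ℝ, ℝ × F) 𝓘(ℝ, E) ∞ Φ (t, (x u).1 t) :=
    fun u hu => (hV hu).2
  have hxc : ∀ t, ContinuousAt (fun q : ℝ × ℝ => (x q.1).1 q.2) (u₀, t) := fun t =>
    (hxV.contDiffAt ((hVo.prod isOpen_univ).mem_nhds ⟨hu₀V, mem_univ _⟩)).continuousAt
  have hcc : ∀ t, ContinuousAt (fun q : ℝ × ℝ => Φ (q.2, (x q.1).1 q.2)) (u₀, t) := fun t =>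
    ContinuousAt.comp (g := Φ) (h₀ t).contMDiffAt.continuousAt (continuousAt_snd.prodMk (hxc t))
  have hp₁ : ∀ s t : ℝ, ContinuousAt (fun q : ℝ × ℝ × ℝ => (q.1, q.2.1)) (u₀, s, t) :=
    fun s t => by fun_prop
  have hp₂ : ∀ s t : ℝ, ContinuousAt (fun q : ℝ × ℝ × ℝ => (q.1, q.2.2)) (u₀, s, t) :=
    fun s t => by fun_prop
  have hmain : ∀ᶠ u in 𝓝 u₀, {s : ℝ | ∃ t, (s, t) ∈ Icc (0 : ℝ) 1 ×ˢ Icc (0 : ℝ) 1 ∧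
        (s : AddCircle (1 : ℝ)) ≠ t ∧ Φ (s, (x u).1 s) = Φ (t, (x u).1 t)}.Finite ∧
      ∀ s t, (s, t) ∈ Icc (0 : ℝ) 1 ×ˢ Icc (0 : ℝ) 1 → (s : AddCircle (1 : ℝ)) ≠ t →
        Φ (s, (x u).1 s) = Φ (t, (x u).1 t) →
        ∃ g' : M → ℝ, ContMDiff 𝓘(ℝ, E) 𝓘(ℝ, ℝ) ∞ g' ∧
          (∀ᶠ r in 𝓝 t, g' (Φ (r, (x u).1 r)) = 0) ∧
          ∃ n : ℕ, iteratedDeriv n (fun r => g' (Φ (r, (x u).1 r))) s ≠ 0 := by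
    -- Compactness of the square of parameters: the claim passes to subsets and finite unions, so it
    -- may be checked near each pair `(s₀, t₀)`. Three cases arise: distinct image points, the same
    -- point of the circle, and a true double point.
    refine (isCompact_Icc.prod isCompact_Icc).induction_on (p := fun K : Set (ℝ × ℝ) =>
      ∀ᶠ u in 𝓝 u₀, {s : ℝ | ∃ t, (s, t) ∈ K ∧
        (s : AddCircle (1 : ℝ)) ≠ t ∧ Φ (s, (x u).1 s) = Φ (t, (x u).1 t)}.Finite ∧
      ∀ s t, (s, t) ∈ K → (s : AddCircle (1 : ℝ)) ≠ t →
        Φ (s, (x u).1 s) = Φ (t, (x u).1 t) →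
        ∃ g' : M → ℝ, ContMDiff 𝓘(ℝ, E) 𝓘(ℝ, ℝ) ∞ g' ∧
          (∀ᶠ r in 𝓝 t, g' (Φ (r, (x u).1 r)) = 0) ∧
          ∃ n : ℕ, iteratedDeriv n (fun r => g' (Φ (r, (x u).1 r))) s ≠ 0) ?_ ?_ ?_ ?_
    · simp
    · intro K K' hKK' h
      filter_upwards [h] with u hu
      exact ⟨hu.1.subset fun s ⟨t, ht, h⟩ => ⟨t, hKK' ht, h⟩, fun s t hst => hu.2 s t (hKK' hst)⟩
    · intro K K' h h'
      filter_upwards [h, h'] with u hu hu'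
      refine ⟨(hu.1.union hu'.1).subset ?_, fun s t hst => hst.elim (hu.2 s t) (hu'.2 s t)⟩
      rintro s ⟨t, ht, h⟩
      exact ht.imp (fun ht => ⟨t, ht, h⟩) fun ht => ⟨t, ht, h⟩
    · rintro ⟨s₀, t₀⟩ -
      -- it suffices to exclude double points nearby
      have hred : (∀ᶠ q : ℝ × ℝ × ℝ in 𝓝 (u₀, s₀, t₀),
          Φ (q.2.1, (x q.1).1 q.2.1) = Φ (q.2.2, (x q.1).1 q.2.2) →
            (q.2.1 : AddCircle (1 : ℝ)) = q.2.2) → ∃ W ∈ 𝓝 (s₀, t₀), ∀ᶠ u in 𝓝 u₀, ∀ s t,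
          (s, t) ∈ W → (s : AddCircle (1 : ℝ)) ≠ t → Φ (s, (x u).1 s) ≠ Φ (t, (x u).1 t) := by
        intro h
        rw [nhds_prod_eq] at h
        obtain ⟨P, hP, Q, hQ, hPQ⟩ := eventually_prod_iff.1 h
        refine ⟨_, hQ, ?_⟩
        filter_upwards [hP] with u hu s t hst hne heq
        exact hne (hPQ hu hst heq)
      have hred' : (∃ W ∈ 𝓝 (s₀, t₀), ∀ᶠ u in 𝓝 u₀, ∀ s t, (s, t) ∈ W →
          (s : AddCircle (1 : ℝ)) ≠ t → Φ (s, (x u).1 s) ≠ Φ (t, (x u).1 t)) →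
          ∃ W ∈ 𝓝[Icc (0 : ℝ) 1 ×ˢ Icc (0 : ℝ) 1] (s₀, t₀), ∀ᶠ u in 𝓝 u₀,
          {s : ℝ | ∃ t, (s, t) ∈ W ∧
            (s : AddCircle (1 : ℝ)) ≠ t ∧ Φ (s, (x u).1 s) = Φ (t, (x u).1 t)}.Finite ∧
          ∀ s t, (s, t) ∈ W → (s : AddCircle (1 : ℝ)) ≠ t →
            Φ (s, (x u).1 s) = Φ (t, (x u).1 t) →
            ∃ g' : M → ℝ, ContMDiff 𝓘(ℝ, E) 𝓘(ℝ, ℝ) ∞ g' ∧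
              (∀ᶠ r in 𝓝 t, g' (Φ (r, (x u).1 r)) = 0) ∧
              ∃ n : ℕ, iteratedDeriv n (fun r => g' (Φ (r, (x u).1 r))) s ≠ 0 := by
        rintro ⟨W, hW, h⟩
        refine ⟨W, mem_nhdsWithin_of_mem_nhds hW, ?_⟩
        filter_upwards [h] with u hu
        refine ⟨?_, fun s t hst hne heq => (hu s t hst hne heq).elim⟩
        convert Set.finite_empty
        ext s
        simp only [mem_ofPred_eq, mem_empty_iff_false, iff_false]
        rintro ⟨t, ht, hne, heq⟩
        exact hu s t ht hne heq
      by_cases hst : Φ (s₀, (x u₀).1 s₀) = Φ (t₀, (x u₀).1 t₀)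
      swap
      · refine hred' (hred ?_)
        have h1 : ContinuousAt (fun q : ℝ × ℝ × ℝ => Φ (q.2.1, (x q.1).1 q.2.1)) (u₀, s₀, t₀) :=
          ContinuousAt.comp (g := fun q : ℝ × ℝ => Φ (q.2, (x q.1).1 q.2))
            (f := fun q : ℝ × ℝ × ℝ => (q.1, q.2.1)) (hcc s₀) (hp₁ s₀ t₀)
        have h2 : ContinuousAt (fun q : ℝ × ℝ × ℝ => Φ (q.2.2, (x q.1).1 q.2.2)) (u₀, s₀, t₀) :=
          ContinuousAt.comp (g := fun q : ℝ × ℝ => Φ (q.2, (x q.1).1 q.2))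
            (f := fun q : ℝ × ℝ × ℝ => (q.1, q.2.2)) (hcc t₀) (hp₂ s₀ t₀)
        filter_upwards [h1.ne_iff_eventually_ne h2 |>.1 hst] with q hq h
        exact (hq h).elim
      -- After an integer shift both parameters lie near `s₀`, where `Φ` is injective; hence no
      -- double points occur close to the diagonal of the circle.
      by_cases hcirc : (s₀ : AddCircle (1 : ℝ)) = t₀
      · refine hred' (hred ?_)
        obtain ⟨n, hn⟩ := AddCircle.coe_eq_coe_iff_exists_int.1 hcirc
        obtain ⟨W, hW, hinj⟩ := (h₀ s₀).exists_injOn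
        have h1 : ∀ᶠ q : ℝ × ℝ × ℝ in 𝓝 (u₀, s₀, t₀), (q.2.1, (x q.1).1 q.2.1) ∈ W :=
          (hp₁ s₀ t₀).eventually ((continuousAt_snd.prodMk (hxc s₀)).eventually_mem hW)
        have h2 : ∀ᶠ q : ℝ × ℝ × ℝ in 𝓝 (u₀, s₀, t₀),
            (q.2.2 + n, (x q.1).1 (q.2.2 + n)) ∈ W := by
          have h3 : ContinuousAt (fun q : ℝ × ℝ × ℝ => (q.1, q.2.2 + (n : ℝ))) (u₀, s₀, t₀) := by
            fun_prop
          have h4 := (continuousAt_snd.prodMk (hxc s₀)).eventually_mem hW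
          rw [hn] at h4
          exact h3.eventually h4
        filter_upwards [h1, h2] with q hq₁ hq₂ heq
        have h5 : Φ (q.2.2 + n, (x q.1).1 (q.2.2 + n)) = Φ (q.2.2, (x q.1).1 q.2.2) := by
          rw [← apply_shift_intCast hΦ n (q.2.2 + n), ← twistedSections_apply_sub_intCast]
          simp
        have h6 := hinj hq₁ hq₂ (heq.trans h5.symm)
        exact AddCircle.coe_eq_coe_iff_exists_int.2 ⟨n, congrArg Prod.fst h6⟩
      · obtain ⟨g, hg, hgv, n, hn⟩ := hk.finiteContact hcirc hst
        obtain ⟨W₁, hW₁, W₂, hW₂, h⟩ :=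
          exists_nhds_finite_double_points hVo hu₀V hxV hgood hst hg hgv hn
        refine ⟨W₁ ×ˢ W₂, mem_nhdsWithin_of_mem_nhds (prod_mem_nhds hW₁ hW₂), ?_⟩
        filter_upwards [h] with u hu
        refine ⟨hu.1.subset fun s ⟨t, ht, _, heq⟩ => ⟨ht.1, t, ht.2, heq⟩,
          fun s t hst _ heq => ?_⟩
        obtain ⟨g', h1, h2, h3⟩ := hu.2 s hst.1 t hst.2 heq
        exact ⟨g', h1, h2, n, h3⟩
  filter_upwards [hmain, hVo.mem_nhds hu₀V] with u hu huV
  exact ⟨hgood u huV, Loop.isSingularKnot_of_finite (tubeLoop_velocity_ne_zero hΦ _ _) hu.1 hu.2⟩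

end Stability

/-! ### Charts of the knot space -/

section Charts

variable {F : Type*} [NormedAddCommGroup F] [NormedSpace ℝ F] {A : F ≃L[ℝ] F}
  {E : Type*} [NormedAddCommGroup E] [NormedSpace ℝ E]
  {M : Type*} [TopologicalSpace M] [ChartedSpace E M] {Φ : ℝ × F → M}

theorem Unparam.mk_eq_mk_iff {P : Set (Loop 𝓘(ℝ, E) M)} {γ γ' : {γ : Loop 𝓘(ℝ, E) M // γ ∈ P}} :
    Unparam.mk γ = Unparam.mk γ' ↔ γ.1.Reparam γ'.1 :=
  Quotient.eq (r := (Loop.setoid 𝓘(ℝ, E) M).comap (Subtype.val : {γ // γ ∈ P} → _))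

/-- The section `x` defines a singular knot in the tube `Φ`. -/
def IsTubeKnot (hΦ : ∀ t x, Φ (t + 1, x) = Φ (t, A x)) (x : twistedSections A) : Prop :=
  ∃ h : ∀ t, IsLocalDiffeomorphAt 𝓘(ℝ, ℝ × F) 𝓘(ℝ, E) ∞ Φ (t, x.1 t),
    (tubeLoop hΦ x h).IsSingularKnot

/-- The sections of norm less than `ε` that define singular knots in the tube `Φ`. -/
def tubeDomain (E : Type*) [NormedAddCommGroup E] [NormedSpace ℝ E] [ChartedSpace E M]
    (hΦ : ∀ t x, Φ (t + 1, x) = Φ (t, A x)) (ε : ℝ) : Set (twistedSections A) :=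
  {x | (∀ t ∈ Icc (0 : ℝ) 1, ‖x.1 t‖ < ε) ∧ IsTubeKnot (E := E) hΦ x}

open Classical in
/-- The unparametrized knot defined by a section, with the value `y` where there is none. -/
def tubeChart (hΦ : ∀ t x, Φ (t + 1, x) = Φ (t, A x)) (y : KnotSpace 𝓘(ℝ, E) M)
    (x : twistedSections A) : KnotSpace 𝓘(ℝ, E) M :=
  if h : IsTubeKnot (E := E) hΦ x then Unparam.mk ⟨tubeLoop hΦ x h.choose, h.choose_spec⟩ else y

theorem tubeChart_apply (hΦ : ∀ t x, Φ (t + 1, x) = Φ (t, A x)) (y : KnotSpace 𝓘(ℝ, E) M)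
    {x : twistedSections A}
    {h : ∀ t, IsLocalDiffeomorphAt 𝓘(ℝ, ℝ × F) 𝓘(ℝ, E) ∞ Φ (t, x.1 t)}
    (hk : (tubeLoop hΦ x h).IsSingularKnot) :
    tubeChart hΦ y x = Unparam.mk ⟨tubeLoop hΦ x h, hk⟩ := by
  have h' : IsTubeKnot (E := E) hΦ x := ⟨h, hk⟩
  exact dif_pos h'

theorem eventually_forall_norm_lt {x : ℝ → twistedSections A} {U : Set ℝ} (hU : IsOpen U) {u₀ : ℝ}
    (hu₀ : u₀ ∈ U) (hx : ContDiffOn ℝ ∞ (fun q : ℝ × ℝ => (x q.1).1 q.2) (U ×ˢ univ)) {ε : ℝ}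
    (h₀ : ∀ t ∈ Icc (0 : ℝ) 1, ‖(x u₀).1 t‖ < ε) :
    ∀ᶠ u in 𝓝 u₀, ∀ t ∈ Icc (0 : ℝ) 1, ‖(x u).1 t‖ < ε := by
  refine isCompact_Icc.eventually_forall_of_forall_eventually fun t ht => ?_
  have hc : ContinuousAt (fun q : ℝ × ℝ => (x q.1).1 q.2) (u₀, t) :=
    (hx.contDiffAt ((hU.prod isOpen_univ).mem_nhds ⟨hu₀, mem_univ _⟩)).continuousAt
  exact hc.norm.eventually_lt continuousAt_const (h₀ t ht)

theorem eventually_mem_tubeDomain [FiniteDimensional ℝ E] [IsManifold 𝓘(ℝ, E) ∞ M] [T2Space M]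
    (hΦ : ∀ t x, Φ (t + 1, x) = Φ (t, A x)) {x : ℝ → twistedSections A} {U : Set ℝ}
    (hU : IsOpen U) {u₀ : ℝ} (hu₀ : u₀ ∈ U)
    (hx : ContDiffOn ℝ ∞ (fun q : ℝ × ℝ => (x q.1).1 q.2) (U ×ˢ univ)) {ε : ℝ}
    (h₀ : x u₀ ∈ tubeDomain E hΦ ε) : ∀ᶠ u in 𝓝 u₀, x u ∈ tubeDomain E hΦ ε := by
  obtain ⟨h1, h2, h3⟩ := h₀
  filter_upwards [eventually_forall_norm_lt hU hu₀ hx h1,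
    eventually_isSingularKnot hΦ hU hu₀ hx h2 h3] with u hu hu'
  exact ⟨hu, hu'⟩

/-- Smooth curves of knots lift locally through the chart, starting at any prescribed preimage. This
yields both openness of the image and, given injectivity, smoothness of the inverse. -/
theorem exists_smooth_lift_tubeChart [FiniteDimensional ℝ E] [IsManifold 𝓘(ℝ, E) ∞ M] [T2Space M]
    (hΦ : ∀ t x, Φ (t + 1, x) = Φ (t, A x)) (y : KnotSpace 𝓘(ℝ, E) M) {ε : ℝ}
    {c : ℝ → KnotSpace 𝓘(ℝ, E) M} (hc : IsSmoothCurve c) {u₀ : ℝ} {x₀ : twistedSections A}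
    (hx₀ : x₀ ∈ tubeDomain E hΦ ε) (hcx : c u₀ = tubeChart hΦ y x₀) :
    ∃ U, IsOpen U ∧ u₀ ∈ U ∧ ∃ x : ℝ → twistedSections A, x u₀ = x₀ ∧
      ContDiffOn ℝ ∞ (fun q : ℝ × ℝ => (x q.1).1 q.2) (U ×ˢ univ) ∧
      ∀ᶠ u in 𝓝 u₀, x u ∈ tubeDomain E hΦ ε ∧ tubeChart hΦ y (x u) = c u := by
  obtain ⟨g, hg, hgc⟩ := hc u₀
  obtain ⟨h1, h2, h3⟩ := hx₀
  rw [tubeChart_apply hΦ y h3, hgc.self_of_nhds] at hcx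
  obtain ⟨U, hU, hUo, x, rfl, hx, hr⟩ := exists_smooth_sections hΦ x₀ h2 (g := fun u => (g u).1) hg
    (Unparam.mk_eq_mk_iff.1 hcx.symm)
  have hu₀ := mem_of_mem_nhds hU
  refine ⟨U, hUo, hu₀, x, rfl, hx, ?_⟩
  filter_upwards [eventually_mem_tubeDomain hΦ hUo hu₀ hx ⟨h1, h2, h3⟩, hr, hgc] with u hu hru hgu
  refine ⟨hu, ?_⟩
  obtain ⟨-, hl, hk⟩ := hu
  rw [tubeChart_apply hΦ y hk, hgu]
  exact Unparam.mk_eq_mk_iff.2 hru.2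

/-- If two small sections differ by a reparametrization `τ`, a simple point `t₀` of the core forces
their lifts to meet over `t₀` up to an integer shift. The lifts then coincide on an open and closed
set of parameters, so `τ` is an integer translation, and the sections are equal. -/
theorem injOn_tubeChart [T2Space M] (hΦ : ∀ t x, Φ (t + 1, x) = Φ (t, A x))
    (y : KnotSpace 𝓘(ℝ, E) M)
    (h₀ : ∀ t, IsLocalDiffeomorphAt 𝓘(ℝ, ℝ × F) 𝓘(ℝ, E) ∞ Φ (t, (0 : twistedSections A).1 t))
    (hk : (tubeLoop hΦ 0 h₀).IsSingularKnot) :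
    ∃ ε > 0, InjOn (tubeChart hΦ y) (tubeDomain E hΦ ε) := by
  obtain ⟨t₀, ht₀, hsimple⟩ := hk.exists_simple_point
  have hev : ∀ᶠ w : F × F in 𝓝 (0, 0), ∀ t ∈ Icc (0 : ℝ) 1,
      Φ (t₀, w.1) = Φ (t, w.2) → (t₀, w.1) = (t, w.2) := by
    refine isCompact_Icc.eventually_forall_of_forall_eventually fun t ht => ?_
    have hΦc : ∀ t, ContinuousAt Φ (t, 0) := fun t => (h₀ t).contMDiffAt.continuousAt
    have hp₁ : ContinuousAt (fun q : (F × F) × ℝ => (t₀, q.1.1)) ((0, 0), t) := by fun_prop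
    have hp₂ : ContinuousAt (fun q : (F × F) × ℝ => (q.2, q.1.2)) ((0, 0), t) := by fun_prop
    by_cases htt : t = t₀
    · subst htt
      obtain ⟨W, hW, hinj⟩ := (h₀ t).exists_injOn
      filter_upwards [hp₁.eventually_mem hW, hp₂.eventually_mem hW] with q h1 h2 h
      exact hinj h1 h2 h
    -- As `t₀` is interior to `[0, 1]`, no other `t` in the interval differs from it by an integer.
    · have hne : Φ (t₀, 0) ≠ Φ (t, 0) := by
        intro h
        obtain ⟨n, hn⟩ := AddCircle.coe_eq_coe_iff_exists_int.1 (hsimple t h.symm)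
        have h1 : (n : ℝ) < 1 := by linarith [ht.2, ht₀.1]
        have h2 : (-1 : ℝ) < n := by linarith [ht.1, ht₀.2]
        have h3 : n = 0 := by
          have h1' : n < 1 := by exact_mod_cast h1
          have h2' : -1 < n := by exact_mod_cast h2
          omega
        exact htt (by simpa [h3] using hn)
      have h1 : ContinuousAt (fun q : (F × F) × ℝ => Φ (t₀, q.1.1)) ((0, 0), t) :=
        ContinuousAt.comp (g := Φ) (f := fun q : (F × F) × ℝ => (t₀, q.1.1)) (hΦc t₀) hp₁
      have h2 : ContinuousAt (fun q : (F × F) × ℝ => Φ (q.2, q.1.2)) ((0, 0), t) :=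
        ContinuousAt.comp (g := Φ) (f := fun q : (F × F) × ℝ => (q.2, q.1.2)) (hΦc t) hp₂
      filter_upwards [(h1.ne_iff_eventually_ne h2).1 hne] with q hq h
      exact (hq h).elim
  obtain ⟨ε, hε, hball⟩ := Metric.eventually_nhds_iff.1 hev
  refine ⟨ε, hε, ?_⟩
  rintro x ⟨hx, hxl, hxk⟩ x' ⟨hx', hxl', hxk'⟩ heq
  rw [tubeChart_apply hΦ y hxk, tubeChart_apply hΦ y hxk'] at heq
  obtain ⟨τ, -, -, hτ⟩ := Unparam.mk_eq_mk_iff.1 heq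
  have hτ' : ∀ t, Φ (t, x'.1 t) = Φ (τ t, x.1 (τ t)) := hτ
  -- The deck transformation by `n` brings `τ t₀` into `[0, 1]`, where both sections are small.
  set n := ⌊τ t₀⌋ with hn
  have hshift : ∀ t, Φ (t, x'.1 t) = Φ (τ t - n, x.1 (τ t - n)) := fun t => by
    rw [hτ', twistedSections_apply_sub_intCast, apply_shift_intCast hΦ]
  have hfr : τ t₀ - n ∈ Icc (0 : ℝ) 1 :=
    ⟨Int.fract_nonneg (τ t₀), (Int.fract_lt_one (τ t₀)).le⟩
  have hstart : (t₀, x'.1 t₀) = (τ t₀ - n, x.1 (τ t₀ - n)) := by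
    refine hball (y := (x'.1 t₀, x.1 (τ t₀ - n))) ?_ _ hfr (hshift t₀)
    rw [← Prod.zero_eq_mk, dist_zero_right]
    exact max_lt (hx' t₀ (Ioo_subset_Icc_self ht₀)) (hx _ hfr)
  have hc₁ : Continuous fun t => (t, x'.1 t) := continuous_id.prodMk x'.2.1.continuous
  have hc₂ : Continuous fun t => (τ t - (n : ℝ), x.1 (τ t - n)) := by
    have h1 : Continuous fun t => τ t - (n : ℝ) := τ.continuous.sub continuous_const
    exact h1.prodMk (x.2.1.continuous.comp h1)
  -- Two lifts of the same curve: their coincidence set is closed by continuity and open by local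
  -- injectivity of `Φ`.
  have hall : {t | (t, x'.1 t) = (τ t - (n : ℝ), x.1 (τ t - n))} = univ := by
    refine IsClopen.eq_univ ⟨isClosed_eq hc₁ hc₂, isOpen_iff_mem_nhds.2 fun t ht => ?_⟩ ⟨t₀, hstart⟩
    obtain ⟨W, hW, hinj⟩ := (hxl' t).exists_injOn
    have ht' : (t, x'.1 t) = (τ t - (n : ℝ), x.1 (τ t - n)) := ht
    filter_upwards [hc₁.continuousAt.eventually_mem hW,
      hc₂.continuousAt.eventually_mem (ht' ▸ hW)] with s h1 h2
    exact hinj h1 h2 (hshift s)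
  refine Subtype.ext (funext fun t => ?_)
  have ht : (t, x'.1 t) = (τ t - (n : ℝ), x.1 (τ t - n)) := hall.ge (mem_univ t)
  have h1 : t = τ t - n := congrArg Prod.fst ht
  have h2 : x'.1 t = x.1 (τ t - n) := congrArg Prod.snd ht
  rw [h2, ← h1]

/-- Small sections of a tube around a singular knot form a chart of the knot space. -/
theorem isSmoothChart_tubeChart [FiniteDimensional ℝ E] [IsManifold 𝓘(ℝ, E) ∞ M] [T2Space M]
    (hΦ : ∀ t x, Φ (t + 1, x) = Φ (t, A x)) (y : KnotSpace 𝓘(ℝ, E) M) {ε : ℝ}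
    (hinj : InjOn (tubeChart hΦ y) (tubeDomain E hΦ ε)) :
    IsSmoothChart (tubeDomain E hΦ ε) (tubeChart hΦ y) where
  open_source c hc := isOpen_iff_mem_nhds.2 fun u₀ hu₀ =>
    eventually_mem_tubeDomain hΦ isOpen_univ (mem_univ u₀) (ContDiff.contDiffOn hc) hu₀
  open_image c hc := by
    refine isOpen_iff_mem_nhds.2 fun u₀ ⟨x₀, hx₀, hcx⟩ => ?_
    obtain ⟨-, -, -, x, -, -, h⟩ := exists_smooth_lift_tubeChart hΦ y hc hx₀ hcx.symm
    filter_upwards [h] with u hu using ⟨x u, hu.1, hu.2⟩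
  injOn := hinj
  smooth_iff c hcV := by
    constructor
    · intro hc u₀
      refine ⟨fun u => ⟨tubeLoop hΦ (c u) (hcV u).2.choose, (hcV u).2.choose_spec⟩, ?_,
        Eventually.of_forall fun u => tubeChart_apply hΦ y _⟩
      rintro ⟨u, t⟩
      have h1 : ContDiff ℝ ∞ fun q : ℝ × ℝ => (q.2, (c q.1).1 q.2) := contDiff_snd.prodMk hc
      exact ContMDiffAt.comp (g := Φ) (f := fun q : ℝ × ℝ => (q.2, (c q.1).1 q.2)) (u, t)
        ((hcV u).2.choose t).contMDiffAt h1.contMDiff.contMDiffAt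
    · intro hc
      change ContDiff ℝ ∞ fun q : ℝ × ℝ => (c q.1).1 q.2
      refine contDiff_iff_contDiffAt.2 ?_
      rintro ⟨u₀, t⟩
      obtain ⟨U, hUo, hu₀, x, -, hx, h⟩ :=
        exists_smooth_lift_tubeChart hΦ y hc (hcV u₀) (u₀ := u₀) rfl
      refine (hx.contDiffAt ((hUo.prod isOpen_univ).mem_nhds
        ⟨hu₀, mem_univ t⟩)).congr_of_eventuallyEq
        ?_
      filter_upwards [(continuousAt_fst (p := (u₀, t))).eventually h] with q hq
      rw [hinj hq.1 (hcV q.1) hq.2]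

end Charts

/-! ### Tubes adapted to an immersion -/

section LinearAlgebra

variable {V : Type*} [NormedAddCommGroup V] [NormedSpace ℝ V] [FiniteDimensional ℝ V]

theorem ContinuousLinearMap.exists_equiv_of_injective {L : V →L[ℝ] V}
    (hL : Function.Injective L) : ∃ e : V ≃L[ℝ] V, (e : V →L[ℝ] V) = L :=
  ⟨(LinearEquiv.ofInjectiveEndo (L : V →ₗ[ℝ] V) hL).toContinuousLinearEquiv, by ext; rfl⟩

theorem exists_equiv_prod_of_ne_zero {F : Type*} [NormedAddCommGroup F] [NormedSpace ℝ F]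
    [FiniteDimensional ℝ F] (hdim : Module.finrank ℝ V = Module.finrank ℝ F + 1) {v : V}
    (hv : v ≠ 0) : ∃ B : (ℝ × F) ≃L[ℝ] V, B (1, 0) = v := by
  obtain ⟨Q, hQ⟩ := Submodule.exists_isCompl (Submodule.span ℝ {v})
  have h1 : Module.finrank ℝ Q = Module.finrank ℝ F := by
    have := Submodule.finrank_add_eq_of_isCompl hQ
    rw [finrank_span_singleton hv] at this
    omega
  let e₁ : ℝ ≃ₗ[ℝ] Submodule.span ℝ {v} := LinearEquiv.toSpanNonzeroSingleton ℝ V v hv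
  let e₂ : F ≃ₗ[ℝ] Q := LinearEquiv.ofFinrankEq F Q h1.symm
  refine ⟨((e₁.prodCongr e₂).trans (Submodule.prodEquivOfIsCompl _ _ hQ)).toContinuousLinearEquiv,
    ?_⟩
  simp [e₁, e₂]

end LinearAlgebra

/-! ### Local tubes from the normal form of an immersion -/

section AdaptedTubes

variable {F₁ : Type*} [NormedAddCommGroup F₁] [NormedSpace ℝ F₁]
  {F₂ : Type*} [NormedAddCommGroup F₂] [NormedSpace ℝ F₂]
  {E : Type*} [NormedAddCommGroup E] [NormedSpace ℝ E]
  {M : Type*} [TopologicalSpace M] [ChartedSpace E M]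
  {E' : Type*} [NormedAddCommGroup E'] [NormedSpace ℝ E']
  {S : Type*} [TopologicalSpace S] [ChartedSpace E' S]

/-- Near the parameter `t`, the maps `Φ` and `Ψ` are tubes around the curves `f ∘ δ` and `δ`, and
the tube `Φ` extends the tube `Ψ`. -/
structure IsTubeAt (E E' : Type*) [NormedAddCommGroup E] [NormedSpace ℝ E] [ChartedSpace E M]
    [NormedAddCommGroup E'] [NormedSpace ℝ E'] [ChartedSpace E' S] (f : S → M) (δ : ℝ → S)
    (Φ : ℝ × F₁ × F₂ → M) (Ψ : ℝ × F₁ → S) (t : ℝ) : Prop where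
  diffeo : IsLocalDiffeomorphAt 𝓘(ℝ, ℝ × F₁ × F₂) 𝓘(ℝ, E) ∞ Φ (t, 0)
  diffeo' : IsLocalDiffeomorphAt 𝓘(ℝ, ℝ × F₁) 𝓘(ℝ, E') ∞ Ψ (t, 0)
  zero : ∀ᶠ s in 𝓝 t, Ψ (s, 0) = δ s
  comm : ∀ᶠ z : ℝ × F₁ in 𝓝 (t, 0), Φ (z.1, z.2, 0) = f (Ψ z)

variable {f : S → M} {δ : ℝ → S} {Φ : ℝ × F₁ × F₂ → M} {Ψ : ℝ × F₁ → S} {t : ℝ}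

theorem tendsto_prodMk_zero {F : Type*} [NormedAddCommGroup F] (t : ℝ) :
    Tendsto (fun s : ℝ => (s, (0 : F))) (𝓝 t) (𝓝 (t, 0)) :=
  (Continuous.prodMk_left (0 : F)).tendsto t

theorem IsTubeAt.eventually (h : IsTubeAt E E' f δ Φ Ψ t) :
    ∀ᶠ s in 𝓝 t, IsTubeAt E E' f δ Φ Ψ s := by
  filter_upwards [(tendsto_prodMk_zero t).eventually h.diffeo.eventually,
    (tendsto_prodMk_zero t).eventually h.diffeo'.eventually, h.zero.eventually_nhds,
    (tendsto_prodMk_zero t).eventually h.comm.eventually_nhds] with s h1 h2 h3 h4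
  exact ⟨h1, h2, h3, h4⟩

theorem IsTubeAt.congr (h : IsTubeAt E E' f δ Φ Ψ t) {Φ' : ℝ × F₁ × F₂ → M} {Ψ' : ℝ × F₁ → S}
    (hΦ : ∀ᶠ s in 𝓝 t, ∀ x, Φ' (s, x) = Φ (s, x)) (hΨ : ∀ᶠ s in 𝓝 t, ∀ x, Ψ' (s, x) = Ψ (s, x)) :
    IsTubeAt E E' f δ Φ' Ψ' t where
  diffeo := h.diffeo.congr_of_eventuallyEq
    ((continuousAt_fst (p := (t, (0 : F₁ × F₂)))).eventually hΦ |>.mono fun z hz => hz z.2)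
  diffeo' := h.diffeo'.congr_of_eventuallyEq
    ((continuousAt_fst (p := (t, (0 : F₁)))).eventually hΨ |>.mono fun z hz => hz z.2)
  zero := by filter_upwards [h.zero, hΨ] with s h1 h2; rw [h2, h1]
  comm := by
    filter_upwards [h.comm, (continuousAt_fst (p := (t, (0 : F₁)))).eventually hΦ,
      (continuousAt_fst (p := (t, (0 : F₁)))).eventually hΨ] with z h1 h2 h3
    rw [h2, h1, h3 z.2]

/-- Tubes can be shifted and changed by linear isomorphisms of the fibres. -/
theorem IsTubeAt.shift (c : ℝ) (hδ : ∀ s, δ (s - c) = δ s) (G₁ : F₁ ≃L[ℝ] F₁) (G₂ : F₂ ≃L[ℝ] F₂)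
    (h : IsTubeAt E E' f δ Φ Ψ (t - c)) :
    IsTubeAt E E' f δ (fun z => Φ (z.1 - c, G₁ z.2.1, G₂ z.2.2)) (fun z => Ψ (z.1 - c, G₁ z.2))
      t where
  diffeo := by
    refine (isLocalDiffeomorphAt_comp_shift_iff (Φ := Φ) c (G₁.prodCongr G₂) t 0).2 ?_
    rw [map_zero]
    exact h.diffeo
  diffeo' := by
    refine (isLocalDiffeomorphAt_comp_shift_iff (Φ := Ψ) c G₁ t 0).2 ?_
    rw [map_zero]
    exact h.diffeo'
  zero := by
    have h1 : Tendsto (fun s : ℝ => s - c) (𝓝 t) (𝓝 (t - c)) :=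
      (continuous_id.sub continuous_const).tendsto t
    filter_upwards [h1.eventually h.zero] with s hs
    simp only [map_zero, hs, hδ]
  comm := by
    have h1 : Tendsto (fun z : ℝ × F₁ => (z.1 - c, G₁ z.2)) (𝓝 (t, 0)) (𝓝 (t - c, 0)) := by
      have h2 : Continuous fun z : ℝ × F₁ => (z.1 - c, G₁ z.2) := by fun_prop
      simpa using h2.tendsto (t, 0)
    filter_upwards [h1.eventually h.comm] with z hz
    simpa using hz

/-- Adapted tubes exist locally. -/
theorem exists_isTubeAt [FiniteDimensional ℝ F₁] [FiniteDimensional ℝ F₂] [FiniteDimensional ℝ E']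
    (hdim : Module.finrank ℝ E' = Module.finrank ℝ F₁ + 1)
    (hδ : ContMDiff 𝓘(ℝ, ℝ) 𝓘(ℝ, E') ∞ δ) (t : ℝ)
    (hv : mfderiv 𝓘(ℝ, ℝ) 𝓘(ℝ, E') δ t (1 : ℝ) ≠ 0)
    (hf : IsImmersionAtOfComplement F₂ 𝓘(ℝ, E') 𝓘(ℝ, E) ∞ f (δ t)) :
    ∃ (Φ : ℝ × F₁ × F₂ → M) (Ψ : ℝ × F₁ → S), IsTubeAt E E' f δ Φ Ψ t := by
  set κ := hf.domChart with hκ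
  set κ' := hf.codChart with hκ'
  have hcharts : ∀ y ∈ κ.target, κ' (f (κ.symm y)) = hf.equiv (y, 0) := fun y hy => by
    have h1 := hf.writtenInCharts
      (show y ∈ (hf.domChart.extend 𝓘(ℝ, E')).target by simpa using hy)
    simpa using h1
  set k : ℝ → E' := fun s => κ (δ s) with hk
  have hsrc : δ t ∈ κ.source := hf.mem_domChart_source
  have hks : ∀ᶠ s in 𝓝 t, ContDiffAt ℝ ∞ k s := by
    filter_upwards [hδ.continuous.continuousAt.preimage_mem_nhds (κ.open_source.mem_nhds hsrc)]
      with s hs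
    exact (ContMDiffAt.comp s (contMDiffAt_of_mem_maximalAtlas hf.domChart_mem_maximalAtlas hs)
      hδ.contMDiffAt).contDiffAt
  set v : E' := deriv k t with hvdef
  have hkd : HasDerivAt k v t := (hks.self_of_nhds.differentiableAt (by simp)).hasDerivAt
  have hv0 : v ≠ 0 := by
    intro h0
    apply hv
    have h1 : (fun s => κ.symm (k s)) =ᶠ[𝓝 t] δ := by
      filter_upwards [hδ.continuous.continuousAt.preimage_mem_nhds (κ.open_source.mem_nhds hsrc)]
        with s hs
      exact κ.left_inv hs
    have h2 : MDifferentiableAt 𝓘(ℝ, E') 𝓘(ℝ, E') κ.symm (k t) :=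
      ((contMDiffAt_symm_of_mem_maximalAtlas hf.domChart_mem_maximalAtlas
        (κ.map_source hsrc))).mdifferentiableAt (by simp)
    have h3 := mfderiv_comp_apply_one h2 hkd
    have h5 : mfderiv 𝓘(ℝ, E') 𝓘(ℝ, E') κ.symm (k t) v = 0 := by
      rw [h0]; exact map_zero (mfderiv 𝓘(ℝ, E') 𝓘(ℝ, E') κ.symm (k t))
    have h4 : mfderiv 𝓘(ℝ, ℝ) 𝓘(ℝ, E') (κ.symm ∘ k) t = mfderiv 𝓘(ℝ, ℝ) 𝓘(ℝ, E') δ t :=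
      Filter.EventuallyEq.mfderiv_eq h1
    rw [← h4]
    exact h3.trans h5
  obtain ⟨B, hB⟩ := exists_equiv_prod_of_ne_zero hdim hv0
  -- In a chart of `S`, the curve is thickened by a complement of its velocity: the derivative of
  -- `a` on the core at `t` is exactly `B`.
  set a : ℝ × F₁ → E' := fun z => k z.1 + B (0, z.2) with ha
  have has : ∀ᶠ z : ℝ × F₁ in 𝓝 (t, 0), ContDiffAt ℝ ∞ a z := by
    filter_upwards [(continuousAt_fst (p := (t, (0 : F₁)))).eventually hks] with z hz
    exact (hz.comp z contDiffAt_fst).add (ContDiff.contDiffAt (by fun_prop))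
  have had : HasFDerivAt a (B : (ℝ × F₁) →L[ℝ] E') (t, 0) := by
    have h1 : HasFDerivAt (fun z : ℝ × F₁ => k z.1) _ (t, 0) :=
      HasFDerivAt.comp (g := k) (f := Prod.fst) (t, (0 : F₁)) hkd.hasFDerivAt hasFDerivAt_fst
    have h2 : HasFDerivAt (fun z : ℝ × F₁ => B (0, z.2)) _ (t, 0) :=
      ((B : (ℝ × F₁) →L[ℝ] E').comp ((ContinuousLinearMap.inr ℝ ℝ F₁).comp
        (ContinuousLinearMap.snd ℝ ℝ F₁))).hasFDerivAt
    refine (h1.add h2).congr_fderiv ?_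
    ext
    · simp [hB]
    · simp
  have ha0 : a (t, 0) = κ (δ t) := by simp [ha, hk]
  -- In the charts of the immersion, `f` is `y ↦ (y, 0)`; filling in the second factor by `F₂`
  -- extends the tube of `S`, with agreement at `F₂`-component zero.
  set b : ℝ × F₁ × F₂ → E := fun z => hf.equiv (a (z.1, z.2.1), z.2.2) with hb
  have hproj : Tendsto (fun z : ℝ × F₁ × F₂ => (z.1, z.2.1)) (𝓝 (t, 0)) (𝓝 (t, 0)) := by
    have h2 : Continuous fun z : ℝ × F₁ × F₂ => (z.1, z.2.1) := by fun_prop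
    exact h2.tendsto (t, 0)
  have hbs : ∀ᶠ z : ℝ × F₁ × F₂ in 𝓝 (t, 0), ContDiffAt ℝ ∞ b z := by
    filter_upwards [hproj.eventually has] with z hz
    have h1 : ContDiffAt ℝ ∞ (fun z : ℝ × F₁ × F₂ => a (z.1, z.2.1)) z :=
      ContDiffAt.comp (f := fun z : ℝ × F₁ × F₂ => (z.1, z.2.1)) z hz (by fun_prop)
    exact hf.equiv.contDiff.contDiffAt.comp z (h1.prodMk (by fun_prop))
  let e : (ℝ × F₁ × F₂) ≃L[ℝ] E :=
    ((ContinuousLinearEquiv.prodAssoc ℝ ℝ F₁ F₂).symm.trans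
      (B.prodCongr (ContinuousLinearEquiv.refl ℝ F₂))).trans hf.equiv
  have hbd : HasFDerivAt b (e : (ℝ × F₁ × F₂) →L[ℝ] E) (t, 0) := by
    have h1 : HasFDerivAt (fun z : ℝ × F₁ × F₂ => a (z.1, z.2.1)) _ (t, 0) :=
      HasFDerivAt.comp (f := fun z : ℝ × F₁ × F₂ => (z.1, z.2.1)) (t, (0 : F₁ × F₂)) had
        (hasFDerivAt_fst.prodMk (hasFDerivAt_fst.comp _ hasFDerivAt_snd))
    have h2 : HasFDerivAt (fun z : ℝ × F₁ × F₂ => z.2.2) _ (t, 0) :=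
      ((ContinuousLinearMap.snd ℝ F₁ F₂).comp (ContinuousLinearMap.snd ℝ ℝ (F₁ × F₂))).hasFDerivAt
    refine (hf.equiv.hasFDerivAt.comp (t, (0 : F₁ × F₂)) (h1.prodMk h2)).congr_fderiv ?_
    exact ContinuousLinearMap.ext fun z => rfl
  have : FiniteDimensional ℝ (ℝ × F₁ × F₂) := inferInstance
  have : CompleteSpace (ℝ × F₁ × F₂) := FiniteDimensional.complete ℝ _
  have : CompleteSpace (ℝ × F₁) := FiniteDimensional.complete ℝ _
  have hκt : κ (δ t) ∈ κ.target := κ.map_source hsrc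
  have hb0 : b (t, 0) = κ' (f (δ t)) := by
    have h1 : b (t, 0) = hf.equiv (a (t, 0), 0) := rfl
    rw [h1, ha0, ← hcharts _ hκt, κ.left_inv hsrc]
  refine ⟨κ'.symm ∘ b, κ.symm ∘ a, ?_, ?_, ?_, ?_⟩
  · refine (isLocalDiffeomorphAt_of_hasFDerivAt hbs e hbd).comp _ _
      (OpenPartialHomeomorph.isLocalDiffeomorphAt_symm hf.codChart_mem_maximalAtlas ?_)
    rw [hb0]
    exact κ'.map_source hf.mem_codChart_source
  · refine (isLocalDiffeomorphAt_of_hasFDerivAt has B had).comp _ _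
      (OpenPartialHomeomorph.isLocalDiffeomorphAt_symm hf.domChart_mem_maximalAtlas ?_)
    rw [ha0]
    exact hκt
  · filter_upwards [hδ.continuous.continuousAt.preimage_mem_nhds (κ.open_source.mem_nhds hsrc)]
      with s hs
    have h1 : a (s, 0) = κ (δ s) := by simp [ha, hk]
    simp only [Function.comp, h1]
    exact κ.left_inv hs
  · have h1 : ∀ᶠ z in 𝓝 (t, (0 : F₁)), a z ∈ κ.target := by
      refine has.self_of_nhds.continuousAt.eventually_mem (κ.open_target.mem_nhds ?_)
      rw [ha0]
      exact hκt
    filter_upwards [h1] with z hz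
    have h2 : b (z.1, z.2, 0) = hf.equiv (a z, 0) := rfl
    simp only [Function.comp, h2]
    rw [← hcharts _ hz]
    exact κ'.left_inv (hf.source_subset_preimage_source (κ.map_target hz))

end AdaptedTubes

/-! ### Gluing two tubes with the same core -/

section Gluing

variable {F₁ : Type*} [NormedAddCommGroup F₁] [NormedSpace ℝ F₁] [FiniteDimensional ℝ F₁]
  {F₂ : Type*} [NormedAddCommGroup F₂] [NormedSpace ℝ F₂] [FiniteDimensional ℝ F₂]
  {E : Type*} [NormedAddCommGroup E] [NormedSpace ℝ E]
  {M : Type*} [TopologicalSpace M] [ChartedSpace E M]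
  {E' : Type*} [NormedAddCommGroup E'] [NormedSpace ℝ E']
  {S : Type*} [TopologicalSpace S] [ChartedSpace E' S]
  {f : S → M} {δ : ℝ → S}

/-- The diagonal blocks of an isomorphism that fixes the first vector and preserves the flag
`ℝ ⊆ ℝ × F₁`; linear interpolation between the isomorphism and its block diagonal part is through
isomorphisms. -/
theorem exists_diagonal_blocks {L : (ℝ × F₁ × F₂) →L[ℝ] (ℝ × F₁ × F₂)}
    (hL : Function.Injective L) (h1 : L (1, 0, 0) = (1, 0, 0))
    (h2 : ∀ z : ℝ × F₁, (L (z.1, z.2, 0)).2.2 = 0) :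
    ∃ (G₁ : F₁ ≃L[ℝ] F₁) (G₂ : F₂ ≃L[ℝ] F₂), ∀ c : ℝ, Function.Injective
      ((1 - c) • L + c • ((ContinuousLinearEquiv.refl ℝ ℝ).prodCongr (G₁.prodCongr G₂) :
        (ℝ × F₁ × F₂) →L[ℝ] (ℝ × F₁ × F₂))) := by
  have h1' : ∀ r : ℝ, L (r, 0, 0) = (r, 0, 0) := fun r => by
    have : ((r, 0, 0) : ℝ × F₁ × F₂) = r • (1, 0, 0) := by simp
    rw [this, map_smul, h1]
  let g₁ : F₁ →L[ℝ] F₁ := (ContinuousLinearMap.fst ℝ F₁ F₂).comp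
    ((ContinuousLinearMap.snd ℝ ℝ (F₁ × F₂)).comp (L.comp
      ((ContinuousLinearMap.inr ℝ ℝ (F₁ × F₂)).comp (ContinuousLinearMap.inl ℝ F₁ F₂))))
  let g₂ : F₂ →L[ℝ] F₂ := (ContinuousLinearMap.snd ℝ F₁ F₂).comp
    ((ContinuousLinearMap.snd ℝ ℝ (F₁ × F₂)).comp (L.comp
      ((ContinuousLinearMap.inr ℝ ℝ (F₁ × F₂)).comp (ContinuousLinearMap.inr ℝ F₁ F₂))))
  have hg₁ : ∀ x, g₁ x = (L (0, x, 0)).2.1 := fun x => rfl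
  have hg₂ : ∀ x, g₂ x = (L (0, 0, x)).2.2 := fun x => rfl
  have hinj₁ : Function.Injective g₁ := by
    rw [injective_iff_map_eq_zero]
    intro x hx
    have h3 : L (0, x, 0) = L ((L (0, x, 0)).1, 0, 0) := by
      rw [h1']
      exact Prod.ext rfl (Prod.ext hx (h2 (0, x)))
    have := hL h3
    simp only [Prod.mk.injEq] at this
    exact this.2.1
  obtain ⟨G₁, hG₁⟩ := ContinuousLinearMap.exists_equiv_of_injective hinj₁
  have hG₁' : ∀ x, G₁ x = g₁ x := fun x => by rw [← hG₁]; rfl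
  have hinj₂ : Function.Injective g₂ := by
    rw [injective_iff_map_eq_zero]
    intro x hx
    -- Chosen so that `L (0, -y, x)` has no `F₁`-component and can be compared with a multiple of
    -- the first vector.
    set y := G₁.symm (L (0, 0, x)).2.1 with hy
    have hy' : g₁ y = (L (0, 0, x)).2.1 := by rw [← hG₁', hy, G₁.apply_symm_apply]
    have h3 : L (0, -y, x) = L ((L (0, -y, x)).1, 0, 0) := by
      rw [h1']
      have h4 : ((0, -y, x) : ℝ × F₁ × F₂) = (0, 0, x) - (0, y, 0) := by simp
      refine Prod.ext rfl (Prod.ext ?_ ?_)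
      · rw [h4, map_sub]
        change (L (0, 0, x)).2.1 - (L (0, y, 0)).2.1 = 0
        rw [← hg₁, hy', sub_self]
      · rw [h4, map_sub]
        change (L (0, 0, x)).2.2 - (L (0, y, 0)).2.2 = 0
        rw [← hg₂, hx, h2 (0, y), sub_self]
    have := hL h3
    simp only [Prod.mk.injEq] at this
    exact this.2.2
  obtain ⟨G₂, hG₂⟩ := ContinuousLinearMap.exists_equiv_of_injective hinj₂
  have hG₂' : ∀ x, G₂ x = g₂ x := fun x => by rw [← hG₂]; rfl
  -- `L` is block upper triangular with diagonal blocks `1`, `G₁`, `G₂`, and so is every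
  -- interpolation. A vector in the kernel vanishes component by component, starting from the last.
  refine ⟨G₁, G₂, fun c => ?_⟩
  rw [injective_iff_map_eq_zero]
  rintro ⟨r, x, y⟩ h
  have hdec : L (r, x, y) = (r, 0, 0) + L (0, x, 0) + L (0, 0, y) := by
    rw [← h1' r, ← map_add, ← map_add]; simp
  have e : (1 - c) • L (r, x, y) + c • (r, G₁ x, G₂ y) = 0 := h
  have e2 : (1 - c) • (L (r, x, y)).2.2 + c • G₂ y = 0 := congrArg (fun z => z.2.2) e
  have hy : y = 0 := by
    have h5 : (L (r, x, y)).2.2 = g₂ y := by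
      rw [hdec]
      change (0 : F₂) + (L (0, x, 0)).2.2 + (L (0, 0, y)).2.2 = g₂ y
      rw [h2 (0, x), zero_add, zero_add, hg₂]
    rw [h5, hG₂', ← add_smul, sub_add_cancel, one_smul] at e2
    exact (injective_iff_map_eq_zero g₂).1 hinj₂ y e2
  subst hy
  have e1 : (1 - c) • (L (r, x, 0)).2.1 + c • G₁ x = 0 := congrArg (fun z => z.2.1) e
  have hx : x = 0 := by
    have h5 : (L (r, x, 0)).2.1 = g₁ x := by
      rw [hdec]
      change (0 : F₁) + (L (0, x, 0)).2.1 + (L (0, 0, 0)).2.1 = g₁ x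
      rw [hg₁, show ((0, 0, 0) : ℝ × F₁ × F₂) = 0 from rfl, map_zero]
      simp
    rw [h5, hG₁', ← add_smul, sub_add_cancel, one_smul] at e1
    exact (injective_iff_map_eq_zero g₁).1 hinj₁ x e1
  subst hx
  have e0 : (1 - c) • (L (r, 0, 0)).1 + c • r = 0 := congrArg (fun z => z.1) e
  rw [h1', ← add_smul, sub_add_cancel, one_smul] at e0
  subst e0
  rfl

/-- Linear interpolation, with factor `χ` depending on the first coordinate, between a map `T` and
a linear map that preserves the first coordinate. -/
def interpolate {F : Type*} [AddCommGroup F] [Module ℝ F] (χ : ℝ → ℝ) (T : ℝ × F → ℝ × F)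
    (G : F → F) (z : ℝ × F) : ℝ × F :=
  (1 - χ z.1) • T z + χ z.1 • (z.1, G z.2)

/-- The two terms containing the derivative of `χ` cancel, since both maps fix `(s, 0)`. Thus the
derivative on the core involves only the value of `χ`, however steep `χ` is. -/
theorem hasFDerivAt_interpolate {F : Type*} [NormedAddCommGroup F] [NormedSpace ℝ F]
    {χ : ℝ → ℝ} (hχ : ContDiff ℝ ∞ χ) {T : ℝ × F → ℝ × F} (G : F →L[ℝ] F) {s : ℝ}
    (hT : DifferentiableAt ℝ T (s, 0)) (h0 : T (s, 0) = (s, 0)) :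
    HasFDerivAt (interpolate χ T G) ((1 - χ s) • fderiv ℝ T (s, 0) +
      χ s • ((ContinuousLinearMap.id ℝ ℝ).prodMap G)) (s, 0) := by
  have h1 : HasFDerivAt (fun z : ℝ × F => χ z.1)
      ((fderiv ℝ χ s).comp (ContinuousLinearMap.fst ℝ ℝ F)) (s, 0) :=
    HasFDerivAt.comp (g := χ) (f := Prod.fst) (s, (0 : F))
      (hχ.differentiable (by simp) s).hasFDerivAt hasFDerivAt_fst
  have h2 := (h1.const_sub 1).smul hT.hasFDerivAt
  have h3 := h1.smul ((ContinuousLinearMap.id ℝ ℝ).prodMap G).hasFDerivAt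
  refine (h2.add h3).congr_fderiv ?_
  refine ContinuousLinearMap.ext fun z => ?_
  have h4 : ((ContinuousLinearMap.id ℝ ℝ).prodMap G) (s, 0) = (s, 0) := by simp
  simp only [h0, h4, add_apply, smul_apply, ContinuousLinearMap.smulRight_apply, neg_apply,
    neg_smul]
  abel

theorem contDiffAt_interpolate {F : Type*} [NormedAddCommGroup F] [NormedSpace ℝ F]
    {χ : ℝ → ℝ} (hχ : ContDiff ℝ ∞ χ) {T : ℝ × F → ℝ × F} (G : F →L[ℝ] F) {z : ℝ × F}
    (hT : ContDiffAt ℝ ∞ T z) : ContDiffAt ℝ ∞ (interpolate χ T G) z := by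
  have h1 : ContDiffAt ℝ ∞ (fun z : ℝ × F => χ z.1) z := (hχ.comp contDiff_fst).contDiffAt
  exact ((contDiffAt_const.sub h1).smul hT).add (h1.smul (ContDiff.contDiffAt (by fun_prop)))

/-- The inclusion of `ℝ × F₁` into `ℝ × F₁ × F₂`. -/
def inclFst (F₁ F₂ : Type*) [NormedAddCommGroup F₁] [NormedSpace ℝ F₁]
    [NormedAddCommGroup F₂] [NormedSpace ℝ F₂] : (ℝ × F₁) →L[ℝ] (ℝ × F₁ × F₂) :=
  (ContinuousLinearMap.id ℝ ℝ).prodMap (ContinuousLinearMap.inl ℝ F₁ F₂)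

theorem inclFst_apply {F₁ F₂ : Type*} [NormedAddCommGroup F₁] [NormedSpace ℝ F₁]
    [NormedAddCommGroup F₂] [NormedSpace ℝ F₂] (z : ℝ × F₁) : inclFst F₁ F₂ z = (z.1, z.2, 0) := rfl

theorem inclFst_injective {F₁ F₂ : Type*} [NormedAddCommGroup F₁] [NormedSpace ℝ F₁]
    [NormedAddCommGroup F₂] [NormedSpace ℝ F₂] : Function.Injective (inclFst F₁ F₂) :=
  fun z w h => by
  simp only [inclFst_apply, Prod.mk.injEq] at h
  exact Prod.ext h.1 h.2.1

/-- The blocks are taken at `b`; openness of invertibility and compactness of `[0, 1]` give a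
neighbourhood of `b` that works for all interpolation factors at once. It does not depend on `χ`, so
the cutoff can be chosen afterwards to fit inside it. -/
theorem exists_isLocalDiffeomorphAt_interpolate {T : ℝ × F₁ × F₂ → ℝ × F₁ × F₂}
    {T₁ : ℝ × F₁ → ℝ × F₁} {b : ℝ} (hT : ∀ᶠ z in 𝓝 (b, 0), ContDiffAt ℝ ∞ T z)
    (hT₁ : ∀ᶠ z in 𝓝 (b, 0), ContDiffAt ℝ ∞ T₁ z)
    (hinj : Function.Injective (fderiv ℝ T (b, 0))) (h0 : ∀ᶠ s in 𝓝 b, T (s, 0) = (s, 0))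
    (h0₁ : ∀ᶠ s in 𝓝 b, T₁ (s, 0) = (s, 0))
    (hcomm : ∀ᶠ z in 𝓝 (b, 0), T (inclFst F₁ F₂ z) = inclFst F₁ F₂ (T₁ z)) :
    ∃ (G₁ : F₁ ≃L[ℝ] F₁) (G₂ : F₂ ≃L[ℝ] F₂), ∀ᶠ s in 𝓝 b, ∀ χ : ℝ → ℝ, ContDiff ℝ ∞ χ →
      χ s ∈ Icc 0 1 →
      IsLocalDiffeomorphAt 𝓘(ℝ, ℝ × F₁ × F₂) 𝓘(ℝ, ℝ × F₁ × F₂) ∞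
        (interpolate χ T (G₁.prodCongr G₂)) (s, 0) ∧
      IsLocalDiffeomorphAt 𝓘(ℝ, ℝ × F₁) 𝓘(ℝ, ℝ × F₁) ∞ (interpolate χ T₁ G₁) (s, 0) ∧
      interpolate χ T (G₁.prodCongr G₂) (s, 0) = (s, 0) ∧ interpolate χ T₁ G₁ (s, 0) = (s, 0) ∧
      ∀ᶠ z in 𝓝 (s, 0), interpolate χ T (G₁.prodCongr G₂) (inclFst F₁ F₂ z) =
        inclFst F₁ F₂ (interpolate χ T₁ G₁ z) := by
  have : CompleteSpace (ℝ × F₁ × F₂) := FiniteDimensional.complete ℝ _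
  have : CompleteSpace (ℝ × F₁) := FiniteDimensional.complete ℝ _
  have hTd : HasFDerivAt T (fderiv ℝ T (b, 0)) (b, 0) :=
    (hT.self_of_nhds.differentiableAt (by simp)).hasFDerivAt
  have hT₁d : HasFDerivAt T₁ (fderiv ℝ T₁ (b, 0)) (b, 0) :=
    (hT₁.self_of_nhds.differentiableAt (by simp)).hasFDerivAt
  have hL1 : fderiv ℝ T (b, 0) (1, 0, 0) = (1, 0, 0) := by
    have hc : HasDerivAt (fun s : ℝ => (s, (0 : F₁ × F₂))) (1, 0) b :=
      (hasDerivAt_id b).prodMk (hasDerivAt_const b _)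
    have h1 := HasFDerivAt.comp_hasDerivAt (f := fun s : ℝ => (s, (0 : F₁ × F₂))) b hTd hc
    exact (h1.congr_of_eventuallyEq (h0.mono fun s hs => hs.symm)).unique hc
  have hL2 : ∀ z : ℝ × F₁, (fderiv ℝ T (b, 0) (z.1, z.2, 0)).2.2 = 0 := by
    intro z
    have h1 : HasFDerivAt (T ∘ inclFst F₁ F₂) ((fderiv ℝ T (b, 0)).comp (inclFst F₁ F₂)) (b, 0) :=
      HasFDerivAt.comp (b, (0 : F₁)) (f := inclFst F₁ F₂) hTd (inclFst F₁ F₂).hasFDerivAt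
    have h2 : HasFDerivAt (inclFst F₁ F₂ ∘ T₁) ((inclFst F₁ F₂).comp (fderiv ℝ T₁ (b, 0))) (b, 0) :=
      (inclFst F₁ F₂).hasFDerivAt.comp (b, (0 : F₁)) hT₁d
    have h3 := (h1.congr_of_eventuallyEq (hcomm.mono fun z hz => hz.symm)).unique h2
    exact congrArg (fun L => (L z).2.2) h3
  obtain ⟨G₁, G₂, hG⟩ := exists_diagonal_blocks hinj hL1 hL2
  refine ⟨G₁, G₂, ?_⟩
  set Δ : (ℝ × F₁ × F₂) →L[ℝ] (ℝ × F₁ × F₂) :=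
    (ContinuousLinearMap.id ℝ ℝ).prodMap ((G₁.prodCongr G₂ : (F₁ × F₂) ≃L[ℝ] (F₁ × F₂)) :
      (F₁ × F₂) →L[ℝ] (F₁ × F₂)) with hΔ
  have hG' : ∀ c : ℝ, Function.Injective ((1 - c) • fderiv ℝ T (b, 0) + c • Δ) := hG
  have hcont : ContinuousAt (fun s : ℝ => fderiv ℝ T (s, 0)) b :=
    ContinuousAt.comp (g := fderiv ℝ T) (f := fun s : ℝ => (s, (0 : F₁ × F₂)))
      (hT.self_of_nhds.fderiv_right (m := 0) (by simp)).continuousAt (tendsto_prodMk_zero b)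
  have hev : ∀ᶠ s in 𝓝 b, ∀ c ∈ Icc (0 : ℝ) 1,
      (1 - c) • fderiv ℝ T (s, 0) + c • Δ ∈
        range ((↑) : ((ℝ × F₁ × F₂) ≃L[ℝ] (ℝ × F₁ × F₂)) → _ →L[ℝ] _) := by
    refine isCompact_Icc.eventually_forall_of_forall_eventually fun c _ => ?_
    obtain ⟨e, he⟩ := ContinuousLinearMap.exists_equiv_of_injective (hG' c)
    have h1 : ContinuousAt (fun q : ℝ × ℝ => (1 - q.2) • fderiv ℝ T (q.1, 0) + q.2 • Δ) (b, c) := by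
      have h2 : ContinuousAt (fun q : ℝ × ℝ => fderiv ℝ T (q.1, 0)) (b, c) :=
        ContinuousAt.comp (g := fun s : ℝ => fderiv ℝ T (s, 0)) (f := Prod.fst) hcont
          continuousAt_fst
      exact ((continuousAt_const.sub continuousAt_snd).smul h2).add
        (continuousAt_snd.smul continuousAt_const)
    refine h1.eventually_mem ?_
    change _ ∈ 𝓝 ((1 - c) • fderiv ℝ T (b, 0) + c • Δ)
    rw [← he]
    exact ContinuousLinearEquiv.nhds e
  filter_upwards [hev, (tendsto_prodMk_zero b).eventually hT.eventually_nhds,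
    (tendsto_prodMk_zero b).eventually hT₁.eventually_nhds, h0, h0₁,
    (tendsto_prodMk_zero b).eventually hcomm.eventually_nhds] with s h1 h2 h3 h4 h5 h6 χ hχ hχs
  obtain ⟨e, he⟩ := h1 _ hχs
  have hd : HasFDerivAt (interpolate χ T (G₁.prodCongr G₂)) (e : (ℝ × F₁ × F₂) →L[ℝ] _) (s, 0) := by
    rw [he]
    exact hasFDerivAt_interpolate hχ ((G₁.prodCongr G₂ : (F₁ × F₂) ≃L[ℝ] (F₁ × F₂)) :
      (F₁ × F₂) →L[ℝ] (F₁ × F₂)) (h2.self_of_nhds.differentiableAt (by simp)) h4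
  have hd₁ := hasFDerivAt_interpolate hχ (G₁ : F₁ →L[ℝ] F₁)
    (h3.self_of_nhds.differentiableAt (by simp)) h5
  have hinc : ∀ᶠ z in 𝓝 (s, 0), interpolate χ T (G₁.prodCongr G₂) (inclFst F₁ F₂ z) =
        inclFst F₁ F₂ (interpolate χ T₁ G₁ z) := by
    filter_upwards [h6] with z hz
    simp only [interpolate, hz, map_add, map_smul]
    congr 2
    simp [inclFst_apply]
  -- The derivative for `T₁` is the restriction to `ℝ × F₁` of the invertible derivative for `T`,
  -- hence injective.
  have hinj₁ : Function.Injective ((1 - χ s) • fderiv ℝ T₁ (s, 0) +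
      χ s • ((ContinuousLinearMap.id ℝ ℝ).prodMap (G₁ : F₁ →L[ℝ] F₁))) := by
    have k1 : HasFDerivAt (interpolate χ T (G₁.prodCongr G₂) ∘ inclFst F₁ F₂)
        ((e : (ℝ × F₁ × F₂) →L[ℝ] _).comp (inclFst F₁ F₂)) (s, 0) :=
      HasFDerivAt.comp (s, (0 : F₁)) (f := inclFst F₁ F₂) hd (inclFst F₁ F₂).hasFDerivAt
    have k2 := (inclFst F₁ F₂).hasFDerivAt.comp (s, (0 : F₁)) hd₁
    have k3 := (k1.congr_of_eventuallyEq (hinc.mono fun z hz => hz.symm)).unique k2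
    refine Function.Injective.of_comp (f := inclFst F₁ F₂) ?_
    have k5 : Function.Injective ((e : (ℝ × F₁ × F₂) →L[ℝ] ℝ × F₁ × F₂).comp (inclFst F₁ F₂)) :=
      e.injective.comp inclFst_injective
    rw [k3] at k5
    exact k5
  obtain ⟨e₁, he₁⟩ := ContinuousLinearMap.exists_equiv_of_injective hinj₁
  refine ⟨isLocalDiffeomorphAt_of_hasFDerivAt (h2.mono fun z hz => contDiffAt_interpolate hχ
    ((G₁.prodCongr G₂ : (F₁ × F₂) ≃L[ℝ] (F₁ × F₂)) : (F₁ × F₂) →L[ℝ] (F₁ × F₂)) hz) e hd,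
    isLocalDiffeomorphAt_of_hasFDerivAt
    (h3.mono fun z hz => contDiffAt_interpolate hχ (G₁ : F₁ →L[ℝ] F₁) hz) e₁ (he₁ ▸ hd₁), ?_, ?_,
    hinc⟩
  · simp only [interpolate, h4, map_zero, ← add_smul, sub_add_cancel, one_smul]
  · simp only [interpolate, h5, map_zero, ← add_smul, sub_add_cancel, one_smul]

/-- Two local diffeomorphisms differ by a smooth change of coordinates. -/
theorem IsLocalDiffeomorphAt.exists_transition {P : Type*} [NormedAddCommGroup P]
    [NormedSpace ℝ P] {Φ Φ' : P → M} {z : P} (h : IsLocalDiffeomorphAt 𝓘(ℝ, P) 𝓘(ℝ, E) ∞ Φ z)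
    (h' : IsLocalDiffeomorphAt 𝓘(ℝ, P) 𝓘(ℝ, E) ∞ Φ' z) (hz : Φ z = Φ' z) :
    ∃ T : P → P, (∀ᶠ w in 𝓝 z, ContDiffAt ℝ ∞ T w) ∧ T z = z ∧ (∀ᶠ w in 𝓝 z, Φ' (T w) = Φ w) ∧
      (∀ᶠ w' in 𝓝 z, ∀ w, Φ w = Φ' w' → T w = w') ∧ Function.Injective (fderiv ℝ T z) := by
  obtain ⟨K', hK', hK'l, hK'r⟩ := h'.exists_inverse
  obtain ⟨K, hK, hKl, hKr⟩ := h.exists_inverse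
  have hc : ContinuousAt Φ z := h.contMDiffAt.continuousAt
  have hT : ∀ᶠ w in 𝓝 z, ContDiffAt ℝ ∞ (K' ∘ Φ) w := by
    rw [← hz] at hK'
    filter_upwards [h.eventually, hc.eventually hK'] with w h1 h2
    exact (h2.comp w h1.contMDiffAt).contDiffAt
  have hTz : (K' ∘ Φ) z = z := by
    simp only [Function.comp, hz]
    exact hK'l.self_of_nhds
  have hr : ∀ᶠ w in 𝓝 z, Φ' ((K' ∘ Φ) w) = Φ w := by
    rw [← hz] at hK'r
    exact hc.eventually hK'r
  refine ⟨K' ∘ Φ, hT, hTz, hr, ?_, ?_⟩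
  · filter_upwards [hK'l] with w' hw' w hw
    simp only [Function.comp, hw, hw']
  · have h1 : ContDiffAt ℝ ∞ (K ∘ Φ') z :=
      (ContMDiffAt.comp z (hz ▸ hK.self_of_nhds) h'.contMDiffAt).contDiffAt
    have h2 : HasFDerivAt (K ∘ Φ') (fderiv ℝ (K ∘ Φ') z) ((K' ∘ Φ) z) := by
      rw [hTz]; exact (h1.differentiableAt (by simp)).hasFDerivAt
    have h3 := h2.comp z (hT.self_of_nhds.differentiableAt (by simp)).hasFDerivAt
    have h4 : (K ∘ Φ') ∘ (K' ∘ Φ) =ᶠ[𝓝 z] id := by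
      filter_upwards [hr, hKl] with w h5 h6
      change K (Φ' ((K' ∘ Φ) w)) = w
      rw [h5, h6]
    have h5 := (h3.congr_of_eventuallyEq h4.symm).unique (hasFDerivAt_id z)
    intro a b hab
    have h6 : ∀ a, fderiv ℝ (K ∘ Φ') z (fderiv ℝ (K' ∘ Φ) z a) = a :=
      fun a => congrArg (fun L => L a) h5
    rw [← h6 a, hab, h6 b]

theorem IsTubeAt.congr_of_eventuallyEq {F₁ F₂ : Type*} [NormedAddCommGroup F₁] [NormedSpace ℝ F₁]
    [NormedAddCommGroup F₂] [NormedSpace ℝ F₂] {Φ Φ' : ℝ × F₁ × F₂ → M} {Ψ Ψ' : ℝ × F₁ → S} {t : ℝ}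
    (h : IsTubeAt E E' f δ Φ Ψ t) (hΦ : Φ' =ᶠ[𝓝 (t, 0)] Φ) (hΨ : Ψ' =ᶠ[𝓝 (t, 0)] Ψ) :
    IsTubeAt E E' f δ Φ' Ψ' t where
  diffeo := h.diffeo.congr_of_eventuallyEq hΦ
  diffeo' := h.diffeo'.congr_of_eventuallyEq hΨ
  zero := by
    filter_upwards [h.zero, (tendsto_prodMk_zero t).eventually hΨ] with s h1 h2
    rw [h2, h1]
  comm := by
    filter_upwards [h.comm, hΨ, ((inclFst F₁ F₂).continuous.tendsto (t, 0)).eventually hΦ]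
      with z h1 h2 h3
    rw [h2, ← h1]
    exact h3

/-- A tube can be changed smoothly into another one along a short interval to the left of `b`. -/
theorem IsTubeAt.exists_glue {Φ Φ' : ℝ × F₁ × F₂ → M} {Ψ Ψ' : ℝ × F₁ → S} {b : ℝ}
    (h : IsTubeAt E E' f δ Φ Ψ b) (h' : IsTubeAt E E' f δ Φ' Ψ' b) {η₀ : ℝ} (hη₀ : 0 < η₀) :
    ∃ η, 0 < η ∧ η ≤ η₀ ∧ ∃ (G₁ : F₁ ≃L[ℝ] F₁) (G₂ : F₂ ≃L[ℝ] F₂) (Φ'' : ℝ × F₁ × F₂ → M)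
      (Ψ'' : ℝ × F₁ → S),
      (∀ s < b - η, ∀ x, Φ'' (s, x) = Φ (s, x)) ∧ (∀ s < b - η, ∀ x, Ψ'' (s, x) = Ψ (s, x)) ∧
      (∀ s, b ≤ s → ∀ x, Φ'' (s, x) = Φ' (s, G₁ x.1, G₂ x.2)) ∧
      (∀ s, b ≤ s → ∀ x, Ψ'' (s, x) = Ψ' (s, G₁ x)) ∧
      ∀ s ∈ Icc (b - η) b, IsTubeAt E E' f δ Φ'' Ψ'' s := by
  have hΨ : ∀ᶠ s in 𝓝 b, Ψ (s, 0) = Ψ' (s, 0) := by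
    filter_upwards [h.zero, h'.zero] with s h1 h2 using h1.trans h2.symm
  have hΦ : ∀ᶠ s in 𝓝 b, Φ (s, 0) = Φ' (s, 0) := by
    filter_upwards [hΨ, (tendsto_prodMk_zero b).eventually h.comm,
      (tendsto_prodMk_zero b).eventually h'.comm] with s h1 h2 h3
    exact h2.trans ((congrArg f h1).trans h3.symm)
  obtain ⟨T, hT, hTz, hTr, hTl, hTi⟩ := h.diffeo.exists_transition h'.diffeo hΦ.self_of_nhds
  obtain ⟨T₁, hT₁, hT₁z, hT₁r, hT₁l, -⟩ := h.diffeo'.exists_transition h'.diffeo' hΨ.self_of_nhds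
  have h0 : ∀ᶠ s in 𝓝 b, T (s, 0) = (s, 0) := by
    filter_upwards [hΦ, (tendsto_prodMk_zero b).eventually hTl] with s h1 h2 using h2 _ h1
  have h0₁ : ∀ᶠ s in 𝓝 b, T₁ (s, 0) = (s, 0) := by
    filter_upwards [hΨ, (tendsto_prodMk_zero b).eventually hT₁l] with s h1 h2 using h2 _ h1
  have hT₁t : Tendsto T₁ (𝓝 (b, 0)) (𝓝 (b, 0)) := by
    have := hT₁.self_of_nhds.continuousAt.tendsto
    rwa [hT₁z] at this
  have hcomm : ∀ᶠ z in 𝓝 (b, 0), T (inclFst F₁ F₂ z) = inclFst F₁ F₂ (T₁ z) := by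
    filter_upwards [h.comm, hT₁t.eventually h'.comm, hT₁r, (((inclFst F₁ F₂).continuous.tendsto
      (b, 0)).comp hT₁t).eventually hTl] with z h1 h2 h3 h4
    refine h4 _ ?_
    change Φ (z.1, z.2, 0) = Φ' ((T₁ z).1, (T₁ z).2, 0)
    rw [h1, h2, h3]
  obtain ⟨G₁, G₂, hG⟩ := exists_isLocalDiffeomorphAt_interpolate hT hT₁ hTi h0 h0₁ hcomm
  have hev := (((hG.and h'.eventually).and
    ((tendsto_prodMk_zero b).eventually hTr.eventually_nhds)).and
    ((tendsto_prodMk_zero b).eventually hT₁r.eventually_nhds))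
  obtain ⟨ρ, hρ, hball⟩ := Metric.eventually_nhds_iff.1 hev
  set η := min η₀ (ρ / 2) with hη
  have hηpos : 0 < η := lt_min hη₀ (half_pos hρ)
  have hηρ : η < ρ := (min_le_right _ _).trans_lt (half_lt_self hρ)
  -- The argument reaches `0` at `b - 2η/3` and `1` at `b - η/3`, so `χ` is constant near both ends
  -- of `[b - η, b]`.
  set χ : ℝ → ℝ := fun s => Real.smoothTransition (2 + 3 * (s - b) / η) with hχdef
  have hχ : ContDiff ℝ ∞ χ := Real.smoothTransition.contDiff.comp (by fun_prop)
  have hχ0 : ∀ s < b - η, χ s = 0 := fun s hs => by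
    refine Real.smoothTransition.zero_of_nonpos ?_
    have : 3 * (s - b) / η ≤ -3 := by rw [div_le_iff₀ hηpos]; linarith
    linarith
  have hχ1 : ∀ s, b ≤ s → χ s = 1 := fun s hs => by
    refine Real.smoothTransition.one_of_one_le ?_
    have : 0 ≤ 3 * (s - b) / η := by have := sub_nonneg.2 hs; positivity
    linarith
  refine ⟨η, hηpos, min_le_left _ _, G₁, G₂,
    -- `T` is controlled only near `(b, 0)`, so to the left `Φ` itself is kept. At the seam both
    -- formulas agree near the core, as `χ = 0` there and `Φ' ∘ T = Φ`.
    fun z => if z.1 < b - η then Φ z else Φ' (interpolate χ T (G₁.prodCongr G₂) z),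
    fun z => if z.1 < b - η then Ψ z else Ψ' (interpolate χ T₁ G₁ z),
    fun s hs x => if_pos hs, fun s hs x => if_pos hs, fun s hs x => ?_, fun s hs x => ?_, ?_⟩
  · refine (if_neg (by change ¬ s < b - η; linarith)).trans ?_
    simp [interpolate, hχ1 s hs]
  · refine (if_neg (by change ¬ s < b - η; linarith)).trans ?_
    simp [interpolate, hχ1 s hs]
  · intro s hs
    obtain ⟨⟨⟨h1, h2⟩, h3⟩, h4⟩ := hball (y := s) (by
      rw [Real.dist_eq, abs_lt]; exact ⟨by linarith [hs.1], by linarith [hs.2]⟩)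
    obtain ⟨k1, k2, k3, k4, k5⟩ := h1 χ hχ
      ⟨Real.smoothTransition.nonneg _, Real.smoothTransition.le_one _⟩
    have key : IsTubeAt E E' f δ (Φ' ∘ interpolate χ T (G₁.prodCongr G₂))
        (Ψ' ∘ interpolate χ T₁ G₁) s := by
      have hz : ∀ᶠ s in 𝓝 s, interpolate χ T₁ G₁ (s, 0) = (s, 0) := by
        have hs' : ∀ᶠ s' in 𝓝 s, dist s' b < ρ :=
          (continuous_id.dist continuous_const).continuousAt.eventually_lt continuousAt_const (by
            change dist s b < ρ
            rw [Real.dist_eq, abs_lt]; exact ⟨by linarith [hs.1], by linarith [hs.2]⟩)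
        filter_upwards [hs'] with s' hs'
        exact ((hball hs').1.1.1 χ hχ
          ⟨Real.smoothTransition.nonneg _, Real.smoothTransition.le_one _⟩).2.2.2.1
      refine ⟨k1.comp _ _ (k3.symm ▸ h2.diffeo), k2.comp _ _ (k4.symm ▸ h2.diffeo'), ?_, ?_⟩
      · filter_upwards [hz, h2.zero] with s' e1 e2
        simp only [Function.comp, e1, e2]
      · have ht : Tendsto (interpolate χ T₁ G₁) (𝓝 (s, 0)) (𝓝 (s, 0)) := by
          have := k2.contMDiffAt.continuousAt.tendsto
          rwa [k4] at this
        filter_upwards [k5, ht.eventually h2.comm] with z e1 e2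
        change Φ' (interpolate χ T (G₁.prodCongr G₂) (inclFst F₁ F₂ z)) = _
        rw [e1]
        exact e2
    refine key.congr_of_eventuallyEq ?_ ?_
    · filter_upwards [h3] with z hz
      by_cases hzs : z.1 < b - η
      · rw [if_pos hzs]
        simp [interpolate, hχ0 _ hzs, hz]
      · rw [if_neg hzs]; rfl
    · filter_upwards [h4] with z hz
      by_cases hzs : z.1 < b - η
      · rw [if_pos hzs]
        simp [interpolate, hχ0 _ hzs, hz]
      · rw [if_neg hzs]; rfl

end Gluing

/-! ### Tubes around closed curves -/

section PeriodicTubes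

variable {F₁ : Type*} [NormedAddCommGroup F₁] [NormedSpace ℝ F₁] [FiniteDimensional ℝ F₁]
  {F₂ : Type*} [NormedAddCommGroup F₂] [NormedSpace ℝ F₂] [FiniteDimensional ℝ F₂]
  {E : Type*} [NormedAddCommGroup E] [NormedSpace ℝ E]
  {M : Type*} [TopologicalSpace M] [ChartedSpace E M]
  {E' : Type*} [NormedAddCommGroup E'] [NormedSpace ℝ E']
  {S : Type*} [TopologicalSpace S] [ChartedSpace E' S]
  {f : S → M} {δ : ℝ → S}

/-- A tube on `[a, b]` and a tube on `[b, c]` give a tube on `[a, c]`. -/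
theorem exists_isTubeAt_Icc_of_glue {Φ Φ' : ℝ × F₁ × F₂ → M} {Ψ Ψ' : ℝ × F₁ → S} {a b c : ℝ}
    (hab : a ≤ b) (h : ∀ s ∈ Icc a b, IsTubeAt E E' f δ Φ Ψ s)
    (h' : ∀ s ∈ Icc b c, IsTubeAt E E' f δ Φ' Ψ' s) (hbc : b ≤ c) :
    ∃ (Φ'' : ℝ × F₁ × F₂ → M) (Ψ'' : ℝ × F₁ → S), ∀ s ∈ Icc a c, IsTubeAt E E' f δ Φ'' Ψ'' s := by
  obtain ⟨η, hη, -, G₁, G₂, Φ'', Ψ'', h1, h2, h3, h4, h5⟩ :=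
    (h b ⟨hab, le_rfl⟩).exists_glue (h' b ⟨le_rfl, hbc⟩) one_pos
  refine ⟨Φ'', Ψ'', fun s hs => ?_⟩
  rcases lt_or_ge s (b - η) with hsb | hsb
  · refine (h s ⟨hs.1, by linarith⟩).congr ?_ ?_
    · filter_upwards [Iio_mem_nhds hsb] with s' hs' using h1 s' hs'
    · filter_upwards [Iio_mem_nhds hsb] with s' hs' using h2 s' hs'
  rcases le_or_gt s b with hsb' | hsb'
  · exact h5 s ⟨hsb, hsb'⟩
  · have h6 : IsTubeAt E E' f δ Φ' Ψ' (s - 0) := by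
      rw [sub_zero]; exact h' s ⟨hsb'.le, hs.2⟩
    refine (h6.shift 0 (by simp) G₁ G₂).congr ?_ ?_
    · filter_upwards [Ioi_mem_nhds hsb'] with s' hs' x
      rw [h3 s' (le_of_lt hs') x, sub_zero]
    · filter_upwards [Ioi_mem_nhds hsb'] with s' hs' x
      rw [h4 s' (le_of_lt hs') x, sub_zero]

/-- Continuous induction on the right end point: a tube extends a little because the tube condition
is open, and past a limit of end points by gluing with a local tube there. -/
theorem exists_isTubeAt_Icc (hloc : ∀ t, ∃ (Φ : ℝ × F₁ × F₂ → M) (Ψ : ℝ × F₁ → S),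
    IsTubeAt E E' f δ Φ Ψ t) {a b : ℝ} (hab : a ≤ b) :
    ∃ (Φ : ℝ × F₁ × F₂ → M) (Ψ : ℝ × F₁ → S), ∀ s ∈ Icc a b, IsTubeAt E E' f δ Φ Ψ s := by
  set Q : Set ℝ := {c | ∃ (Φ : ℝ × F₁ × F₂ → M) (Ψ : ℝ × F₁ → S), ∀ s ∈ Icc a c,
    IsTubeAt E E' f δ Φ Ψ s} with hQ
  suffices Icc a b ⊆ Q from this ⟨hab, le_rfl⟩
  refine IsClosed.Icc_subset_of_forall_exists_gt ?_ ?_ ?_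
  · refine isClosed_of_closure_subset fun c hc => ?_
    have hcI : c ∈ Icc a b := isClosed_Icc.closure_subset (closure_mono inter_subset_right hc)
    refine ⟨?_, hcI⟩
    obtain ⟨Φ', Ψ', h'⟩ := hloc c
    obtain ⟨ρ, hρ, hball⟩ := Metric.eventually_nhds_iff.1 h'.eventually
    obtain ⟨d, ⟨⟨Φ, Ψ, h⟩, hd⟩, hdc⟩ := Metric.mem_closure_iff.1 hc ρ hρ
    rcases le_or_gt c d with hcd | hcd
    · exact ⟨Φ, Ψ, fun s hs => h s ⟨hs.1, hs.2.trans hcd⟩⟩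
    · refine exists_isTubeAt_Icc_of_glue hd.1 h (fun s hs => hball ?_) hcd.le
      rw [Real.dist_eq, abs_lt] at hdc ⊢
      exact ⟨by linarith [hs.1], by linarith [hs.2]⟩
  · obtain ⟨Φ, Ψ, h⟩ := hloc a
    exact ⟨Φ, Ψ, fun s hs => by rwa [le_antisymm hs.2 hs.1]⟩
  · rintro c ⟨⟨Φ, Ψ, h⟩, hc⟩ y hy
    obtain ⟨ρ, hρ, hball⟩ := Metric.eventually_nhds_iff.1 (h c ⟨hc.1, le_rfl⟩).eventually
    refine ⟨min y (c + ρ / 2), ⟨Φ, Ψ, fun s hs => ?_⟩, lt_min hy (by linarith), min_le_left _ _⟩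
    rcases le_or_gt s c with hsc | hsc
    · exact h s ⟨hs.1, hsc⟩
    · refine hball ?_
      rw [Real.dist_eq, abs_lt]
      exact ⟨by linarith, by linarith [hs.2.trans (min_le_right _ _)]⟩

/-- A closed curve has a tube which is periodic up to linear isomorphisms of the fibres. -/
theorem exists_isTubeAt_periodic (hδ : Function.Periodic δ 1)
    (hloc : ∀ t, ∃ (Φ : ℝ × F₁ × F₂ → M) (Ψ : ℝ × F₁ → S), IsTubeAt E E' f δ Φ Ψ t) :
    ∃ (A₁ : F₁ ≃L[ℝ] F₁) (A₂ : F₂ ≃L[ℝ] F₂) (Φ : ℝ × F₁ × F₂ → M) (Ψ : ℝ × F₁ → S),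
      (∀ t x, Φ (t + 1, x) = Φ (t, A₁.prodCongr A₂ x)) ∧ (∀ t x, Ψ (t + 1, x) = Ψ (t, A₁ x)) ∧
      ∀ t, IsTubeAt E E' f δ Φ Ψ t := by
  have hδn : ∀ (n : ℤ) s, δ (s - n) = δ s := fun n s => by
    simpa using hδ.sub_zsmul_eq n (x := s)
  obtain ⟨Φ, Ψ, h⟩ := exists_isTubeAt_Icc hloc zero_le_one
  -- The tube over `[0, 1]` is glued at `1` to its own translate; the linear maps produced by the
  -- gluing become the monodromy. The bound `1 / 4` keeps the change away from the beginning of the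
  -- period.
  have h' : IsTubeAt E E' f δ (fun z => Φ (z.1 - 1, z.2)) (fun z => Ψ (z.1 - 1, z.2)) 1 := by
    have h0 : IsTubeAt E E' f δ Φ Ψ (1 - 1) := by rw [sub_self]; exact h 0 ⟨le_rfl, zero_le_one⟩
    exact h0.shift 1 (by simpa using hδn 1) (ContinuousLinearEquiv.refl ℝ F₁)
      (ContinuousLinearEquiv.refl ℝ F₂)
  obtain ⟨η, hη, hη4, A₁, A₂, Φ'', Ψ'', h1, h2, h3, h4, h5⟩ :=
    (h 1 ⟨zero_le_one, le_rfl⟩).exists_glue h' (η₀ := 1 / 4) (by norm_num)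
  have htube : ∀ s ∈ Icc (0 : ℝ) 1, IsTubeAt E E' f δ Φ'' Ψ'' s := by
    intro s hs
    rcases lt_or_ge s (1 - η) with hsb | hsb
    · refine (h s hs).congr ?_ ?_
      · filter_upwards [Iio_mem_nhds hsb] with s' hs' using h1 s' hs'
      · filter_upwards [Iio_mem_nhds hsb] with s' hs' using h2 s' hs'
    · exact h5 s ⟨hsb, hs.2⟩
  refine ⟨A₁, A₂, fun z => Φ'' (Int.fract z.1, (A₁ ^ ⌊z.1⌋) z.2.1, (A₂ ^ ⌊z.1⌋) z.2.2),
    fun z => Ψ'' (Int.fract z.1, (A₁ ^ ⌊z.1⌋) z.2), fun t x => ?_, fun t x => ?_, fun t => ?_⟩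
  · simp only [Int.fract_add_one, Int.floor_add_one, zpow_add_one]
    rfl
  · simp only [Int.fract_add_one, Int.floor_add_one, zpow_add_one]
    rfl
  -- At an integer `n` the comparison is with the end `1` of the preceding period. Just to the right
  -- of `n`, the new tube is still the original one, which is what the glued tube continues to
  -- beyond `1`, up to the monodromy.
  · rcases eq_or_lt_of_le (Int.floor_le t) with hn | hn
    · set n : ℤ := ⌊t⌋ with hndef
      have h6 : IsTubeAt E E' f δ Φ'' Ψ'' (t - ((n - 1 : ℤ) : ℝ)) := by
        have : t - ((n - 1 : ℤ) : ℝ) = 1 := by push_cast; linarith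
        rw [this]; exact htube 1 ⟨zero_le_one, le_rfl⟩
      have hnear : ∀ᶠ s in 𝓝 t, s ∈ Ioo ((n : ℝ) - 1) (n + 1 / 2) :=
        Ioo_mem_nhds (by linarith) (by linarith)
      have hfloor1 : ∀ s ∈ Ioo ((n : ℝ) - 1) (n + 1 / 2), s < n →
          ⌊s⌋ = n - 1 := fun s hs hsn => by
        rw [Int.floor_eq_iff]; push_cast; exact ⟨hs.1.le, by linarith⟩
      have hfloor2 : ∀ s ∈ Ioo ((n : ℝ) - 1) (n + 1 / 2), (n : ℝ) ≤ s → ⌊s⌋ = n :=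
        fun s hs hsn => by
        rw [Int.floor_eq_iff]; exact ⟨hsn, by linarith [hs.2]⟩
      have hzpow₁ : ∀ x, A₁ ((A₁ ^ (n - 1)) x) = (A₁ ^ n) x := fun x => by
        have : A₁ ^ n = A₁ * A₁ ^ (n - 1) := by rw [← zpow_one_add, add_sub_cancel]
        rw [this]; rfl
      have hzpow₂ : ∀ x, A₂ ((A₂ ^ (n - 1)) x) = (A₂ ^ n) x := fun x => by
        have : A₂ ^ n = A₂ * A₂ ^ (n - 1) := by rw [← zpow_one_add, add_sub_cancel]
        rw [this]; rfl
      refine (h6.shift ((n - 1 : ℤ) : ℝ) (hδn (n - 1)) (A₁ ^ (n - 1)) (A₂ ^ (n - 1))).congr ?_ ?_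
      · filter_upwards [hnear] with s hs x
        rcases lt_or_ge s n with hsn | hsn
        · simp only [Int.fract, hfloor1 s hs hsn]
        · simp only [Int.fract, hfloor2 s hs hsn]
          rw [h1 (s - n) (by linarith [hs.2]),
            h3 (s - ((n - 1 : ℤ) : ℝ)) (by push_cast; linarith)]
          simp only [hzpow₁, hzpow₂]
          congr 2
          push_cast; ring
      · filter_upwards [hnear] with s hs x
        rcases lt_or_ge s n with hsn | hsn
        · simp only [Int.fract, hfloor1 s hs hsn]
        · simp only [Int.fract, hfloor2 s hs hsn]
          rw [h2 (s - n) (by linarith [hs.2]),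
            h4 (s - ((n - 1 : ℤ) : ℝ)) (by push_cast; linarith)]
          simp only [hzpow₁]
          congr 2
          push_cast; ring
    · set n : ℤ := ⌊t⌋ with hndef
      have hlt : t < n + 1 := Int.lt_floor_add_one t
      have hfloor : ∀ᶠ s in 𝓝 t, ⌊s⌋ = n := by
        filter_upwards [Ioo_mem_nhds hn hlt] with s hs
        rw [Int.floor_eq_iff]; exact ⟨hs.1.le, hs.2⟩
      refine ((htube (t - n) ⟨by linarith, by linarith⟩).shift n (hδn n) (A₁ ^ n)
        (A₂ ^ n)).congr ?_ ?_
      · filter_upwards [hfloor] with s hs x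
        simp only [Int.fract, hs]
      · filter_upwards [hfloor] with s hs x
        simp only [Int.fract, hs]

end PeriodicTubes

/-! ### Vector fields along loops in tubes -/

section TangentMaps

variable {E : Type*} [NormedAddCommGroup E] [NormedSpace ℝ E]
  {M : Type*} [TopologicalSpace M] [ChartedSpace E M]
  {E' : Type*} [NormedAddCommGroup E'] [NormedSpace ℝ E']
  {S : Type*} [TopologicalSpace S] [ChartedSpace E' S]
  {N : Type*} [NormedAddCommGroup N] [NormedSpace ℝ N]
  {P : Type*} [NormedAddCommGroup P] [NormedSpace ℝ P]

theorem tangentBundle_mk_congr {p q : M} (h : p = q) (v : E) :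
    (⟨p, v⟩ : TangentBundle 𝓘(ℝ, E) M) = ⟨q, v⟩ := by
  subst h
  rfl

theorem tangentBundle_mk_inj {p q : M} {v w : E}
    (h : (⟨p, v⟩ : TangentBundle 𝓘(ℝ, E) M) = ⟨q, w⟩) : v = w := by
  cases h
  rfl

theorem ContMDiffAt.tangentMap_along [IsManifold 𝓘(ℝ, E) ∞ M] [IsManifold 𝓘(ℝ, E') ∞ S]
    {g : S → M} {b : N → S} {X : ∀ n, TangentSpace 𝓘(ℝ, E') (b n)} {n₀ : N}
    (hX : ContMDiffAt 𝓘(ℝ, N) 𝓘(ℝ, E').tangent ∞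
      (fun n => (⟨b n, X n⟩ : TangentBundle 𝓘(ℝ, E') S)) n₀)
    (hg : ∀ᶠ p in 𝓝 (b n₀), ContMDiffAt 𝓘(ℝ, E') 𝓘(ℝ, E) ∞ g p) :
    ContMDiffAt 𝓘(ℝ, N) 𝓘(ℝ, E).tangent ∞
      (fun n => (⟨g (b n), mfderiv 𝓘(ℝ, E') 𝓘(ℝ, E) g (b n) (X n)⟩ :
        TangentBundle 𝓘(ℝ, E) M)) n₀ := by
  have : IsManifold 𝓘(ℝ, E) 1 M := IsManifold.of_le (n := ∞) (by simp)
  have : IsManifold 𝓘(ℝ, E') 1 S := IsManifold.of_le (n := ∞) (by simp)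
  obtain ⟨U, hU, hUo, hbU⟩ := mem_nhds_iff.1 hg
  have hgU : ContMDiffOn 𝓘(ℝ, E') 𝓘(ℝ, E) ∞ g U := fun p hp => (hU hp).contMDiffWithinAt
  have h1 := hgU.contMDiffOn_tangentMapWithin (m := ∞) (by simp) hUo.uniqueMDiffOn
  have hπ : IsOpen (Bundle.TotalSpace.proj ⁻¹' U : Set (TangentBundle 𝓘(ℝ, E') S)) :=
    hUo.preimage (FiberBundle.continuous_proj E' (TangentSpace 𝓘(ℝ, E') : S → Type _))
  have h2 := (h1.contMDiffAt (x := ⟨b n₀, X n₀⟩) (hπ.mem_nhds hbU)).comp n₀ hX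
  refine h2.congr_of_eventuallyEq ?_
  have hb : ContinuousAt b n₀ :=
    ((FiberBundle.continuous_proj E' (TangentSpace 𝓘(ℝ, E') : S → Type _)).continuousAt.comp
      hX.continuousAt :)
  filter_upwards [hb.eventually_mem (hUo.mem_nhds hbU)] with n hn
  simp only [Function.comp, tangentMapWithin, mfderivWithin_of_isOpen hUo hn]

theorem ContDiffAt.contMDiffAt_tangentBundle_mk {a v : N → P} {n₀ : N} (ha : ContDiffAt ℝ ∞ a n₀)
    (hv : ContDiffAt ℝ ∞ v n₀) : ContMDiffAt 𝓘(ℝ, N) 𝓘(ℝ, P).tangent ∞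
      (fun n => (⟨a n, v n⟩ : TangentBundle 𝓘(ℝ, P) P)) n₀ := by
  refine Bundle.contMDiffAt_totalSpace.2 ⟨ha.contMDiffAt, ?_⟩
  convert! hv.contMDiffAt with n
  simp

theorem ContMDiffAt.mfderiv_along [IsManifold 𝓘(ℝ, E) ∞ M]
    {g : M → P} {b : N → M} {X : ∀ n, TangentSpace 𝓘(ℝ, E) (b n)} {n₀ : N}
    (hX : ContMDiffAt 𝓘(ℝ, N) 𝓘(ℝ, E).tangent ∞
      (fun n => (⟨b n, X n⟩ : TangentBundle 𝓘(ℝ, E) M)) n₀)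
    (hg : ∀ᶠ p in 𝓝 (b n₀), ContMDiffAt 𝓘(ℝ, E) 𝓘(ℝ, P) ∞ g p) :
    ContDiffAt ℝ ∞ (fun n => (mfderiv 𝓘(ℝ, E) 𝓘(ℝ, P) g (b n) (X n) : P)) n₀ :=
  ((contMDiff_snd_tangentBundle_modelSpace P 𝓘(ℝ, P)).contMDiffAt.comp n₀
    (hX.tangentMap_along hg)).contDiffAt

/-- The differential, as a linear map between the model spaces. -/
def diffAt (E : Type*) [NormedAddCommGroup E] [NormedSpace ℝ E] [ChartedSpace E M] (Φ : P → M)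
    (z : P) : P →L[ℝ] E :=
  mfderiv 𝓘(ℝ, P) 𝓘(ℝ, E) Φ z

theorem mfderiv_comp_curve {Φ : P → M} {c : ℝ → P} {t : ℝ} {z v : P}
    (hΦ : MDifferentiableAt 𝓘(ℝ, P) 𝓘(ℝ, E) Φ z) (hc : HasDerivAt c v t) (hz : c t = z) :
    (mfderiv 𝓘(ℝ, ℝ) 𝓘(ℝ, E) (Φ ∘ c) t (1 : ℝ) : E) = diffAt E Φ z v := by
  subst hz
  exact mfderiv_comp_apply_one hΦ hc

/-- The differential of a local diffeomorphism, as a linear isomorphism between the model spaces. -/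
def diffEquiv {Φ : P → M} {z : P} (h : IsLocalDiffeomorphAt 𝓘(ℝ, P) 𝓘(ℝ, E) ∞ Φ z) :
    P ≃L[ℝ] E :=
  h.mfderivToContinuousLinearEquiv (by simp)

theorem diffEquiv_apply {Φ : P → M} {z : P} (h : IsLocalDiffeomorphAt 𝓘(ℝ, P) 𝓘(ℝ, E) ∞ Φ z)
    (v : P) : diffEquiv h v = diffAt E Φ z v := rfl

/-- The coordinates, with respect to local diffeomorphisms, of a smooth vector field along a smooth
map are smooth. -/
theorem contDiffAt_diffEquiv_symm [IsManifold 𝓘(ℝ, E) ∞ M] {Φ : P → M} {a : N → P}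
    {X : N → E} {n₀ : N} (h : ∀ n, IsLocalDiffeomorphAt 𝓘(ℝ, P) 𝓘(ℝ, E) ∞ Φ (a n))
    (ha : ContinuousAt a n₀)
    (hX : ContMDiffAt 𝓘(ℝ, N) 𝓘(ℝ, E).tangent ∞
      (fun n => (⟨Φ (a n), X n⟩ : TangentBundle 𝓘(ℝ, E) M)) n₀) :
    ContDiffAt ℝ ∞ (fun n => (diffEquiv (h n)).symm (X n)) n₀ := by
  obtain ⟨G, hG, hGl, -⟩ := (h n₀).exists_inverse
  refine (ContMDiffAt.mfderiv_along (b := fun n => Φ (a n)) (X := fun n => X n) hX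
    hG).congr_of_eventuallyEq ?_
  have hc : ContinuousAt (fun n => Φ (a n)) n₀ :=
    ContinuousAt.comp (g := Φ) (h n₀).contMDiffAt.continuousAt ha
  filter_upwards [hc.eventually hG, ha.eventually hGl.eventually_nhds] with n h1 h2
  refine (diffEquiv (h n)).injective ?_
  rw [ContinuousLinearEquiv.apply_symm_apply]
  obtain ⟨v, hv⟩ := (diffEquiv (h n)).surjective (X n)
  have h3 : mfderiv 𝓘(ℝ, E) 𝓘(ℝ, P) G (Φ (a n)) (mfderiv 𝓘(ℝ, P) 𝓘(ℝ, E) Φ (a n) v) = v := by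
    have h4 := mfderiv_comp (a n) (h1.mdifferentiableAt (by simp))
      ((h n).contMDiffAt.mdifferentiableAt (by simp))
    have h5 : mfderiv 𝓘(ℝ, P) 𝓘(ℝ, P) (G ∘ Φ) (a n) = mfderiv 𝓘(ℝ, P) 𝓘(ℝ, P) id (a n) :=
      Filter.EventuallyEq.mfderiv_eq h2
    rw [mfderiv_id] at h5
    have h6 := h4.symm.trans h5
    exact congrArg (fun L => L v) h6
  rw [← hv]
  exact congrArg (diffEquiv (h n)) h3.symm

/-- Vector fields along smooth maps given by smooth coordinates are smooth. -/
theorem contMDiffAt_diffAt [IsManifold 𝓘(ℝ, E) ∞ M] {Φ : P → M} {a v : N → P} {n₀ : N}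
    (h : IsLocalDiffeomorphAt 𝓘(ℝ, P) 𝓘(ℝ, E) ∞ Φ (a n₀)) (ha : ContDiffAt ℝ ∞ a n₀)
    (hv : ContDiffAt ℝ ∞ v n₀) :
    ContMDiffAt 𝓘(ℝ, N) 𝓘(ℝ, E).tangent ∞
      (fun n => (⟨Φ (a n), diffAt E Φ (a n) (v n)⟩ : TangentBundle 𝓘(ℝ, E) M)) n₀ :=
  (ContDiffAt.contMDiffAt_tangentBundle_mk ha hv).tangentMap_along
    (h.eventually.mono fun _ hp => hp.contMDiffAt)

end TangentMaps

/-! ### Normal sections as twisted periodic functions -/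

section NormalSections

variable {F : Type*} [NormedAddCommGroup F] [NormedSpace ℝ F] {A : F ≃L[ℝ] F}
  {E : Type*} [NormedAddCommGroup E] [NormedSpace ℝ E]
  {M : Type*} [TopologicalSpace M] [ChartedSpace E M] {Φ : ℝ × F → M}

theorem diffAt_add_one (hΦ : ∀ t x, Φ (t + 1, x) = Φ (t, A x)) {t : ℝ}
    (h : IsLocalDiffeomorphAt 𝓘(ℝ, ℝ × F) 𝓘(ℝ, E) ∞ Φ (t, 0))
    (h' : IsLocalDiffeomorphAt 𝓘(ℝ, ℝ × F) 𝓘(ℝ, E) ∞ Φ (t + 1, 0)) (r : ℝ) (x : F) :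
    diffAt E Φ (t + 1, 0) (r, x) = diffAt E Φ (t, 0) (r, A x) := by
  have hc : HasDerivAt (fun s : ℝ => (t + s * r + 1, s • x)) (r, x) 0 := by
    simpa using (((hasDerivAt_id (0 : ℝ)).mul_const r).const_add t |>.add_const 1).prodMk
      ((hasDerivAt_id (0 : ℝ)).smul_const x)
  have hc' : HasDerivAt (fun s : ℝ => (t + s * r, s • A x)) (r, A x) 0 := by
    simpa using (((hasDerivAt_id (0 : ℝ)).mul_const r).const_add t).prodMk
      ((hasDerivAt_id (0 : ℝ)).smul_const (A x))
  have h1 := mfderiv_comp_curve (h'.contMDiffAt.mdifferentiableAt (by simp)) hc (by simp)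
  have h2 := mfderiv_comp_curve (h.contMDiffAt.mdifferentiableAt (by simp)) hc' (by simp)
  rw [← h1, ← h2]
  have h3 : Φ ∘ (fun s : ℝ => (t + s * r + 1, s • x)) = Φ ∘ fun s : ℝ => (t + s * r, s • A x) := by
    ext s
    simp [hΦ]
  rw [h3]

theorem velocity_eq_diffAt {γ : Loop 𝓘(ℝ, E) M}
    (h₀ : ∀ t, IsLocalDiffeomorphAt 𝓘(ℝ, ℝ × F) 𝓘(ℝ, E) ∞ Φ (t, 0))
    (hγ : ∀ t, γ.toFun t = Φ (t, 0)) (t : ℝ) :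
    (γ.velocity t : E) = diffAt E Φ (t, 0) (1, 0) := by
  have hc : HasDerivAt (fun s : ℝ => (s, (0 : F))) (1, 0) t :=
    (hasDerivAt_id t).prodMk (hasDerivAt_const t _)
  rw [← mfderiv_comp_curve ((h₀ t).contMDiffAt.mdifferentiableAt (by simp)) hc rfl]
  have h1 : γ.toFun = Φ ∘ fun s : ℝ => (s, (0 : F)) := funext hγ
  exact congrArg (fun g : ℝ → M => (mfderiv 𝓘(ℝ, ℝ) 𝓘(ℝ, E) g t (1 : ℝ) : E)) h1

variable [IsManifold 𝓘(ℝ, E) ∞ M] {γ : Loop 𝓘(ℝ, E) M}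

/-- The vector field along the core of the tube `Φ` given by a section. -/
def tubeField (hΦ : ∀ t x, Φ (t + 1, x) = Φ (t, A x))
    (h₀ : ∀ t, IsLocalDiffeomorphAt 𝓘(ℝ, ℝ × F) 𝓘(ℝ, E) ∞ Φ (t, 0))
    (hγ : ∀ t, γ.toFun t = Φ (t, 0)) : twistedSections A →ₗ[ℝ] γ.fields where
  toFun x := ⟨fun t => diffAt E Φ (t, 0) (0, x.1 t), by
    refine ⟨fun t => ?_, fun t => ?_⟩
    · refine (contMDiffAt_diffAt (a := fun t : ℝ => (t, (0 : F))) (v := fun t => ((0 : ℝ), x.1 t))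
        (h₀ t) (by fun_prop) (contDiffAt_const.prodMk x.2.1.contDiffAt)).congr_of_eventuallyEq ?_
      exact Eventually.of_forall fun s => tangentBundle_mk_congr (hγ s) _
    · have h1 : diffAt E Φ (t + 1, 0) (0, x.1 (t + 1)) = diffAt E Φ (t, 0) (0, x.1 t) := by
        rw [diffAt_add_one hΦ (h₀ t) (h₀ (t + 1)), x.2.2]
      exact (tangentBundle_mk_congr (γ.periodic t) _).trans
        (congrArg (fun v : E => (⟨γ.toFun t, v⟩ : TangentBundle 𝓘(ℝ, E) M)) h1)⟩
  map_add' x y := Subtype.ext <| funext fun t => by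
    change diffAt E Φ (t, 0) (0, x.1 t + y.1 t) = _
    rw [← zero_add (0 : ℝ), ← Prod.mk_add_mk, map_add]
    simp only [zero_add]
    rfl
  map_smul' r x := Subtype.ext <| funext fun t => by
    change diffAt E Φ (t, 0) (0, r • x.1 t) = r • diffAt E Φ (t, 0) (0, x.1 t)
    rw [← map_smul]
    simp

/-- The normal coordinates of a vector field along the core of the tube. -/
def tubeCoord (hΦ : ∀ t x, Φ (t + 1, x) = Φ (t, A x))
    (h₀ : ∀ t, IsLocalDiffeomorphAt 𝓘(ℝ, ℝ × F) 𝓘(ℝ, E) ∞ Φ (t, 0))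
    (hγ : ∀ t, γ.toFun t = Φ (t, 0)) : γ.fields →ₗ[ℝ] twistedSections A where
  toFun X := ⟨fun t => ((diffEquiv (h₀ t)).symm (X.1 t)).2, by
    refine ⟨contDiff_iff_contDiffAt.2 fun t => ?_, fun t => ?_⟩
    · refine contDiffAt_snd.comp t (contDiffAt_diffEquiv_symm (a := fun t : ℝ => (t, (0 : F)))
        (X := fun t => X.1 t) h₀ (by fun_prop) ((X.2.1 t).congr_of_eventuallyEq ?_))
      exact Eventually.of_forall fun s => (tangentBundle_mk_congr (hγ s) _).symm
    · have h1 : (X.1 (t + 1) : E) = X.1 t := tangentBundle_mk_inj (E := E) (M := M) (X.2.2 t)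
      set w := (diffEquiv (h₀ (t + 1))).symm (X.1 (t + 1)) with hw
      have h2 : diffEquiv (h₀ t) (w.1, A w.2) = X.1 t := by
        rw [diffEquiv_apply, ← diffAt_add_one hΦ (h₀ t) (h₀ (t + 1)),
          ← diffEquiv_apply (h₀ (t + 1)), hw]
        exact ((diffEquiv (h₀ (t + 1))).apply_symm_apply _).trans h1
      have h3 : (diffEquiv (h₀ t)).symm (X.1 t) = (w.1, A w.2) :=
        (congrArg _ h2.symm).trans ((diffEquiv (h₀ t)).symm_apply_apply _)
      exact (congrArg Prod.snd h3).symm⟩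
  map_add' X Y := Subtype.ext <| funext fun t =>
    congrArg Prod.snd (map_add (diffEquiv (h₀ t)).symm (X.1 t) (Y.1 t))
  map_smul' r X := Subtype.ext <| funext fun t =>
    congrArg Prod.snd (map_smul (diffEquiv (h₀ t)).symm r (X.1 t))

theorem tubeCoord_apply (hΦ : ∀ t x, Φ (t + 1, x) = Φ (t, A x))
    (h₀ : ∀ t, IsLocalDiffeomorphAt 𝓘(ℝ, ℝ × F) 𝓘(ℝ, E) ∞ Φ (t, 0))
    (hγ : ∀ t, γ.toFun t = Φ (t, 0)) (X : γ.fields) (t : ℝ) :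
    (tubeCoord hΦ h₀ hγ X).1 t = ((diffEquiv (h₀ t)).symm (X.1 t)).2 := rfl

theorem tubeCoord_tubeField (hΦ : ∀ t x, Φ (t + 1, x) = Φ (t, A x))
    (h₀ : ∀ t, IsLocalDiffeomorphAt 𝓘(ℝ, ℝ × F) 𝓘(ℝ, E) ∞ Φ (t, 0))
    (hγ : ∀ t, γ.toFun t = Φ (t, 0)) (x : twistedSections A) :
    tubeCoord hΦ h₀ hγ (tubeField hΦ h₀ hγ x) = x :=
  Subtype.ext <| funext fun t =>
    congrArg Prod.snd ((diffEquiv (h₀ t)).symm_apply_apply ((0 : ℝ), x.1 t))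

/-- The velocity of the core is the image of `(1, 0)` under the differential of the tube, so
tangency to the loop means that the fibre component vanishes. -/
theorem mem_tangentialFields_iff (hΦ : ∀ t x, Φ (t + 1, x) = Φ (t, A x))
    (h₀ : ∀ t, IsLocalDiffeomorphAt 𝓘(ℝ, ℝ × F) 𝓘(ℝ, E) ∞ Φ (t, 0))
    (hγ : ∀ t, γ.toFun t = Φ (t, 0)) (X : γ.fields) :
    X ∈ γ.tangentialFields ↔ tubeCoord hΦ h₀ hγ X = 0 := by
  have key : ∀ t, X.1 t ∈ Submodule.span ℝ {γ.velocity t} ↔ (tubeCoord hΦ h₀ hγ X).1 t = 0 := by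
    intro t
    rw [Submodule.mem_span_singleton]
    have hv : (γ.velocity t : E) = diffEquiv (h₀ t) (1, 0) := velocity_eq_diffAt h₀ hγ t
    constructor
    · rintro ⟨r, hr⟩
      have h1 : diffEquiv (h₀ t) (r • (1, 0)) = X.1 t := by
        rw [map_smul, ← hv]; exact hr
      have h2 : (diffEquiv (h₀ t)).symm (X.1 t) = r • (1, 0) :=
        (congrArg _ h1.symm).trans ((diffEquiv (h₀ t)).symm_apply_apply _)
      rw [tubeCoord_apply]
      refine (congrArg Prod.snd h2).trans ?_
      simp
    · intro h
      refine ⟨((diffEquiv (h₀ t)).symm (X.1 t)).1, ?_⟩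
      have h1 : ((diffEquiv (h₀ t)).symm (X.1 t)) =
          ((diffEquiv (h₀ t)).symm (X.1 t)).1 • ((1 : ℝ), (0 : F)) := by
        refine Prod.ext ?_ ?_
        · simp
        · rw [tubeCoord_apply] at h
          simpa using h
      have h2 : diffEquiv (h₀ t) (((diffEquiv (h₀ t)).symm (X.1 t)).1 • ((1 : ℝ), (0 : F))) =
          X.1 t :=
        (congrArg (diffEquiv (h₀ t)) h1.symm).trans ((diffEquiv (h₀ t)).apply_symm_apply _)
      rw [map_smul, ← hv] at h2
      exact h2
  exact ⟨fun h => Subtype.ext <| funext fun t => (key t).1 (h t),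
    fun h t => (key t).2 (by rw [h]; rfl)⟩

/-- The sections of the normal bundle of the core of a tube. -/
def normalEquiv (hΦ : ∀ t x, Φ (t + 1, x) = Φ (t, A x))
    (h₀ : ∀ t, IsLocalDiffeomorphAt 𝓘(ℝ, ℝ × F) 𝓘(ℝ, E) ∞ Φ (t, 0))
    (hγ : ∀ t, γ.toFun t = Φ (t, 0)) : γ.NormalSections ≃ₗ[ℝ] twistedSections A :=
  LinearEquiv.ofLinearMap
    (γ.tangentialFields.liftQ (tubeCoord hΦ h₀ hγ) fun X hX =>
      (mem_tangentialFields_iff hΦ h₀ hγ X).1 hX)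
    (γ.tangentialFields.mkQ ∘ₗ tubeField hΦ h₀ hγ)
    (by
      ext x : 1
      exact tubeCoord_tubeField hΦ h₀ hγ x)
    (by
      ext X : 2
      refine (Submodule.Quotient.eq _).2 ?_
      rw [mem_tangentialFields_iff hΦ h₀ hγ, map_sub, sub_eq_zero]
      exact tubeCoord_tubeField hΦ h₀ hγ _)

theorem normalEquiv_mkQ (hΦ : ∀ t x, Φ (t + 1, x) = Φ (t, A x))
    (h₀ : ∀ t, IsLocalDiffeomorphAt 𝓘(ℝ, ℝ × F) 𝓘(ℝ, E) ∞ Φ (t, 0))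
    (hγ : ∀ t, γ.toFun t = Φ (t, 0)) (X : γ.fields) :
    normalEquiv hΦ h₀ hγ (γ.tangentialFields.mkQ X) = tubeCoord hΦ h₀ hγ X := rfl

theorem normalEquiv_symm_apply (hΦ : ∀ t x, Φ (t + 1, x) = Φ (t, A x))
    (h₀ : ∀ t, IsLocalDiffeomorphAt 𝓘(ℝ, ℝ × F) 𝓘(ℝ, E) ∞ Φ (t, 0))
    (hγ : ∀ t, γ.toFun t = Φ (t, 0)) (x : twistedSections A) :
    (normalEquiv hΦ h₀ hγ).symm x = γ.tangentialFields.mkQ (tubeField hΦ h₀ hγ x) := rfl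

theorem isSmoothCurve_normalEquiv_comp_iff (hΦ : ∀ t x, Φ (t + 1, x) = Φ (t, A x))
    (h₀ : ∀ t, IsLocalDiffeomorphAt 𝓘(ℝ, ℝ × F) 𝓘(ℝ, E) ∞ Φ (t, 0))
    (hγ : ∀ t, γ.toFun t = Φ (t, 0)) (c : ℝ → γ.NormalSections) :
    IsSmoothCurve (normalEquiv hΦ h₀ hγ ∘ c) ↔ IsSmoothCurve c := by
  constructor
  · intro h
    have h' : ContDiff ℝ ∞ fun q : ℝ × ℝ => (normalEquiv hΦ h₀ hγ (c q.1)).1 q.2 := h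
    refine ⟨fun u => tubeField hΦ h₀ hγ (normalEquiv hΦ h₀ hγ (c u)), fun q => ?_, fun u => ?_⟩
    · refine (contMDiffAt_diffAt (a := fun q : ℝ × ℝ => (q.2, (0 : F)))
        (v := fun q => ((0 : ℝ), (normalEquiv hΦ h₀ hγ (c q.1)).1 q.2))
        (h₀ q.2) (by fun_prop) (contDiffAt_const.prodMk h'.contDiffAt)).congr_of_eventuallyEq ?_
      exact Eventually.of_forall fun s => tangentBundle_mk_congr (hγ s.2) _
    · rw [← normalEquiv_symm_apply, LinearEquiv.symm_apply_apply]
  · rintro ⟨X, hX, hc⟩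
    change ContDiff ℝ ∞ fun q : ℝ × ℝ => (normalEquiv hΦ h₀ hγ (c q.1)).1 q.2
    simp only [hc, normalEquiv_mkQ, tubeCoord_apply]
    refine contDiff_iff_contDiffAt.2 fun q => contDiffAt_snd.comp q
      (contDiffAt_diffEquiv_symm (a := fun q : ℝ × ℝ => (q.2, (0 : F)))
        (X := fun q => (X q.1).1 q.2) (fun q => h₀ q.2) (by fun_prop)
        ((hX q).congr_of_eventuallyEq ?_))
    exact Eventually.of_forall fun s => (tangentBundle_mk_congr (hγ s.2) _).symm

end NormalSections

/-! ### Isotropic subspaces for forms of Cayley type -/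

section Cayley

theorem re_eq_zero_of_mem_imCayley {a : ℍ[ℝ] × ℍ[ℝ]} (ha : a ∈ imCayley) : a.1.re = 0 := by
  have h1 : cayleyConj a = -a := ha
  have h2 := congrArg (fun z : ℍ[ℝ] × ℍ[ℝ] => z.1.re) h1
  simp only [cayleyConj, Quaternion.re_star, Prod.fst_neg, Quaternion.re_neg] at h2
  linarith

/-- The formula for double commutators of imaginary Cayley numbers. -/
theorem cayleyMul_commutator {a b : ℍ[ℝ] × ℍ[ℝ]} (ha : a ∈ imCayley) (hb : b ∈ imCayley) :
    cayleyMul a (cayleyMul a b - cayleyMul b a) - cayleyMul (cayleyMul a b - cayleyMul b a) a =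
      (4 * cayleyDot a b) • a - (4 * cayleyDot a a) • b := by
  have ha0 := re_eq_zero_of_mem_imCayley ha
  have hb0 := re_eq_zero_of_mem_imCayley hb
  -- Everything is expanded in real coordinates. Naming the commutator `z` and recording its eight
  -- coordinates first keeps the final polynomial identities small.
  have hab : cayleyDot a b = a.1.imI * b.1.imI + a.1.imJ * b.1.imJ + a.1.imK * b.1.imK +
      (a.2.re * b.2.re + a.2.imI * b.2.imI + a.2.imJ * b.2.imJ + a.2.imK * b.2.imK) := by
    simp [cayleyMul, cayleyDot, cayleyConj, ha0, hb0]; ring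
  have haa : cayleyDot a a = a.1.imI * a.1.imI + a.1.imJ * a.1.imJ + a.1.imK * a.1.imK +
      (a.2.re * a.2.re + a.2.imI * a.2.imI + a.2.imJ * a.2.imJ + a.2.imK * a.2.imK) := by
    simp [cayleyMul, cayleyDot, cayleyConj, ha0]
  generalize hz : cayleyMul a b - cayleyMul b a = z
  have h0 : z.1.re = 0 := by
    rw [← hz]; simp [cayleyMul, ha0, hb0]; ring
  have h1 : z.1.imI = 2 * (a.1.imJ * b.1.imK + a.2.re * b.2.imI + a.2.imK * b.2.imJ -
      a.1.imK * b.1.imJ - a.2.imI * b.2.re - a.2.imJ * b.2.imK) := by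
    rw [← hz]; simp [cayleyMul, ha0, hb0]; ring
  have h2 : z.1.imJ = 2 * (a.1.imK * b.1.imI + a.2.re * b.2.imJ + a.2.imI * b.2.imK -
      a.1.imI * b.1.imK - a.2.imJ * b.2.re - a.2.imK * b.2.imI) := by
    rw [← hz]; simp [cayleyMul, ha0, hb0]; ring
  have h3 : z.1.imK = 2 * (a.1.imI * b.1.imJ + a.2.re * b.2.imK + a.2.imJ * b.2.imI -
      a.1.imJ * b.1.imI - a.2.imK * b.2.re - a.2.imI * b.2.imJ) := by
    rw [← hz]; simp [cayleyMul, ha0, hb0]; ring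
  have h4 : z.2.re = 2 * (a.2.imI * b.1.imI + a.2.imJ * b.1.imJ + a.2.imK * b.1.imK -
      a.1.imI * b.2.imI - a.1.imJ * b.2.imJ - a.1.imK * b.2.imK) := by
    rw [← hz]; simp [cayleyMul, ha0, hb0]; ring
  have h5 : z.2.imI = 2 * (a.1.imI * b.2.re + a.1.imK * b.2.imJ + a.2.imK * b.1.imJ -
      a.1.imJ * b.2.imK - a.2.re * b.1.imI - a.2.imJ * b.1.imK) := by
    rw [← hz]; simp [cayleyMul, ha0, hb0]; ring
  have h6 : z.2.imJ = 2 * (a.1.imJ * b.2.re + a.1.imI * b.2.imK + a.2.imI * b.1.imK -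
      a.1.imK * b.2.imI - a.2.re * b.1.imJ - a.2.imK * b.1.imI) := by
    rw [← hz]; simp [cayleyMul, ha0, hb0]; ring
  have h7 : z.2.imK = 2 * (a.1.imK * b.2.re + a.1.imJ * b.2.imI + a.2.imJ * b.1.imI -
      a.1.imI * b.2.imJ - a.2.re * b.1.imK - a.2.imI * b.1.imJ) := by
    rw [← hz]; simp [cayleyMul, ha0, hb0]; ring
  refine Prod.ext (Quaternion.ext _ _ ?_ ?_ ?_ ?_) (Quaternion.ext _ _ ?_ ?_ ?_ ?_) <;>
    simp [cayleyMul, ha0, hb0, hab, haa, h0, h1, h2, h3, h4, h5, h6, h7] <;> ring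

theorem cayleyMul_commutator_mem {a b : ℍ[ℝ] × ℍ[ℝ]} (ha : a ∈ imCayley) (hb : b ∈ imCayley) :
    cayleyMul a b - cayleyMul b a ∈ imCayley := by
  have ha0 := re_eq_zero_of_mem_imCayley ha
  have hb0 := re_eq_zero_of_mem_imCayley hb
  change cayleyConj _ = - _
  refine Prod.ext (Quaternion.ext _ _ ?_ ?_ ?_ ?_) rfl <;> simp [cayleyMul, cayleyConj, ha0, hb0]

theorem cayleyDot_self (a : ℍ[ℝ] × ℍ[ℝ]) :
    cayleyDot a a = Quaternion.normSq a.1 + Quaternion.normSq a.2 := by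
  simp [cayleyDot, cayleyMul, cayleyConj, Quaternion.normSq_def']
  ring

theorem cayleyDot_self_eq_zero {a : ℍ[ℝ] × ℍ[ℝ]} : cayleyDot a a = 0 ↔ a = 0 := by
  rw [cayleyDot_self, add_eq_zero_iff_of_nonneg Quaternion.normSq_nonneg
    Quaternion.normSq_nonneg, Quaternion.normSq_eq_zero, Quaternion.normSq_eq_zero, Prod.ext_iff]
  rfl

/-- The radical of the 2-form obtained by contracting the Cayley form with a nonzero vector. -/
theorem exists_smul_of_cayleyForm_eq_zero {a b : imCayley} (ha : a ≠ 0)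
    (h : ∀ c : imCayley, cayleyForm a b c = 0) : ∃ r : ℝ, b = r • a := by
  -- Testing with `c = [a, b]` and using positivity of the dot product gives `[a, b] = 0`; the
  -- double commutator formula then makes `b` a multiple of `a`.
  have h1 := h ⟨_, cayleyMul_commutator_mem a.2 b.2⟩
  have h2 : cayleyMul a.1 b.1 - cayleyMul b.1 a.1 = 0 := cayleyDot_self_eq_zero.1 h1
  have h3 := cayleyMul_commutator a.2 b.2
  rw [h2] at h3
  have h4 : cayleyDot a.1 a.1 ≠ 0 := fun h0 => ha (Subtype.ext (cayleyDot_self_eq_zero.1 h0))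
  have h5 : (4 * cayleyDot a.1 b.1) • a.1 - (4 * cayleyDot a.1 a.1) • b.1 = 0 := by
    rw [← h3]
    simp [cayleyMul]
  refine ⟨cayleyDot a.1 b.1 / cayleyDot a.1 a.1, Subtype.ext ?_⟩
  have h6 : (4 * cayleyDot a.1 a.1) • b.1 = (4 * cayleyDot a.1 b.1) • a.1 := (sub_eq_zero.1 h5).symm
  have h7 : (4 * cayleyDot a.1 a.1) ≠ 0 := mul_ne_zero (by norm_num) h4
  refine (inv_smul_smul₀ h7 b.1).symm.trans ?_
  rw [h6, smul_smul]
  change _ = (cayleyDot a.1 b.1 / cayleyDot a.1 a.1) • a.1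
  congr 1
  field_simp

/-- An isotropic subspace of more than half of the dimension, containing the radical, is its own
orthogonal. -/
theorem mem_of_forall_eq_zero {V : Type*} [AddCommGroup V] [Module ℝ V] [FiniteDimensional ℝ V]
    (B : V →ₗ[ℝ] V →ₗ[ℝ] ℝ) {v : V} (hB : ∀ x, (∀ y, B y x = 0) → x ∈ Submodule.span ℝ {v})
    {W : Submodule ℝ V} (hW : ∀ x ∈ W, ∀ y ∈ W, B x y = 0)
    (hdim : Module.finrank ℝ V + 1 ≤ 2 * Module.finrank ℝ W) {x : V} (hx : ∀ w ∈ W, B x w = 0) :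
    x ∈ W := by
  -- The orthogonal of `W` is the coannihilator of the range of `β`, and it contains `W`. The kernel
  -- of `β` has dimension at most 1, so the orthogonal has dimension at most `dim V - dim W + 1 ≤
  -- dim W`.
  set β : W →ₗ[ℝ] Module.Dual ℝ V := B.flip.domRestrict W with hβ
  have h1 : Module.finrank ℝ (LinearMap.ker β) ≤ 1 := by
    have h2 : (LinearMap.ker β).map W.subtype ≤ Submodule.span ℝ {v} := by
      rintro _ ⟨w, hw, rfl⟩
      exact hB _ fun y => congrArg (fun φ : Module.Dual ℝ V => φ y) hw
    have h3 := Submodule.finrank_mono h2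
    rw [Submodule.finrank_map_subtype_eq] at h3
    exact h3.trans ((finrank_span_le_card {v}).trans (by simp))
  have h2 := LinearMap.finrank_range_add_finrank_ker β
  have h3 := Subspace.finrank_add_finrank_dualCoannihilator_eq (LinearMap.range β)
  have h4 : W ≤ (LinearMap.range β).dualCoannihilator := by
    intro w hw
    rw [Submodule.mem_dualCoannihilator]
    rintro _ ⟨w', rfl⟩
    exact hW w hw w' w'.2
  have h5 : W = (LinearMap.range β).dualCoannihilator :=
    Submodule.eq_of_le_of_finrank_le h4 (by omega)
  rw [h5, Submodule.mem_dualCoannihilator]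
  rintro _ ⟨w', rfl⟩
  exact hx w' w'.2

/-- The contraction of a 3-form with a vector. -/
def contraction {V : Type*} [AddCommGroup V] [Module ℝ V] [TopologicalSpace V]
    (l : V [⋀^Fin 3]→L[ℝ] ℝ) (v : V) : V →ₗ[ℝ] V →ₗ[ℝ] ℝ :=
  LinearMap.mk₂ ℝ (fun x y => l ![v, x, y])
    (fun x x' y => by
      have h := l.map_update_add ![v, x, y] 1 x x'
      have u : ∀ w, Function.update ![v, x, y] 1 w = ![v, w, y] := by
        intro w; ext i; fin_cases i <;> rfl
      simpa only [u] using h)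
    (fun r x y => by
      have h := l.map_update_smul ![v, x, y] 1 r x
      have u : ∀ w, Function.update ![v, x, y] 1 w = ![v, w, y] := by
        intro w; ext i; fin_cases i <;> rfl
      simpa only [u] using h)
    (fun x y y' => by
      have h := l.map_update_add ![v, x, y] 2 y y'
      have u : ∀ w, Function.update ![v, x, y] 2 w = ![v, x, w] := by
        intro w; ext i; fin_cases i <;> rfl
      simpa only [u] using h)
    (fun r x y => by
      have h := l.map_update_smul ![v, x, y] 2 r y
      have u : ∀ w, Function.update ![v, x, y] 2 w = ![v, x, w] := by
        intro w; ext i; fin_cases i <;> rfl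
      simpa only [u] using h)

/-- An isotropic subspace of more than half of the dimension, for a form of Cayley type, is its own
orthogonal with respect to the contraction by any of its nonzero vectors. -/
theorem mem_of_forall_form_eq_zero {V : Type*} [AddCommGroup V] [Module ℝ V] [TopologicalSpace V]
    [FiniteDimensional ℝ V] {l : V [⋀^Fin 3]→L[ℝ] ℝ}
    (hl : ∃ e : V ≃ₗ[ℝ] imCayley, ∀ a b c : V, l ![a, b, c] = cayleyForm (e a) (e b) (e c))
    {v : V} (hv : v ≠ 0) {W : Submodule ℝ V} (hvW : v ∈ W)
    (hW : ∀ x ∈ W, ∀ y ∈ W, ∀ z ∈ W, l ![x, y, z] = 0)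
    (hdim : Module.finrank ℝ V + 1 ≤ 2 * Module.finrank ℝ W) {x : V}
    (hx : ∀ w ∈ W, l ![v, x, w] = 0) : x ∈ W := by
  obtain ⟨e, he⟩ := hl
  refine mem_of_forall_eq_zero (contraction l v) (v := v) (fun x hx => ?_)
    (fun x hx y hy => hW v hvW x hx y hy) hdim hx
  have h1 : ∀ c : imCayley, cayleyForm (e v) (e x) c = 0 := by
    intro c
    obtain ⟨y, rfl⟩ := e.surjective c
    rw [← he]
    have h2 : l ![v, y, x] = 0 := hx y
    have h3 := l.map_swap ![v, y, x] (i := 1) (j := 2) (by decide)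
    have h4 : ![v, y, x] ∘ Equiv.swap (1 : Fin 3) 2 = ![v, x, y] := by
      ext i; fin_cases i <;> rfl
    rw [h4] at h3
    exact h3.trans (neg_eq_zero.2 h2)
  obtain ⟨r, hr⟩ := exists_smul_of_cayleyForm_eq_zero (e.map_ne_zero_iff.2 hv) h1
  rw [← map_smul] at hr
  rw [Submodule.mem_span_singleton]
  exact ⟨r, (e.injective hr).symm⟩

end Cayley

/-! ### Lagrangian subspaces of normal sections -/

section Lagrangian

section Continuity

variable {E : Type*} [NormedAddCommGroup E] [NormedSpace ℝ E]
  {M : Type*} [TopologicalSpace M] [ChartedSpace E M]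

theorem mfderiv_extChartAt_symm_apply [IsManifold 𝓘(ℝ, E) ∞ M] {x p : M}
    (hp : p ∈ (extChartAt 𝓘(ℝ, E) x).source) (v : E) :
    (mfderiv 𝓘(ℝ, E) 𝓘(ℝ, E) (extChartAt 𝓘(ℝ, E) x).symm (extChartAt 𝓘(ℝ, E) x p)
      (mfderiv 𝓘(ℝ, E) 𝓘(ℝ, E) (extChartAt 𝓘(ℝ, E) x) p v) : E) = v := by
  have h1 : MDifferentiableAt 𝓘(ℝ, E) 𝓘(ℝ, E) (extChartAt 𝓘(ℝ, E) x) p :=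
    (contMDiffAt_extChartAt' (n := ∞) (by simpa using hp)).mdifferentiableAt (by simp)
  have h2 : MDifferentiableAt 𝓘(ℝ, E) 𝓘(ℝ, E) (extChartAt 𝓘(ℝ, E) x).symm
      (extChartAt 𝓘(ℝ, E) x p) :=
    ((contMDiffOn_extChartAt_symm (n := ∞) x).contMDiffAt ((isOpen_extChartAt_target x).mem_nhds
      ((extChartAt 𝓘(ℝ, E) x).map_source hp))).mdifferentiableAt (by simp)
  have h3 := mfderiv_comp p h2 h1
  have h4 : (extChartAt 𝓘(ℝ, E) x).symm ∘ extChartAt 𝓘(ℝ, E) x =ᶠ[𝓝 p] id := by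
    filter_upwards [(isOpen_extChartAt_source x).mem_nhds hp] with q hq
    exact (extChartAt 𝓘(ℝ, E) x).left_inv hq
  have h5 : mfderiv 𝓘(ℝ, E) 𝓘(ℝ, E) ((extChartAt 𝓘(ℝ, E) x).symm ∘ extChartAt 𝓘(ℝ, E) x) p =
      mfderiv 𝓘(ℝ, E) 𝓘(ℝ, E) id p := Filter.EventuallyEq.mfderiv_eq h4
  rw [mfderiv_id] at h5
  have h6 := h3.symm.trans h5
  exact congrArg (fun L => (L v : E)) h6

/-- The values of a smooth form on smooth vector fields along a curve depend continuously on the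
parameter. -/
theorem continuous_form_along [IsManifold 𝓘(ℝ, E) ∞ M]
    {lam : ∀ p : M, (TangentSpace 𝓘(ℝ, E) p) [⋀^Fin 3]→L[ℝ] ℝ}
    (hlam : ∀ x : M, ContDiffOn ℝ ∞ (formInChart 𝓘(ℝ, E) lam x) (extChartAt 𝓘(ℝ, E) x).target)
    {b : ℝ → M} {X : Fin 3 → ∀ t, TangentSpace 𝓘(ℝ, E) (b t)}
    (hX : ∀ i, ContMDiff 𝓘(ℝ, ℝ) 𝓘(ℝ, E).tangent ∞
      (fun t => (⟨b t, X i t⟩ : TangentBundle 𝓘(ℝ, E) M))) :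
    Continuous fun t => lam (b t) fun i => X i t := by
  refine continuous_iff_continuousAt.2 fun t₀ => ?_
  set φ := extChartAt 𝓘(ℝ, E) (b t₀) with hφ
  have hb : ContinuousAt b t₀ :=
    ((FiberBundle.continuous_proj E (TangentSpace 𝓘(ℝ, E) : M → Type _)).continuousAt.comp
      (hX 0 t₀).continuousAt :)
  have hsrc : ∀ᶠ p in 𝓝 (b t₀), p ∈ φ.source :=
    (isOpen_extChartAt_source (b t₀)).mem_nhds (mem_extChartAt_source (b t₀))
  have hG : ∀ᶠ p in 𝓝 (b t₀), ContMDiffAt 𝓘(ℝ, E) 𝓘(ℝ, E) ∞ φ p :=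
    hsrc.mono fun p hp => contMDiffAt_extChartAt' (by simpa [hφ] using hp)
  have h1 : ∀ i, ContinuousAt (fun t => (mfderiv 𝓘(ℝ, E) 𝓘(ℝ, E) φ (b t) (X i t) : E)) t₀ :=
    fun i => ((hX i t₀).mfderiv_along hG).continuousAt
  have h2 : ContinuousAt (fun t => formInChart 𝓘(ℝ, E) lam (b t₀) (φ (b t))) t₀ := by
    have h3 : ContinuousAt (formInChart 𝓘(ℝ, E) lam (b t₀)) (φ (b t₀)) :=
      (hlam (b t₀)).continuousOn.continuousAt
        ((isOpen_extChartAt_target (b t₀)).mem_nhds (mem_extChartAt_target (b t₀)))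
    exact ContinuousAt.comp (g := formInChart 𝓘(ℝ, E) lam (b t₀)) (f := fun t => φ (b t)) h3
      (ContinuousAt.comp (g := φ) (continuousAt_extChartAt (b t₀)) hb)
  have h3 : ContinuousAt (fun t => formInChart 𝓘(ℝ, E) lam (b t₀) (φ (b t)) fun i =>
      (mfderiv 𝓘(ℝ, E) 𝓘(ℝ, E) φ (b t) (X i t) : E)) t₀ :=
    h2.eval (continuousAt_pi.2 h1)
  refine h3.congr ?_
  filter_upwards [hb.eventually hsrc] with t ht
  let l : M → E [⋀^Fin 3]→L[ℝ] ℝ := lam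
  have h4 : ∀ p q (v w : Fin 3 → E), p = q → v = w → l p v = l q w := by
    rintro p _ v _ rfl rfl; rfl
  exact h4 _ _ _ _ (φ.left_inv ht) (funext fun i => mfderiv_extChartAt_symm_apply ht (X i t))

end Continuity

section Bump

variable {F : Type*} [NormedAddCommGroup F] [NormedSpace ℝ F]

/-- The section that equals `g • w` on `[0, 1]`, where `g` is supported in the open interval. -/
def twistedBump (A : F ≃L[ℝ] F) {g : ℝ → ℝ} (hg : ContDiff ℝ ∞ g) (hs : tsupport g ⊆ Ioo 0 1)
    (w : F) : twistedSections A :=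
  ⟨fun t => (A ^ (-⌊t⌋)) (g (Int.fract t) • w), by
    refine ⟨contDiff_iff_contDiffAt.2 fun t => ?_, fun t => ?_⟩
    · set n := ⌊t⌋ with hn
      have hlt : t < n + 1 := Int.lt_floor_add_one t
      -- At an integer the floor jumps, but `g` vanishes near both `0` and `1`, so the section
      -- vanishes on both sides.
      rcases eq_or_lt_of_le (Int.floor_le t) with hnt | hnt
      · have h0 : ∀ᶠ s in 𝓝 (0 : ℝ), g s = 0 :=
          notMem_tsupport_iff_eventuallyEq.1 fun h => lt_irrefl _ (hs h).1
        have h1 : ∀ᶠ s in 𝓝 (1 : ℝ), g s = 0 :=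
          notMem_tsupport_iff_eventuallyEq.1 fun h => lt_irrefl _ (hs h).2
        have c0 : Tendsto (fun s : ℝ => s - n) (𝓝 t) (𝓝 0) := by
          have : Continuous fun s : ℝ => s - n := by fun_prop
          have h2 := this.tendsto t
          rwa [show t - (n : ℝ) = 0 by linarith] at h2
        have c1 : Tendsto (fun s : ℝ => s - n + 1) (𝓝 t) (𝓝 1) := by
          simpa using c0.add_const 1
        refine (contDiffAt_const (c := (0 : F))).congr_of_eventuallyEq ?_
        filter_upwards [c0.eventually h0, c1.eventually h1,
          Ioo_mem_nhds (show (n : ℝ) - 1 < t by linarith) hlt] with s e0 e1 hs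
        rcases lt_or_ge s n with hsn | hsn
        · have hf : ⌊s⌋ = n - 1 := by
            rw [Int.floor_eq_iff]; push_cast; exact ⟨hs.1.le, by linarith⟩
          have : Int.fract s = s - n + 1 := by rw [Int.fract, hf]; push_cast; ring
          rw [this, e1, zero_smul, map_zero]
        · have hf : ⌊s⌋ = n := by
            rw [Int.floor_eq_iff]; exact ⟨hsn, hs.2⟩
          have : Int.fract s = s - n := by rw [Int.fract, hf]
          rw [this, e0, zero_smul, map_zero]
      · have h1 : ContDiff ℝ ∞ fun s : ℝ => (A ^ (-n)) (g (s - n) • w) :=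
          (A ^ (-n)).contDiff.comp ((hg.comp (contDiff_id.sub contDiff_const)).smul contDiff_const)
        refine h1.contDiffAt.congr_of_eventuallyEq ?_
        filter_upwards [Ioo_mem_nhds hnt hlt] with s hs
        have hf : ⌊s⌋ = n := by
          rw [Int.floor_eq_iff]; exact ⟨hs.1.le, hs.2⟩
        rw [Int.fract, hf]
    · have h1 : A ^ (-⌊t⌋) = A * A ^ (-(⌊t⌋ + 1)) := by
        rw [← zpow_one_add]; congr 1; ring
      change A ((A ^ (-⌊t + 1⌋)) (g (Int.fract (t + 1)) • w)) = (A ^ (-⌊t⌋)) (g (Int.fract t) • w)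
      rw [Int.fract_add_one, Int.floor_add_one, h1]
      rfl⟩

theorem twistedBump_apply (A : F ≃L[ℝ] F) {g : ℝ → ℝ} (hg : ContDiff ℝ ∞ g)
    (hs : tsupport g ⊆ Ioo 0 1) (w : F) {t : ℝ} (ht : t ∈ Ico (0 : ℝ) 1) :
    (twistedBump A hg hs w).1 t = g t • w := by
  have h1 : ⌊t⌋ = 0 := Int.floor_eq_zero_iff.2 ht
  change (A ^ (-⌊t⌋)) (g (Int.fract t) • w) = _
  rw [Int.fract, h1, Int.cast_zero, sub_zero, neg_zero, zpow_zero]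
  rfl

end Bump

/-! ### Horizontal sections are Lagrangian -/

section Horizontal

variable {F₁ : Type*} [NormedAddCommGroup F₁] [NormedSpace ℝ F₁]
  {F₂ : Type*} [NormedAddCommGroup F₂] [NormedSpace ℝ F₂]
  {E : Type*} [NormedAddCommGroup E] [NormedSpace ℝ E]
  {M : Type*} [TopologicalSpace M] [ChartedSpace E M] {Φ : ℝ × F₁ × F₂ → M}
  {A₁ : F₁ ≃L[ℝ] F₁} {A₂ : F₂ ≃L[ℝ] F₂}

/-- The sections with vanishing second component. -/
def horizontalSections (A : (F₁ × F₂) ≃L[ℝ] (F₁ × F₂)) : Submodule ℝ (twistedSections A) where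
  carrier := {x | ∀ t, (x.1 t).2 = 0}
  add_mem' {x y} hx hy t := by
    change (x.1 t).2 + (y.1 t).2 = 0
    rw [hx t, hy t, add_zero]
  zero_mem' _ := rfl
  smul_mem' r x hx t := by
    change r • (x.1 t).2 = 0
    rw [hx t, smul_zero]

/-- The section with given first component and vanishing second component. -/
def inclSections (A₁ : F₁ ≃L[ℝ] F₁) (A₂ : F₂ ≃L[ℝ] F₂) :
    twistedSections A₁ →ₗ[ℝ] twistedSections (A₁.prodCongr A₂) where
  toFun x := ⟨fun t => (x.1 t, 0), x.2.1.prodMk contDiff_const, fun t =>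
    Prod.ext (x.2.2 t) (map_zero A₂)⟩
  map_add' _ _ := Subtype.ext <| funext fun _ => Prod.ext rfl (add_zero (0 : F₂)).symm
  map_smul' r _ := Subtype.ext <| funext fun _ => Prod.ext rfl (smul_zero r).symm

/-- The first component of a section. -/
def fstSections (A₁ : F₁ ≃L[ℝ] F₁) (A₂ : F₂ ≃L[ℝ] F₂) :
    twistedSections (A₁.prodCongr A₂) →ₗ[ℝ] twistedSections A₁ where
  toFun x := ⟨fun t => (x.1 t).1, contDiff_fst.comp x.2.1, fun t => congrArg Prod.fst (x.2.2 t)⟩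
  map_add' _ _ := rfl
  map_smul' _ _ := rfl

theorem inclSections_mem (x : twistedSections A₁) :
    inclSections A₁ A₂ x ∈ horizontalSections (A₁.prodCongr A₂) := fun _ => rfl

theorem inclSections_fstSections {x : twistedSections (A₁.prodCongr A₂)}
    (hx : x ∈ horizontalSections (A₁.prodCongr A₂)) :
    inclSections A₁ A₂ (fstSections A₁ A₂ x) = x :=
  Subtype.ext <| funext fun t => Prod.ext rfl (hx t).symm

/-- A section is horizontal if its second component vanishes on `[0, 1]`. -/
theorem mem_horizontalSections_of_Icc {x : twistedSections (A₁.prodCongr A₂)}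
    (hx : ∀ t ∈ Icc (0 : ℝ) 1, (x.1 t).2 = 0) : x ∈ horizontalSections (A₁.prodCongr A₂) := by
  have hper : Function.Periodic (fun t => (x.1 t).2 = 0) 1 := by
    intro t
    have h1 : A₂ (x.1 (t + 1)).2 = (x.1 t).2 := congrArg Prod.snd (x.2.2 t)
    change ((x.1 (t + 1)).2 = 0) = ((x.1 t).2 = 0)
    rw [← h1, EmbeddingLike.map_eq_zero_iff]
  intro t
  obtain ⟨s, hs, hst⟩ := hper.exists_mem_Ico₀ one_pos t
  exact hst.mpr (hx s ⟨hs.1, hs.2.le⟩)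

/-- The monodromy is block diagonal, so discarding the `F₂`-component is a well defined projection.
-/
theorem isSplit_comap_normalEquiv [IsManifold 𝓘(ℝ, E) ∞ M] {γ : Loop 𝓘(ℝ, E) M}
    (hΦ : ∀ t x, Φ (t + 1, x) = Φ (t, A₁.prodCongr A₂ x))
    (h₀ : ∀ t, IsLocalDiffeomorphAt 𝓘(ℝ, ℝ × F₁ × F₂) 𝓘(ℝ, E) ∞ Φ (t, 0))
    (hγ : ∀ t, γ.toFun t = Φ (t, 0)) :
    IsSplit ((horizontalSections (A₁.prodCongr A₂)).comap
      (normalEquiv hΦ h₀ hγ : γ.NormalSections →ₗ[ℝ] twistedSections (A₁.prodCongr A₂))) := by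
  set Θ := normalEquiv hΦ h₀ hγ with hΘ
  refine ⟨(Θ.symm : _ →ₗ[ℝ] _) ∘ₗ inclSections A₁ A₂ ∘ₗ fstSections A₁ A₂ ∘ₗ (Θ : _ →ₗ[ℝ] _),
    ⟨fun x => ?_, fun x hx => ?_⟩, fun c hc => ?_⟩
  · change Θ (Θ.symm (inclSections A₁ A₂ (fstSections A₁ A₂ (Θ x)))) ∈
      horizontalSections (A₁.prodCongr A₂)
    rw [LinearEquiv.apply_symm_apply]
    exact inclSections_mem _
  · change Θ.symm (inclSections A₁ A₂ (fstSections A₁ A₂ (Θ x))) = x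
    have h1 : inclSections A₁ A₂ (fstSections A₁ A₂ (Θ x)) = Θ x := inclSections_fstSections hx
    rw [h1, LinearEquiv.symm_apply_apply]
  · rw [← isSmoothCurve_normalEquiv_comp_iff hΦ h₀ hγ] at hc ⊢
    have hc' : ContDiff ℝ ∞ fun q : ℝ × ℝ => (Θ (c q.1)).1 q.2 := hc
    have h1 : ContDiff ℝ ∞ fun q : ℝ × ℝ => (((Θ (c q.1)).1 q.2).1, (0 : F₂)) :=
      (contDiff_fst.comp hc').prodMk contDiff_const
    change ContDiff ℝ ∞ fun q : ℝ × ℝ =>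
      (Θ (Θ.symm (inclSections A₁ A₂ (fstSections A₁ A₂ (Θ (c q.1)))))).1 q.2
    simp only [LinearEquiv.apply_symm_apply]
    exact h1

theorem transgression_mkQ [IsManifold 𝓘(ℝ, E) ∞ M] {γ : Loop 𝓘(ℝ, E) M}
    (lam : ∀ p : M, (TangentSpace 𝓘(ℝ, E) p) [⋀^Fin 3]→L[ℝ] ℝ) (X Y : γ.fields) :
    transgression lam γ (γ.tangentialFields.mkQ X) (γ.tangentialFields.mkQ Y) =
      ∫ t in (0 : ℝ)..1, lam (γ.toFun t) ![γ.velocity t, X.1 t, Y.1 t] := rfl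

/-- Isotropy holds already under the integral sign. Conversely, a section orthogonal to all
horizontal bumps is pointwise orthogonal to the horizontal vectors, by the fundamental lemma of the
calculus of variations, and is therefore horizontal by the linear algebra of forms of Cayley type.
-/
theorem isLagrangianSubspace_comap_normalEquiv [IsManifold 𝓘(ℝ, E) ∞ M]
    [FiniteDimensional ℝ F₁] [FiniteDimensional ℝ F₂] {γ : Loop 𝓘(ℝ, E) M}
    {lam : ∀ p : M, (TangentSpace 𝓘(ℝ, E) p) [⋀^Fin 3]→L[ℝ] ℝ} (hlam : IsG2Form 𝓘(ℝ, E) lam)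
    (hΦ : ∀ t x, Φ (t + 1, x) = Φ (t, A₁.prodCongr A₂ x))
    (h₀ : ∀ t, IsLocalDiffeomorphAt 𝓘(ℝ, ℝ × F₁ × F₂) 𝓘(ℝ, E) ∞ Φ (t, 0))
    (hγ : ∀ t, γ.toFun t = Φ (t, 0)) (hdim : Module.finrank ℝ F₂ ≤ Module.finrank ℝ F₁)
    (hiso : ∀ t (a b c : ℝ × F₁), lam (γ.toFun t) ![diffAt E Φ (t, 0) (inclFst F₁ F₂ a),
      diffAt E Φ (t, 0) (inclFst F₁ F₂ b), diffAt E Φ (t, 0) (inclFst F₁ F₂ c)] = 0) :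
    IsLagrangianSubspace lam γ ((horizontalSections (A₁.prodCongr A₂)).comap
      (normalEquiv hΦ h₀ hγ : γ.NormalSections →ₗ[ℝ] twistedSections (A₁.prodCongr A₂))) := by
  set Θ := normalEquiv hΦ h₀ hγ with hΘ
  let l : ℝ → E [⋀^Fin 3]→L[ℝ] ℝ := fun t => lam (γ.toFun t)
  have hv : ∀ t, (γ.velocity t : E) = diffAt E Φ (t, 0) (inclFst F₁ F₂ (1, 0)) :=
    velocity_eq_diffAt h₀ hγ
  have hω : ∀ x y : γ.NormalSections, transgression lam γ x y = ∫ t in (0 : ℝ)..1,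
      l t ![diffAt E Φ (t, 0) (inclFst F₁ F₂ (1, 0)), diffAt E Φ (t, 0) (0, (Θ x).1 t),
        diffAt E Φ (t, 0) (0, (Θ y).1 t)] := by
    intro x y
    rw [← Θ.symm_apply_apply x, ← Θ.symm_apply_apply y, hΘ, normalEquiv_symm_apply,
      normalEquiv_symm_apply, transgression_mkQ]
    simp only [← normalEquiv_symm_apply, LinearEquiv.apply_symm_apply]
    refine intervalIntegral.integral_congr fun t _ => ?_
    exact congrArg (fun v : E => l t ![v, diffAt E Φ (t, 0) (0, (normalEquiv hΦ h₀ hγ x).1 t),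
      diffAt E Φ (t, 0) (0, (normalEquiv hΦ h₀ hγ y).1 t)]) (hv t)
  intro n
  constructor
  · intro hn m hm
    rw [hω]
    refine (intervalIntegral.integral_congr fun t _ => ?_).trans intervalIntegral.integral_zero
    have h1 : ((0 : ℝ), (Θ n).1 t) = inclFst F₁ F₂ (0, ((Θ n).1 t).1) :=
      Prod.ext rfl (Prod.ext rfl (hn t))
    have h2 : ((0 : ℝ), (Θ m).1 t) = inclFst F₁ F₂ (0, ((Θ m).1 t).1) :=
      Prod.ext rfl (Prod.ext rfl (hm t))
    simp only [h1, h2]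
    exact hiso t _ _ _
  · intro h
    set x := Θ n with hx
    have hfield : ∀ v : ℝ → ℝ × F₁ × F₂, ContDiff ℝ ∞ v → ContMDiff 𝓘(ℝ, ℝ) 𝓘(ℝ, E).tangent ∞
        (fun t => (⟨γ.toFun t, diffAt E Φ (t, 0) (v t)⟩ : TangentBundle 𝓘(ℝ, E) M)) := by
      intro v hv t
      refine (contMDiffAt_diffAt (a := fun t : ℝ => (t, (0 : F₁ × F₂))) (v := v)
        (h₀ t) (by fun_prop) hv.contDiffAt).congr_of_eventuallyEq ?_
      exact Eventually.of_forall fun s => tangentBundle_mk_congr (hγ s) _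
    have hcont : ∀ w : F₁, Continuous fun t => l t ![diffAt E Φ (t, 0) (inclFst F₁ F₂ (1, 0)),
        diffAt E Φ (t, 0) (0, x.1 t), diffAt E Φ (t, 0) (inclFst F₁ F₂ (0, w))] := by
      intro w
      have h1 := continuous_form_along hlam.smooth (b := γ.toFun)
        (X := ![fun t => diffAt E Φ (t, 0) (inclFst F₁ F₂ (1, 0)),
          fun t => diffAt E Φ (t, 0) (0, x.1 t),
          fun t => diffAt E Φ (t, 0) (inclFst F₁ F₂ (0, w))]) (by
        intro i
        fin_cases i
        · exact hfield (fun _ => inclFst F₁ F₂ (1, 0)) contDiff_const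
        · exact hfield (fun t => (0, x.1 t)) (contDiff_const.prodMk x.2.1)
        · exact hfield (fun _ => inclFst F₁ F₂ (0, w)) contDiff_const)
      refine h1.congr fun t => ?_
      refine congrArg (l t) (funext fun i => ?_)
      fin_cases i <;> rfl
    have hzero : ∀ w : F₁, ∀ t ∈ Ioo (0 : ℝ) 1,
        l t ![diffAt E Φ (t, 0) (inclFst F₁ F₂ (1, 0)), diffAt E Φ (t, 0) (0, x.1 t),
          diffAt E Φ (t, 0) (inclFst F₁ F₂ (0, w))] = 0 := by
      intro w
      have h1 := isOpen_Ioo.ae_eq_zero_of_integral_contDiff_smul_eq_zero (U := Ioo (0 : ℝ) 1)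
        (μ := MeasureTheory.volume) ((hcont w).locallyIntegrable.locallyIntegrableOn _) (by
        intro g hg _ hsupp
        have h2 := h (Θ.symm (inclSections A₁ A₂ (twistedBump A₁ hg hsupp w))) (by
          change Θ (Θ.symm _) ∈ horizontalSections (A₁.prodCongr A₂)
          rw [LinearEquiv.apply_symm_apply]
          exact inclSections_mem _)
        rw [hω, LinearEquiv.apply_symm_apply, intervalIntegral.integral_of_le zero_le_one,
          MeasureTheory.integral_Ioc_eq_integral_Ioo] at h2
        refine Eq.trans ?_ h2
        rw [← MeasureTheory.setIntegral_eq_integral_of_forall_compl_eq_zero (s := Ioo (0 : ℝ) 1)]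
        · refine MeasureTheory.setIntegral_congr_fun measurableSet_Ioo fun t ht => ?_
          have h3 : ((0 : ℝ), (inclSections A₁ A₂ (twistedBump A₁ hg hsupp w)).1 t) =
              g t • inclFst F₁ F₂ (0, w) := by
            change ((0 : ℝ), ((twistedBump A₁ hg hsupp w).1 t, (0 : F₂))) = _
            rw [twistedBump_apply A₁ hg hsupp w ⟨ht.1.le, ht.2⟩]
            simp [inclFst_apply]
          simp only [h3, map_smul]
          exact ((contraction (l t) (diffAt E Φ (t, 0) (inclFst F₁ F₂ (1, 0)))
            (diffAt E Φ (t, 0) (0, x.1 t))).map_smul (g t)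
            (diffAt E Φ (t, 0) (inclFst F₁ F₂ (0, w)))).symm
        · intro t ht
          rw [image_eq_zero_of_notMem_tsupport fun h => ht (hsupp h), zero_smul])
      have h2 := MeasureTheory.Measure.eqOn_open_of_ae_eq (μ := MeasureTheory.volume)
        (g := fun _ => (0 : ℝ))
        ((MeasureTheory.ae_restrict_iff' measurableSet_Ioo).2 h1) isOpen_Ioo
        (hcont w).continuousOn continuousOn_const
      exact h2
    have hIoo : ∀ t ∈ Ioo (0 : ℝ) 1, (x.1 t).2 = 0 := by
      intro t ht
      -- `W` is the tangent space of the immersed submanifold. The dimension bound `dim V + 1 ≤ 2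
      -- dim W` reads `2 + dim F₁ + dim F₂ ≤ 2 + 2 dim F₁`, which is `hdim`.
      set e := diffEquiv (h₀ t) with he
      have : FiniteDimensional ℝ E := e.toLinearEquiv.finiteDimensional
      set W : Submodule ℝ E := LinearMap.range
        ((e : (ℝ × F₁ × F₂) →ₗ[ℝ] E) ∘ₗ (inclFst F₁ F₂ : (ℝ × F₁) →ₗ[ℝ] (ℝ × F₁ × F₂))) with hW
      have hWdim : Module.finrank ℝ W = 1 + Module.finrank ℝ F₁ := by
        have hinj : Function.Injective ((e : (ℝ × F₁ × F₂) →ₗ[ℝ] E) ∘ₗ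
            (inclFst F₁ F₂ : (ℝ × F₁) →ₗ[ℝ] (ℝ × F₁ × F₂))) := e.injective.comp inclFst_injective
        rw [hW, LinearMap.finrank_range_of_inj hinj, Module.finrank_prod, Module.finrank_self]
      have hEdim : Module.finrank ℝ E = 1 + (Module.finrank ℝ F₁ + Module.finrank ℝ F₂) := by
        rw [← e.toLinearEquiv.finrank_eq, Module.finrank_prod, Module.finrank_prod,
          Module.finrank_self]
      have hcay : ∃ e : E ≃ₗ[ℝ] imCayley, ∀ a b c : E, l t ![a, b, c] =
        cayleyForm (e a) (e b) (e c) := hlam.cayley (γ.toFun t)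
      have hmem : e (0, x.1 t) ∈ W := by
        refine mem_of_forall_form_eq_zero hcay (v := e (inclFst F₁ F₂ (1, 0))) (W := W) ?_
          ⟨(1, 0), rfl⟩ ?_ (by omega) ?_
        · rw [Ne, EmbeddingLike.map_eq_zero_iff]
          intro h0
          have := congrArg Prod.fst h0
          simp [inclFst_apply] at this
        · rintro _ ⟨a, rfl⟩ _ ⟨b, rfl⟩ _ ⟨c, rfl⟩
          exact hiso t a b c
        · rintro _ ⟨a, rfl⟩
          -- Only the `F₁`-directions were tested above; in the direction of the velocity the form
          -- vanishes by alternation.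
          have h1 : a = a.1 • ((1 : ℝ), (0 : F₁)) + (0, a.2) := by ext <;> simp
          have h2 : e (inclFst F₁ F₂ a) = a.1 • e (inclFst F₁ F₂ (1, 0)) +
              e (inclFst F₁ F₂ (0, a.2)) := by
            conv_lhs => rw [h1]
            rw [map_add, map_add, map_smul, map_smul]
          change contraction (l t) (e (inclFst F₁ F₂ (1, 0))) (e (0, x.1 t))
            (e (inclFst F₁ F₂ a)) = 0
          rw [h2, map_add, map_smul]
          have h3 : contraction (l t) (e (inclFst F₁ F₂ (1, 0))) (e (0, x.1 t))
              (e (inclFst F₁ F₂ (1, 0))) = 0 :=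
            (l t).map_eq_zero_of_eq _ (i := 0) (j := 2) rfl (by decide)
          rw [h3, smul_zero, zero_add]
          exact hzero a.2 t ht
      obtain ⟨a, ha⟩ := hmem
      have h1 : inclFst F₁ F₂ a = (0, x.1 t) := e.injective ha
      exact (congrArg (fun z => z.2.2) h1).symm
    have hIcc : ∀ t ∈ Icc (0 : ℝ) 1, (x.1 t).2 = 0 := by
      have h1 : IsClosed {t | (x.1 t).2 = 0} :=
        isClosed_eq (continuous_snd.comp x.2.1.continuous) continuous_const
      have h2 := h1.closure_subset_iff.2 hIoo
      rwa [closure_Ioo zero_ne_one] at h2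
    exact mem_horizontalSections_of_Icc hIcc

end Horizontal

end Lagrangian

/-! ### Charts adapted to an immersion -/

theorem Loop.ext_toFun {E : Type*} [NormedAddCommGroup E] [NormedSpace ℝ E] {H : Type*}
    [TopologicalSpace H] {I : ModelWithCorners ℝ E H} {M : Type*} [TopologicalSpace M]
    [ChartedSpace H M] {γ γ' : Loop I M} (h : ∀ t, γ.toFun t = γ'.toFun t) : γ = γ' := by
  cases γ
  cases γ'
  congr
  exact funext h

section AdaptedCharts

variable {F₁ : Type*} [NormedAddCommGroup F₁] [NormedSpace ℝ F₁]
  {F₂ : Type*} [NormedAddCommGroup F₂] [NormedSpace ℝ F₂]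
  {E : Type*} [NormedAddCommGroup E] [NormedSpace ℝ E]
  {M : Type*} [TopologicalSpace M] [ChartedSpace E M]
  {E' : Type*} [NormedAddCommGroup E'] [NormedSpace ℝ E']
  {S : Type*} [TopologicalSpace S] [ChartedSpace E' S]
  {f : S → M} {A₁ : F₁ ≃L[ℝ] F₁} {A₂ : F₂ ≃L[ℝ] F₂}
  {Φ : ℝ × F₁ × F₂ → M} {Ψ : ℝ × F₁ → S}

/-- The maps `Φ` and `Ψ`, periodic up to linear isomorphisms of the fibres, are tubes around the
closed curves `f ∘ δ` and `δ`, and the tube `Φ` extends the tube `Ψ`. -/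
structure IsAdaptedTube (E E' : Type*) [NormedAddCommGroup E] [NormedSpace ℝ E] [ChartedSpace E M]
    [NormedAddCommGroup E'] [NormedSpace ℝ E'] [ChartedSpace E' S] (f : S → M) (δ : ℝ → S)
    (A₁ : F₁ ≃L[ℝ] F₁) (A₂ : F₂ ≃L[ℝ] F₂) (Φ : ℝ × F₁ × F₂ → M) (Ψ : ℝ × F₁ → S) : Prop where
  twist : ∀ t x, Φ (t + 1, x) = Φ (t, A₁.prodCongr A₂ x)
  twist' : ∀ t x, Ψ (t + 1, x) = Ψ (t, A₁ x)
  tube : ∀ t, IsTubeAt E E' f δ Φ Ψ t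

/-- Smooth charts can be composed with linear isomorphisms that respect smooth curves. -/
theorem IsSmoothChart.comp_equiv {W W' X : Type*} [SmoothCurves W] [SmoothCurves W']
    [SmoothCurves X] {V : Set W} {φ : W → X} (h : IsSmoothChart V φ) (e : W' ≃ W)
    (he : ∀ c : ℝ → W', IsSmoothCurve (e ∘ c) ↔ IsSmoothCurve c) :
    IsSmoothChart (e ⁻¹' V) (φ ∘ e) where
  open_source c hc := h.open_source (e ∘ c) ((he c).2 hc)
  open_image := by
    rw [image_comp, image_preimage_eq V e.surjective]
    exact h.open_image
  injOn x hx y hy hxy := e.injective (h.injOn hx hy hxy)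
  smooth_iff c hc := (he c).symm.trans (h.smooth_iff (e ∘ c) hc)

theorem isSmoothCurve_pushKnot_comp {hf : ContMDiff 𝓘(ℝ, E') 𝓘(ℝ, E) ∞ f}
    {c : ℝ → Unparam (loopsOver hf)} (hc : IsSmoothCurve c) : IsSmoothCurve (pushKnot hf ∘ c) := by
  intro u₀
  obtain ⟨g, hg, hgc⟩ := hc u₀
  refine ⟨fun u => ⟨(g u).1.map hf, (g u).2⟩, hf.comp hg, ?_⟩
  filter_upwards [hgc] with u hu
  simp only [Function.comp, hu]
  rfl

namespace IsAdaptedTube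

variable {δ : ℝ → S}

theorem apply_zero (h : IsAdaptedTube E E' f δ A₁ A₂ Φ Ψ) (t : ℝ) : Ψ (t, 0) = δ t :=
  (h.tube t).zero.self_of_nhds

theorem comm_zero (h : IsAdaptedTube E E' f δ A₁ A₂ Φ Ψ) (t : ℝ) : f (δ t) = Φ (t, 0) := by
  rw [← h.apply_zero t]
  exact (h.tube t).comm.self_of_nhds.symm

theorem diffeo (h : IsAdaptedTube E E' f δ A₁ A₂ Φ Ψ) (t : ℝ) :
    IsLocalDiffeomorphAt 𝓘(ℝ, ℝ × F₁ × F₂) 𝓘(ℝ, E) ∞ Φ (t, 0) := (h.tube t).diffeo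

/-- The chain rule for the two tubes. -/
theorem diffAt_inclFst (h : IsAdaptedTube E E' f δ A₁ A₂ Φ Ψ)
    (hf : ContMDiff 𝓘(ℝ, E') 𝓘(ℝ, E) ∞ f) (t : ℝ) (z : ℝ × F₁) :
    diffAt E Φ (t, 0) (inclFst F₁ F₂ z) =
      (mfderiv 𝓘(ℝ, E') 𝓘(ℝ, E) f (δ t) (diffAt E' Ψ (t, 0) z) : E) := by
  have hc : HasDerivAt (fun s : ℝ => (t, (0 : F₁)) + s • z) z 0 := by
    simpa using ((hasDerivAt_id (0 : ℝ)).smul_const z).const_add (t, (0 : F₁))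
  have hΨ : MDifferentiableAt 𝓘(ℝ, ℝ × F₁) 𝓘(ℝ, E') Ψ (t, 0) :=
    (h.tube t).diffeo'.contMDiffAt.mdifferentiableAt (by simp)
  have hfd : MDifferentiableAt 𝓘(ℝ, E') 𝓘(ℝ, E) f (Ψ (t, 0)) :=
    hf.contMDiffAt.mdifferentiableAt (by simp)
  have h1 := mfderiv_comp_curve (hfd.comp _ hΨ) hc (by simp)
  have hc' : HasDerivAt (fun s : ℝ => inclFst F₁ F₂ ((t, (0 : F₁)) + s • z)) (inclFst F₁ F₂ z) 0 :=
    (inclFst F₁ F₂).hasFDerivAt.comp_hasDerivAt (0 : ℝ) hc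
  have h2 := mfderiv_comp_curve ((h.diffeo t).contMDiffAt.mdifferentiableAt (by simp)) hc'
    (by simp [inclFst_apply])
  rw [← h2]
  have h3 : Φ ∘ (fun s : ℝ => inclFst F₁ F₂ ((t, (0 : F₁)) + s • z)) =ᶠ[𝓝 0]
      (f ∘ Ψ) ∘ fun s : ℝ => (t, (0 : F₁)) + s • z := by
    have h4 : Tendsto (fun s : ℝ => (t, (0 : F₁)) + s • z) (𝓝 0) (𝓝 (t, 0)) := by
      simpa using hc.continuousAt.tendsto
    exact h4.eventually (h.tube t).comm
  have h4 : mfderiv 𝓘(ℝ, ℝ) 𝓘(ℝ, E) (Φ ∘ (fun s : ℝ => inclFst F₁ F₂ ((t, (0 : F₁)) + s • z))) 0 =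
    mfderiv 𝓘(ℝ, ℝ) 𝓘(ℝ, E) ((f ∘ Ψ) ∘ fun s : ℝ => (t, (0 : F₁)) + s • z) 0 :=
    h3.mfderiv_eq
  have h5 : diffAt E (f ∘ Ψ) (t, 0) z =
      (mfderiv 𝓘(ℝ, E') 𝓘(ℝ, E) f (Ψ (t, 0)) (diffAt E' Ψ (t, 0) z) : E) :=
    congrArg (fun L => (L z : E)) (mfderiv_comp (t, (0 : F₁)) hfd hΨ)
  have h6 : ∀ p q : S, p = q → ∀ w : E', (mfderiv 𝓘(ℝ, E') 𝓘(ℝ, E) f p w : E) =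
      (mfderiv 𝓘(ℝ, E') 𝓘(ℝ, E) f q w : E) := by
    rintro p _ rfl w; rfl
  exact (congrArg (fun L => (L (1 : ℝ) : E)) h4).trans
    (h1.trans (h5.trans (h6 _ _ (h.apply_zero t) _)))

/-- Vectors tangent to the image of `f` are horizontal in the tube. -/
theorem diffEquiv_symm_mfderiv (h : IsAdaptedTube E E' f δ A₁ A₂ Φ Ψ)
    (hf : ContMDiff 𝓘(ℝ, E') 𝓘(ℝ, E) ∞ f) (t : ℝ) (w : E') :
    ((diffEquiv (h.diffeo t)).symm (mfderiv 𝓘(ℝ, E') 𝓘(ℝ, E) f (δ t) w : E)).2.2 = 0 := by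
  obtain ⟨z, hz⟩ := (diffEquiv (h.tube t).diffeo').surjective w
  have h1 : diffEquiv (h.diffeo t) (inclFst F₁ F₂ z) =
      (mfderiv 𝓘(ℝ, E') 𝓘(ℝ, E) f (δ t) w : E) := by
    rw [← hz]
    exact h.diffAt_inclFst hf t z
  have h2 : (diffEquiv (h.diffeo t)).symm (mfderiv 𝓘(ℝ, E') 𝓘(ℝ, E) f (δ t) w : E) =
      inclFst F₁ F₂ z :=
    (congrArg _ h1.symm).trans ((diffEquiv (h.diffeo t)).symm_apply_apply _)
  exact congrArg (fun z => z.2.2) h2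

/-- On small sections, the tube `Φ` extends the tube `Ψ`. -/
theorem exists_radius (h : IsAdaptedTube E E' f δ A₁ A₂ Φ Ψ) :
    ∃ ε > 0, ∀ y : twistedSections A₁, (∀ t ∈ Icc (0 : ℝ) 1, ‖y.1 t‖ < ε) →
      (∀ t, IsLocalDiffeomorphAt 𝓘(ℝ, ℝ × F₁) 𝓘(ℝ, E') ∞ Ψ (t, y.1 t)) ∧
      ∀ t, Φ (t, (inclSections A₁ A₂ y).1 t) = f (Ψ (t, y.1 t)) := by
  have hev : ∀ᶠ w : F₁ in 𝓝 0, ∀ t ∈ Icc (0 : ℝ) 1,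
      IsLocalDiffeomorphAt 𝓘(ℝ, ℝ × F₁) 𝓘(ℝ, E') ∞ Ψ (t, w) ∧ Φ (t, w, 0) = f (Ψ (t, w)) := by
    refine isCompact_Icc.eventually_forall_of_forall_eventually fun t _ => ?_
    have h1 : Tendsto (fun q : F₁ × ℝ => (q.2, q.1)) (𝓝 (0, t)) (𝓝 (t, 0)) :=
      continuous_swap.tendsto (0, t)
    exact (h1.eventually (h.tube t).diffeo'.eventually).and (h1.eventually (h.tube t).comm)
  obtain ⟨ε, hε, hball⟩ := Metric.eventually_nhds_iff.1 hev
  refine ⟨ε, hε, fun y hy => ?_⟩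
  have hy' : ∀ t ∈ Icc (0 : ℝ) 1, IsLocalDiffeomorphAt 𝓘(ℝ, ℝ × F₁) 𝓘(ℝ, E') ∞ Ψ (t, y.1 t) ∧
      Φ (t, y.1 t, 0) = f (Ψ (t, y.1 t)) := fun t ht =>
    hball (by rw [dist_zero_right]; exact hy t ht) t ht
  have hmem : ∀ t : ℝ, t - ⌊t⌋ ∈ Icc (0 : ℝ) 1 := fun t =>
    ⟨Int.fract_nonneg t, (Int.fract_lt_one t).le⟩
  refine ⟨fun t => ?_, fun t => ?_⟩
  · have h1 := (hy' _ (hmem t)).1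
    rw [twistedSections_apply_sub_intCast, isLocalDiffeomorphAt_shift_iff h.twist'] at h1
    exact h1
  · have h1 : Φ (t - ⌊t⌋, (inclSections A₁ A₂ y).1 (t - ⌊t⌋)) = f (Ψ (t - ⌊t⌋, y.1 (t - ⌊t⌋))) :=
      (hy' _ (hmem t)).2
    rwa [twistedSections_apply_sub_intCast, twistedSections_apply_sub_intCast,
      apply_shift_intCast h.twist, apply_shift_intCast h.twist'] at h1

end IsAdaptedTube

end AdaptedCharts

/-! ### Horizontal sections as velocities of loops in the source -/

section LagrangianCharts

variable {F₁ : Type*} [NormedAddCommGroup F₁] [NormedSpace ℝ F₁]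
  {F₂ : Type*} [NormedAddCommGroup F₂] [NormedSpace ℝ F₂]
  {E : Type*} [NormedAddCommGroup E] [NormedSpace ℝ E]
  {M : Type*} [TopologicalSpace M] [ChartedSpace E M]
  {E' : Type*} [NormedAddCommGroup E'] [NormedSpace ℝ E']
  {S : Type*} [TopologicalSpace S] [ChartedSpace E' S]
  {f : S → M} {A₁ : F₁ ≃L[ℝ] F₁} {A₂ : F₂ ≃L[ℝ] F₂}
  {Φ : ℝ × F₁ × F₂ → M} {Ψ : ℝ × F₁ → S} {δ : Loop 𝓘(ℝ, E') S}

open Classical in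
/-- The unparametrized loop in `S` defined by a section of the tube `Ψ`, with the value `d` where
there is none. -/
def loopChart (hΨ : ∀ t x, Ψ (t + 1, x) = Ψ (t, A₁ x)) (hf : ContMDiff 𝓘(ℝ, E') 𝓘(ℝ, E) ∞ f)
    (d : Unparam (loopsOver hf)) (y : twistedSections A₁) : Unparam (loopsOver hf) :=
  if h : ∃ h : ∀ t, IsLocalDiffeomorphAt 𝓘(ℝ, ℝ × F₁) 𝓘(ℝ, E') ∞ Ψ (t, y.1 t),
    tubeLoop hΨ y h ∈ loopsOver hf then Unparam.mk ⟨tubeLoop hΨ y h.choose, h.choose_spec⟩ else d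

theorem loopChart_apply (hΨ : ∀ t x, Ψ (t + 1, x) = Ψ (t, A₁ x))
    (hf : ContMDiff 𝓘(ℝ, E') 𝓘(ℝ, E) ∞ f) (d : Unparam (loopsOver hf)) {y : twistedSections A₁}
    {h : ∀ t, IsLocalDiffeomorphAt 𝓘(ℝ, ℝ × F₁) 𝓘(ℝ, E') ∞ Ψ (t, y.1 t)}
    (hk : tubeLoop hΨ y h ∈ loopsOver hf) :
    loopChart hΨ hf d y = Unparam.mk ⟨tubeLoop hΨ y h, hk⟩ := by
  have h' : ∃ h : ∀ t, IsLocalDiffeomorphAt 𝓘(ℝ, ℝ × F₁) 𝓘(ℝ, E') ∞ Ψ (t, y.1 t),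
    tubeLoop hΨ y h ∈ loopsOver hf := ⟨h, hk⟩
  exact dif_pos h'

theorem norm_inclSections_apply (y : twistedSections A₁) (t : ℝ) :
    ‖(inclSections A₁ A₂ y).1 t‖ = ‖y.1 t‖ := by
  change ‖(y.1 t, (0 : F₂))‖ = ‖y.1 t‖
  simp [Prod.norm_def]

namespace IsAdaptedTube

theorem map_tubeLoop (h : IsAdaptedTube E E' f δ.toFun A₁ A₂ Φ Ψ)
    (hf : ContMDiff 𝓘(ℝ, E') 𝓘(ℝ, E) ∞ f) {y : twistedSections A₁}
    {hΨ : ∀ t, IsLocalDiffeomorphAt 𝓘(ℝ, ℝ × F₁) 𝓘(ℝ, E') ∞ Ψ (t, y.1 t)}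
    {hΦ : ∀ t, IsLocalDiffeomorphAt 𝓘(ℝ, ℝ × F₁ × F₂) 𝓘(ℝ, E) ∞ Φ
      (t, (inclSections A₁ A₂ y).1 t)}
    (hy : ∀ t, Φ (t, (inclSections A₁ A₂ y).1 t) = f (Ψ (t, y.1 t))) :
    (tubeLoop h.twist' y hΨ).map hf = tubeLoop h.twist (inclSections A₁ A₂ y) hΦ :=
  Loop.ext_toFun fun t => (hy t).symm

theorem map_toFun (h : IsAdaptedTube E E' f δ.toFun A₁ A₂ Φ Ψ)
    (hf : ContMDiff 𝓘(ℝ, E') 𝓘(ℝ, E) ∞ f) (t : ℝ) : (δ.map hf).toFun t = Φ (t, 0) :=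
  h.comm_zero t

theorem tubeLoop_zero (h : IsAdaptedTube E E' f δ.toFun A₁ A₂ Φ Ψ)
    (hf : ContMDiff 𝓘(ℝ, E') 𝓘(ℝ, E) ∞ f) : tubeLoop h.twist 0 h.diffeo = δ.map hf :=
  Loop.ext_toFun fun t => (h.comm_zero t).symm

theorem zero_mem_tubeDomain (h : IsAdaptedTube E E' f δ.toFun A₁ A₂ Φ Ψ)
    {hf : ContMDiff 𝓘(ℝ, E') 𝓘(ℝ, E) ∞ f} (hδ : δ ∈ loopsOver hf) {ε : ℝ} (hε : 0 < ε) :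
    0 ∈ tubeDomain E h.twist ε := by
  refine ⟨fun t _ => ?_, h.diffeo, ?_⟩
  · change ‖(0 : F₁ × F₂)‖ < ε
    simpa using hε
  · rw [h.tubeLoop_zero hf]
    exact hδ

theorem exists_isSmoothChart [FiniteDimensional ℝ E] [IsManifold 𝓘(ℝ, E) ∞ M] [T2Space M]
    (h : IsAdaptedTube E E' f δ.toFun A₁ A₂ Φ Ψ) {hf : ContMDiff 𝓘(ℝ, E') 𝓘(ℝ, E) ∞ f}
    (hδ : δ ∈ loopsOver hf) (y : KnotSpace 𝓘(ℝ, E) M) :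
    ∃ ε₀ > 0, ∀ ε ≤ ε₀, IsSmoothChart (tubeDomain E h.twist ε) (tubeChart h.twist y) := by
  obtain ⟨ε₀, hε₀, hinj⟩ := injOn_tubeChart h.twist y h.diffeo (by
    rw [h.tubeLoop_zero hf]
    exact hδ)
  refine ⟨ε₀, hε₀, fun ε hε => isSmoothChart_tubeChart h.twist y (hinj.mono ?_)⟩
  rintro x ⟨h1, h2⟩
  exact ⟨fun t ht => (h1 t ht).trans_le hε, h2⟩

variable [IsManifold 𝓘(ℝ, E) ∞ M]

/-- The vector fields along `f ∘ δ` which are tangent to `f`, modulo those tangent to the loop. -/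
def tangentSubmodule (h : IsAdaptedTube E E' f δ.toFun A₁ A₂ Φ Ψ)
    (hf : ContMDiff 𝓘(ℝ, E') 𝓘(ℝ, E) ∞ f) : Submodule ℝ (δ.map hf).NormalSections :=
  (horizontalSections (A₁.prodCongr A₂)).comap (normalEquiv h.twist h.diffeo
    (h.map_toFun hf) : (δ.map hf).NormalSections →ₗ[ℝ] twistedSections (A₁.prodCongr A₂))

theorem mem_tangentSubmodule (h : IsAdaptedTube E E' f δ.toFun A₁ A₂ Φ Ψ)
    (hf : ContMDiff 𝓘(ℝ, E') 𝓘(ℝ, E) ∞ f) (x : (δ.map hf).NormalSections) :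
    x ∈ h.tangentSubmodule hf ↔
      normalEquiv h.twist h.diffeo (h.map_toFun hf) x ∈
        horizontalSections (A₁.prodCongr A₂) := Iff.rfl

/-- A vector field along `f ∘ δ` all of whose values are tangent to `f` is horizontal. -/
theorem mkQ_mem_tangentSubmodule (h : IsAdaptedTube E E' f δ.toFun A₁ A₂ Φ Ψ)
    (hf : ContMDiff 𝓘(ℝ, E') 𝓘(ℝ, E) ∞ f) {X : (δ.map hf).fields}
    (hX : ∀ t, ∃ w : E', (X.1 t : E) = (mfderiv 𝓘(ℝ, E') 𝓘(ℝ, E) f (δ.toFun t) w : E)) :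
    (δ.map hf).tangentialFields.mkQ X ∈ h.tangentSubmodule hf := by
  rw [mem_tangentSubmodule, normalEquiv_mkQ]
  intro t
  obtain ⟨w, hw⟩ := hX t
  rw [tubeCoord_apply]
  exact (congrArg (fun v : E => ((diffEquiv (h.diffeo t)).symm v).2.2) hw).trans
    (h.diffEquiv_symm_mfderiv hf t w)

/-- The velocity of a family of loops in `S`, mapped to `M`, is tangent to `f`. -/
theorem exists_eq_mfderiv_of_hasInitialVelocity (hf : ContMDiff 𝓘(ℝ, E') 𝓘(ℝ, E) ∞ f)
    {X : (δ.map hf).fields} {g : ℝ → Loop 𝓘(ℝ, E) M} (hX : HasInitialVelocity g (δ.map hf) X)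
    {c : ℝ → ℝ → S} (hc : ∀ t, MDifferentiableAt 𝓘(ℝ, ℝ) 𝓘(ℝ, E') (fun u => c u t) 0)
    (hgc : ∀ u t, (g u).toFun t = f (c u t)) (h0 : ∀ t, c 0 t = δ.toFun t) (t : ℝ) :
    ∃ w : E', (X.1 t : E) = (mfderiv 𝓘(ℝ, E') 𝓘(ℝ, E) f (δ.toFun t) w : E) := by
  refine ⟨mfderiv 𝓘(ℝ, ℝ) 𝓘(ℝ, E') (fun u => c u t) 0 (1 : ℝ), ?_⟩
  have h1 : (X.1 t : E) = (mfderiv 𝓘(ℝ, ℝ) 𝓘(ℝ, E) (fun u => (g u).toFun t) 0 (1 : ℝ) : E) :=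
    tangentBundle_mk_inj (E := E) (M := M) (hX t)
  have h2 : (fun u => (g u).toFun t) = f ∘ fun u => c u t := funext fun u => hgc u t
  have h3 := mfderiv_comp (I' := 𝓘(ℝ, E')) (0 : ℝ)
    ((hf (c 0 t)).mdifferentiableAt (by simp)) (hc t)
  have h6 : ∀ p q : S, p = q → ∀ w : E', (mfderiv 𝓘(ℝ, E') 𝓘(ℝ, E) f p w : E) =
      (mfderiv 𝓘(ℝ, E') 𝓘(ℝ, E) f q w : E) := by
    rintro p _ rfl w; rfl
  refine h1.trans (Eq.trans ?_ (h6 _ _ (h0 t) _))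
  exact (congrArg (fun g : ℝ → M => (mfderiv 𝓘(ℝ, ℝ) 𝓘(ℝ, E) g 0 (1 : ℝ) : E)) h2).trans
    (congrArg (fun L => (L (1 : ℝ) : E)) h3)

theorem tangentImage_subset (h : IsAdaptedTube E E' f δ.toFun A₁ A₂ Φ Ψ)
    (hf : ContMDiff 𝓘(ℝ, E') 𝓘(ℝ, E) ∞ f) :
    tangentImage hf δ ⊆ h.tangentSubmodule hf := by
  rintro _ ⟨g, X, hg, hg0, hX, rfl⟩
  refine h.mkQ_mem_tangentSubmodule hf (exists_eq_mfderiv_of_hasInitialVelocity hf hX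
    (c := fun u t => (g u).1.toFun t) (fun t => ?_) (fun u t => rfl) (fun t => by rw [hg0]))
  have h1 : ContMDiff 𝓘(ℝ, ℝ × ℝ) 𝓘(ℝ, E') ∞ fun q : ℝ × ℝ => (g q.1).1.toFun q.2 := hg
  have h2 : ContMDiff 𝓘(ℝ, ℝ) 𝓘(ℝ, ℝ × ℝ) ∞ fun u : ℝ => (u, t) :=
    ContDiff.contMDiff (by fun_prop)
  exact (h1.comp h2).contMDiffAt.mdifferentiableAt (by simp)

theorem isSmoothCurve_smul (x : twistedSections A₁) :
    ContDiff ℝ ∞ fun q : ℝ × ℝ => (q.1 • x).1 q.2 :=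
  contDiff_fst.smul (x.2.1.comp contDiff_snd)

/-- A horizontal section is the velocity of the family of its small multiples, all of which come
from loops in the tube `Ψ` in `S`. -/
theorem subset_tangentImage [FiniteDimensional ℝ E] [T2Space M]
    (h : IsAdaptedTube E E' f δ.toFun A₁ A₂ Φ Ψ) {hf : ContMDiff 𝓘(ℝ, E') 𝓘(ℝ, E) ∞ f}
    (hδ : δ ∈ loopsOver hf) : (h.tangentSubmodule hf : Set _) ⊆ tangentImage hf δ := by
  intro n hn
  obtain ⟨ε, hε, hrad⟩ := h.exists_radius
  set Θ := normalEquiv h.twist h.diffeo (h.map_toFun hf) with hΘ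
  set y : twistedSections A₁ := fstSections A₁ A₂ (Θ n) with hy
  have hyn : inclSections A₁ A₂ y = Θ n := inclSections_fstSections hn
  have hev : ∀ᶠ u : ℝ in 𝓝 0, u • inclSections A₁ A₂ y ∈ tubeDomain E h.twist ε := by
    have h1 : ContDiffOn ℝ ∞ (fun q : ℝ × ℝ => (q.1 • inclSections A₁ A₂ y).1 q.2)
        (univ ×ˢ univ) := (isSmoothCurve_smul _).contDiffOn
    refine eventually_mem_tubeDomain h.twist (x := fun u => u • inclSections A₁ A₂ y)
      isOpen_univ (mem_univ 0) h1 ?_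
    rw [zero_smul]
    exact h.zero_mem_tubeDomain hδ hε
  obtain ⟨ρ, hρ, hball⟩ := Metric.eventually_nhds_iff.1 hev
  -- Curves must be defined on all of `ℝ` and stay among singular knots: `s` has derivative `1` at
  -- `0` and never exceeds `ρ / 2` in absolute value.
  set s : ℝ → ℝ := fun u => ρ / 2 * Real.sin (2 / ρ * u) with hs
  have hsd : ContDiff ℝ ∞ s := contDiff_const.mul (Real.contDiff_sin.comp (by fun_prop))
  have hs0 : s 0 = 0 := by simp [hs]
  have hs1 : HasDerivAt s 1 0 := by
    have h1 : HasDerivAt (fun u : ℝ => 2 / ρ * u) (2 / ρ) 0 := by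
      simpa using (hasDerivAt_id (0 : ℝ)).const_mul (2 / ρ)
    have h2 := (h1.sin).const_mul (ρ / 2)
    refine h2.congr_deriv ?_
    have : ρ ≠ 0 := hρ.ne'
    simp
    field_simp
  have hsρ : ∀ u, s u • inclSections A₁ A₂ y ∈ tubeDomain E h.twist ε := by
    intro u
    refine hball ?_
    rw [dist_zero_right, Real.norm_eq_abs, hs, abs_mul, abs_of_pos (half_pos hρ)]
    calc ρ / 2 * |Real.sin (2 / ρ * u)| ≤ ρ / 2 * 1 := by
          gcongr
          exact Real.abs_sin_le_one _
      _ < ρ := by linarith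
  have hincl : ∀ u, inclSections A₁ A₂ (s u • y) = s u • inclSections A₁ A₂ y :=
    fun u => map_smul _ _ _
  have hgood : ∀ u, (∀ t, IsLocalDiffeomorphAt 𝓘(ℝ, ℝ × F₁) 𝓘(ℝ, E') ∞ Ψ (t, (s u • y).1 t)) ∧
      ∀ t, Φ (t, (inclSections A₁ A₂ (s u • y)).1 t) = f (Ψ (t, (s u • y).1 t)) := by
    intro u
    refine hrad _ fun t ht => ?_
    rw [← norm_inclSections_apply (A₂ := A₂), hincl]
    exact (hsρ u).1 t ht
  have hloop : ∀ u, tubeLoop h.twist' (s u • y) (hgood u).1 ∈ loopsOver hf := by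
    intro u
    obtain ⟨-, h1, h2⟩ := hsρ u
    rw [← hincl] at h1
    change ((tubeLoop h.twist' (s u • y) (hgood u).1).map hf).IsSingularKnot
    rw [h.map_tubeLoop hf (hΦ := by rw [hincl]; exact (hsρ u).2.choose) (hgood u).2]
    convert (hsρ u).2.choose_spec using 2
    exact hincl u
  refine ⟨fun u => ⟨tubeLoop h.twist' (s u • y) (hgood u).1, hloop u⟩,
    tubeField h.twist h.diffeo (h.map_toFun hf) (Θ n), ?_, ?_, fun t => ?_, ?_⟩
  · rintro ⟨u, t⟩
    have h1 : ContDiff ℝ ∞ fun q : ℝ × ℝ => (q.2, (s q.1 • y).1 q.2) :=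
      contDiff_snd.prodMk ((hsd.comp contDiff_fst).smul (y.2.1.comp contDiff_snd))
    exact ContMDiffAt.comp (g := Ψ) (f := fun q : ℝ × ℝ => (q.2, (s q.1 • y).1 q.2)) (u, t)
      ((hgood u).1 t).contMDiffAt h1.contMDiff.contMDiffAt
  · refine Loop.ext_toFun fun t => ?_
    change Ψ (t, s 0 • y.1 t) = δ.toFun t
    rw [hs0, zero_smul, h.apply_zero]
  · have hc : HasDerivAt (fun u : ℝ => (t, s u • (inclSections A₁ A₂ y).1 t))
        ((0 : ℝ), (Θ n).1 t) 0 := by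
      have h1 := (hasDerivAt_const (0 : ℝ) t).prodMk (hs1.smul_const ((inclSections A₁ A₂ y).1 t))
      rw [one_smul, hyn] at h1
      rw [hyn]
      exact h1
    have h1 := mfderiv_comp_curve ((h.diffeo t).contMDiffAt.mdifferentiableAt (by simp)) hc
      (by rw [hs0, zero_smul])
    have h2 : (Φ ∘ fun u : ℝ => (t, s u • (inclSections A₁ A₂ y).1 t)) =
        fun u => ((tubeLoop h.twist' (s u • y) (hgood u).1).map hf).toFun t := by
      ext u
      refine Eq.trans ?_ ((hgood u).2 t)
      rw [hincl]
      rfl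
    rw [h2] at h1
    have h3 : (δ.map hf).toFun t = ((tubeLoop h.twist' (s 0 • y) (hgood 0).1).map hf).toFun t := by
      change f (δ.toFun t) = f (Ψ (t, s 0 • y.1 t))
      rw [hs0, zero_smul, h.apply_zero]
    exact (tangentBundle_mk_congr h3 _).trans
      (congrArg (fun v : E => (⟨_, v⟩ : TangentBundle 𝓘(ℝ, E) M)) h1.symm)
  · rw [← normalEquiv_symm_apply, ← hΘ, LinearEquiv.symm_apply_apply]

end IsAdaptedTube

end LagrangianCharts

/-! ### Charts of the immersion and slice charts -/

section LagrangianImmersions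

variable {F₁ : Type*} [NormedAddCommGroup F₁] [NormedSpace ℝ F₁]
  {F₂ : Type*} [NormedAddCommGroup F₂] [NormedSpace ℝ F₂]
  {E : Type*} [NormedAddCommGroup E] [NormedSpace ℝ E]
  {M : Type*} [TopologicalSpace M] [ChartedSpace E M]
  {E' : Type*} [NormedAddCommGroup E'] [NormedSpace ℝ E']
  {S : Type*} [TopologicalSpace S] [ChartedSpace E' S]
  {f : S → M} {A₁ : F₁ ≃L[ℝ] F₁} {A₂ : F₂ ≃L[ℝ] F₂}
  {Φ : ℝ × F₁ × F₂ → M} {Ψ : ℝ × F₁ → S} {δ : Loop 𝓘(ℝ, E') S}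

namespace IsAdaptedTube

/-- The chart of the knot space given by the tube, on normal sections. -/
theorem isSmoothChart_comp_normalEquiv [IsManifold 𝓘(ℝ, E) ∞ M]
    (h : IsAdaptedTube E E' f δ.toFun A₁ A₂ Φ Ψ)
    (hf : ContMDiff 𝓘(ℝ, E') 𝓘(ℝ, E) ∞ f) {V : Set (twistedSections (A₁.prodCongr A₂))}
    {φ : twistedSections (A₁.prodCongr A₂) → KnotSpace 𝓘(ℝ, E) M} (hφ : IsSmoothChart V φ) :
    IsSmoothChart (normalEquiv h.twist h.diffeo (h.map_toFun hf) ⁻¹' V)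
      (φ ∘ normalEquiv h.twist h.diffeo (h.map_toFun hf)) :=
  hφ.comp_equiv (normalEquiv h.twist h.diffeo (h.map_toFun hf)).toEquiv
    (isSmoothCurve_normalEquiv_comp_iff h.twist h.diffeo (h.map_toFun hf))

/-- Small horizontal sections that define knots in the tube `Φ` define loops in the tube `Ψ`. -/
theorem exists_mem_loopsOver (h : IsAdaptedTube E E' f δ.toFun A₁ A₂ Φ Ψ)
    (hf : ContMDiff 𝓘(ℝ, E') 𝓘(ℝ, E) ∞ f) :
    ∃ ε₀ > 0, ∀ ε ≤ ε₀, ∀ y : twistedSections A₁,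
      inclSections A₁ A₂ y ∈ tubeDomain E h.twist ε →
      ∃ (hΨ : ∀ t, IsLocalDiffeomorphAt 𝓘(ℝ, ℝ × F₁) 𝓘(ℝ, E') ∞ Ψ (t, y.1 t))
        (hk : tubeLoop h.twist' y hΨ ∈ loopsOver hf), ∀ d,
        tubeChart h.twist d (inclSections A₁ A₂ y) =
          Unparam.mk (P := singularKnots 𝓘(ℝ, E) M) ⟨(tubeLoop h.twist' y hΨ).map hf, hk⟩ := by
  obtain ⟨ε₀, hε₀, hrad⟩ := h.exists_radius
  refine ⟨ε₀, hε₀, fun ε hε y hy => ?_⟩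
  obtain ⟨h1, h2, h3⟩ := hy
  obtain ⟨h4, h5⟩ := hrad y fun t ht => by
    rw [← norm_inclSections_apply (A₂ := A₂)]
    exact (h1 t ht).trans_le hε
  have h6 := h.map_tubeLoop hf (hΨ := h4) (hΦ := h2) h5
  have hk : tubeLoop h.twist' y h4 ∈ loopsOver hf := by
    change ((tubeLoop h.twist' y h4).map hf).IsSingularKnot
    rw [h6]
    exact h3
  refine ⟨h4, hk, fun d => ?_⟩
  rw [tubeChart_apply h.twist d h3]
  congr 1
  exact Subtype.ext h6.symm

/-- Here `ψ` reads a horizontal section in the tube `Ψ`, so that `pushKnot hf ∘ ψ` is the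
restriction of `φ`. Injectivity of `ψ` and smoothness of its inverse are inherited from `φ`; only
openness of the image requires lifting families of loops within `S`. -/
theorem exists_charts [IsManifold 𝓘(ℝ, E) ∞ M] [FiniteDimensional ℝ E] [T2Space M]
    (h : IsAdaptedTube E E' f δ.toFun A₁ A₂ Φ Ψ) {hf : ContMDiff 𝓘(ℝ, E') 𝓘(ℝ, E) ∞ f}
    (hδ : δ ∈ loopsOver hf) :
    ∃ (V : Set (δ.map hf).NormalSections) (φ : (δ.map hf).NormalSections → KnotSpace 𝓘(ℝ, E) M)
      (ψ : h.tangentSubmodule hf → Unparam (loopsOver hf)),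
      IsSmoothChart V φ ∧ 0 ∈ V ∧
      IsSmoothChart {x : h.tangentSubmodule hf | (x : (δ.map hf).NormalSections) ∈ V} ψ ∧
      ψ 0 = Unparam.mk ⟨δ, hδ⟩ ∧ ∀ x : h.tangentSubmodule hf,
        (x : (δ.map hf).NormalSections) ∈ V → pushKnot hf (ψ x) = φ x := by
  set d : KnotSpace 𝓘(ℝ, E) M := Unparam.mk ⟨δ.map hf, hδ⟩ with hd
  set d' : Unparam (loopsOver hf) := Unparam.mk ⟨δ, hδ⟩ with hd'
  obtain ⟨ε₁, hε₁, hchart⟩ := h.exists_isSmoothChart hδ d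
  obtain ⟨ε₂, hε₂, hover⟩ := h.exists_mem_loopsOver hf
  set ε := min ε₁ ε₂ with hε
  have hεpos : 0 < ε := lt_min hε₁ hε₂
  set Θ := normalEquiv h.twist h.diffeo (h.map_toFun hf) with hΘ
  have hφ := h.isSmoothChart_comp_normalEquiv hf (hchart ε (min_le_left _ _))
  have hover' := hover ε (min_le_right _ _)
  set V := Θ ⁻¹' tubeDomain E h.twist ε with hV
  set φ := tubeChart h.twist d ∘ Θ with hφdef
  set ψ : h.tangentSubmodule hf → Unparam (loopsOver hf) := fun x =>
    loopChart h.twist' hf d' (fstSections A₁ A₂ (Θ x)) with hψ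
  have hincl : ∀ x : h.tangentSubmodule hf, inclSections A₁ A₂ (fstSections A₁ A₂ (Θ x)) = Θ x :=
    fun x => inclSections_fstSections x.2
  have hmem : ∀ x : h.tangentSubmodule hf, (x : (δ.map hf).NormalSections) ∈ V →
      inclSections A₁ A₂ (fstSections A₁ A₂ (Θ x)) ∈ tubeDomain E h.twist ε := fun x hx => by
    rw [hincl x]; exact hx
  have hpush : ∀ x : h.tangentSubmodule hf, (x : (δ.map hf).NormalSections) ∈ V →
      pushKnot hf (ψ x) = φ x := by
    intro x hx
    obtain ⟨hΨ, hk, heq⟩ := hover' _ (hmem x hx)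
    have h1 : ψ x = _ := loopChart_apply h.twist' hf d' hk
    have h2 : φ x = tubeChart h.twist d (inclSections A₁ A₂ (fstSections A₁ A₂ (Θ x))) := by
      rw [hincl x]
      rfl
    rw [h1, h2, heq]
    rfl
  have h0 : (0 : (δ.map hf).NormalSections) ∈ V := by
    change Θ 0 ∈ tubeDomain E h.twist ε
    rw [map_zero]
    exact h.zero_mem_tubeDomain hδ hεpos
  have hψ0 : ψ 0 = d' := by
    obtain ⟨hΨ, hk, -⟩ := hover' _ (hmem 0 h0)
    have h1 : ψ 0 = _ := loopChart_apply h.twist' hf d' hk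
    rw [h1, hd']
    congr 1
    refine Subtype.ext (Loop.ext_toFun fun t => ?_)
    change Ψ (t, ((Θ (0 : h.tangentSubmodule hf)).1 t).1) = δ.toFun t
    have h2 : Θ ((0 : h.tangentSubmodule hf) : (δ.map hf).NormalSections) = 0 := map_zero Θ
    rw [h2, ← h.apply_zero t]
    rfl
  refine ⟨V, φ, ψ, hφ, h0, ⟨?_, ?_, ?_, ?_⟩, hψ0, hpush⟩
  · exact fun c hc => hφ.open_source (fun u => (c u : (δ.map hf).NormalSections)) hc
  · intro c hc
    refine isOpen_iff_mem_nhds.2 fun u₀ ⟨x, hx, hcx⟩ => ?_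
    obtain ⟨g, hg, hgc⟩ := hc u₀
    obtain ⟨hΨ, hk, -⟩ := hover' _ (hmem x hx)
    have h1 : ψ x = _ := loopChart_apply h.twist' hf d' hk
    rw [h1, hgc.self_of_nhds] at hcx
    obtain ⟨U, hU, hUo, y, hy₀, hy, hr⟩ := exists_smooth_sections h.twist' _ hΨ
      (g := fun u => (g u).1) hg (Unparam.mk_eq_mk_iff.1 hcx)
    have hy' : ContDiffOn ℝ ∞ (fun q : ℝ × ℝ => (inclSections A₁ A₂ (y q.1)).1 q.2) (U ×ˢ univ) :=
      hy.prodMk contDiffOn_const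
    have hdom := eventually_mem_tubeDomain h.twist (x := fun u => inclSections A₁ A₂ (y u)) hUo
      (mem_of_mem_nhds hU) hy' (ε := ε) (by rw [hy₀]; exact hmem x hx)
    filter_upwards [hdom, hr, hgc] with u hu hru hgu
    have hΘu : Θ (Θ.symm (inclSections A₁ A₂ (y u))) = inclSections A₁ A₂ (y u) :=
      Θ.apply_symm_apply _
    refine ⟨⟨Θ.symm (inclSections A₁ A₂ (y u)), ?_⟩, ?_, ?_⟩
    · rw [mem_tangentSubmodule, ← hΘ, hΘu]
      exact inclSections_mem _
    · change Θ (Θ.symm (inclSections A₁ A₂ (y u))) ∈ tubeDomain E h.twist ε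
      rw [hΘu]
      exact hu
    · change loopChart h.twist' hf d'
        (fstSections A₁ A₂ (Θ (Θ.symm (inclSections A₁ A₂ (y u))))) = c u
      rw [hΘu]
      change loopChart h.twist' hf d' (y u) = c u
      obtain ⟨hΨ', hk', -⟩ := hover' _ hu
      rw [loopChart_apply h.twist' hf d' hk', hgu]
      exact Unparam.mk_eq_mk_iff.2 hru.choose_spec
  · intro x hx x' hx' hxx'
    refine Subtype.ext (hφ.injOn hx hx' ?_)
    rw [← hpush x hx, ← hpush x' hx', hxx']
  · intro c hcV
    constructor
    · intro hc u₀
      have hgood := fun u => hover' _ (hmem (c u) (hcV u))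
      choose hΨ hk heq using hgood
      refine ⟨fun u => ⟨tubeLoop h.twist' (fstSections A₁ A₂ (Θ (c u))) (hΨ u), hk u⟩, ?_,
        Eventually.of_forall fun u => loopChart_apply h.twist' hf d' (hk u)⟩
      have hc' : ContDiff ℝ ∞ fun q : ℝ × ℝ => (Θ (c q.1)).1 q.2 :=
        (isSmoothCurve_normalEquiv_comp_iff h.twist h.diffeo (h.map_toFun hf) _).2 hc
      rintro ⟨u, t⟩
      have h1 : ContDiff ℝ ∞ fun q : ℝ × ℝ => (q.2, ((Θ (c q.1)).1 q.2).1) :=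
        contDiff_snd.prodMk (contDiff_fst.comp hc')
      exact ContMDiffAt.comp (g := Ψ) (f := fun q : ℝ × ℝ => (q.2, ((Θ (c q.1)).1 q.2).1)) (u, t)
        (hΨ u t).contMDiffAt h1.contMDiff.contMDiffAt
    · intro hc
      refine (hφ.smooth_iff (fun u => (c u : (δ.map hf).NormalSections)) hcV).2 ?_
      have h1 : φ ∘ (fun u => (c u : (δ.map hf).NormalSections)) = pushKnot hf ∘ ψ ∘ c :=
        funext fun u => (hpush (c u) (hcV u)).symm
      rw [h1]
      exact isSmoothCurve_pushKnot_comp hc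

/-- Near the core of the tube, the points of the image of an embedding `f` are horizontal. -/
theorem exists_slice_radius (h : IsAdaptedTube E E' f δ.toFun A₁ A₂ Φ Ψ) (hemb : IsEmbedding f) :
    ∃ ε > 0, ∀ t ∈ Icc (0 : ℝ) 1, ∀ x : F₁ × F₂, ‖x‖ < ε → Φ (t, x) ∈ range f → x.2 = 0 := by
  have hloc : ∀ t, ∀ᶠ z : ℝ × F₁ × F₂ in 𝓝 (t, 0), Φ z ∈ range f → z.2.2 = 0 := by
    intro t
    obtain ⟨U, hU, hinj⟩ := (h.diffeo t).exists_injOn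
    obtain ⟨G, hG, hGl, hGr⟩ := (h.tube t).diffeo'.exists_inverse
    have hG0 : G (Ψ (t, 0)) = (t, 0) := hGl.self_of_nhds
    have hGt : Tendsto G (𝓝 (Ψ (t, 0))) (𝓝 (t, 0)) := by
      have := hG.self_of_nhds.continuousAt.tendsto
      rwa [hG0] at this
    have hiG : Tendsto (fun p => inclFst F₁ F₂ (G p)) (𝓝 (Ψ (t, 0))) (𝓝 (t, 0)) :=
      ((inclFst F₁ F₂).continuous.tendsto (t, 0)).comp hGt
    have hev : ∀ᶠ p in 𝓝 (Ψ (t, 0)), Φ (inclFst F₁ F₂ (G p)) = f p ∧ inclFst F₁ F₂ (G p) ∈ U := by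
      filter_upwards [hGr, hGt.eventually (h.tube t).comm, hiG.eventually hU] with p h1 h2 h3
      refine ⟨?_, h3⟩
      rw [h1] at h2
      exact h2
    -- This is where the embedding enters: a point of `range f` close to `Φ (t, 0)` comes from a
    -- point of `S` close to `δ t`, hence lies in the image of the tube `Ψ`, and local injectivity
    -- of `Φ` shows that its coordinates are horizontal.
    rw [hemb.isInducing.nhds_eq_comap, eventually_comap] at hev
    have hΦ0 : f (Ψ (t, 0)) = Φ (t, 0) := by rw [h.apply_zero, h.comm_zero]
    rw [hΦ0] at hev
    filter_upwards [(h.diffeo t).contMDiffAt.continuousAt.eventually hev, hU] with z h1 h2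
    rintro ⟨p, hp⟩
    obtain ⟨h3, h4⟩ := h1 p hp
    have h5 : inclFst F₁ F₂ (G p) = z := hinj h4 h2 (h3.trans hp)
    rw [← h5]
    rfl
  have hev : ∀ᶠ x : F₁ × F₂ in 𝓝 0, ∀ t ∈ Icc (0 : ℝ) 1, Φ (t, x) ∈ range f → x.2 = 0 := by
    refine isCompact_Icc.eventually_forall_of_forall_eventually fun t _ => ?_
    have h1 : Tendsto (fun q : (F₁ × F₂) × ℝ => (q.2, q.1)) (𝓝 (0, t)) (𝓝 (t, 0)) :=
      continuous_swap.tendsto (0, t)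
    exact h1.eventually (hloc t)
  obtain ⟨ε, hε, hball⟩ := Metric.eventually_nhds_iff.1 hev
  exact ⟨ε, hε, fun t ht x hx => hball (by rwa [dist_zero_right]) t ht⟩

end IsAdaptedTube

/-- Membership in the set of knots contained in `T`. -/
theorem mk_mem_knotsIn_iff {T : Set M} {γ : {γ : Loop 𝓘(ℝ, E) M // γ ∈ singularKnots 𝓘(ℝ, E) M}} :
    Unparam.mk γ ∈ knotsIn 𝓘(ℝ, E) T ↔ ∀ t, γ.1.toFun t ∈ T := by
  constructor
  · rintro ⟨γ', h, h'⟩ t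
    obtain ⟨φ, -, -, hφ⟩ := Unparam.mk_eq_mk_iff.1 h.symm
    rw [hφ]
    exact h' _
  · exact fun h => ⟨γ, rfl, h⟩

namespace IsAdaptedTube

theorem exists_slice_chart [IsManifold 𝓘(ℝ, E) ∞ M] [FiniteDimensional ℝ E] [T2Space M]
    (h : IsAdaptedTube E E' f δ.toFun A₁ A₂ Φ Ψ) {hf : ContMDiff 𝓘(ℝ, E') 𝓘(ℝ, E) ∞ f}
    (hδ : δ ∈ loopsOver hf) (hemb : IsEmbedding f) :
    ∃ (V : Set (δ.map hf).NormalSections) (φ : (δ.map hf).NormalSections → KnotSpace 𝓘(ℝ, E) M),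
      IsSmoothChart V φ ∧ 0 ∈ V ∧ φ 0 = Unparam.mk ⟨δ.map hf, hδ⟩ ∧
      ∀ x ∈ V, φ x ∈ knotsIn 𝓘(ℝ, E) (range f) ↔ x ∈ h.tangentSubmodule hf := by
  set d : KnotSpace 𝓘(ℝ, E) M := Unparam.mk ⟨δ.map hf, hδ⟩ with hd
  obtain ⟨ε₁, hε₁, hchart⟩ := h.exists_isSmoothChart hδ d
  obtain ⟨ε₂, hε₂, hover⟩ := h.exists_mem_loopsOver hf
  obtain ⟨ε₃, hε₃, hslice⟩ := h.exists_slice_radius hemb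
  set ε := min ε₁ (min ε₂ ε₃) with hε
  have hεpos : 0 < ε := lt_min hε₁ (lt_min hε₂ hε₃)
  have hεle : ε ≤ ε₂ := (min_le_right _ _).trans (min_le_left _ _)
  have hεle' : ε ≤ ε₃ := (min_le_right _ _).trans (min_le_right _ _)
  set Θ := normalEquiv h.twist h.diffeo (h.map_toFun hf) with hΘ
  have hdom : ∀ x ∈ tubeDomain E h.twist ε, ∃ hl hk, tubeChart h.twist d x =
      Unparam.mk (P := singularKnots 𝓘(ℝ, E) M) ⟨tubeLoop h.twist x hl, hk⟩ := fun x hx =>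
    ⟨hx.2.choose, hx.2.choose_spec, tubeChart_apply h.twist d _⟩
  have hzero := h.zero_mem_tubeDomain hδ hεpos
  refine ⟨Θ ⁻¹' tubeDomain E h.twist ε, tubeChart h.twist d ∘ Θ,
    h.isSmoothChart_comp_normalEquiv hf (hchart ε (min_le_left _ _)), ?_, ?_, fun x hx => ?_⟩
  · change Θ 0 ∈ tubeDomain E h.twist ε
    rw [map_zero]
    exact hzero
  · change tubeChart h.twist d (Θ 0) = d
    rw [map_zero]
    obtain ⟨hl, hk, heq⟩ := hdom 0 hzero
    rw [heq, hd]
    congr 1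
    exact Subtype.ext (h.tubeLoop_zero hf)
  · rw [mem_tangentSubmodule, ← hΘ]
    constructor
    · intro hL
      obtain ⟨hl, hk, heq⟩ := hdom (Θ x) hx
      have h1 : tubeChart h.twist d (Θ x) ∈ knotsIn 𝓘(ℝ, E) (range f) := hL
      rw [heq, mk_mem_knotsIn_iff] at h1
      exact mem_horizontalSections_of_Icc fun t ht =>
        hslice t ht _ ((hx.1 t ht).trans_le hεle') (h1 t)
    · intro hF
      have h1 := inclSections_fstSections hF
      obtain ⟨hΨ, hk, heq⟩ := hover ε hεle (fstSections A₁ A₂ (Θ x)) (by rw [h1]; exact hx)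
      have h2 := (congrArg (tubeChart h.twist d) h1).symm.trans (heq d)
      change tubeChart h.twist d (Θ x) ∈ knotsIn 𝓘(ℝ, E) (range f)
      rw [h2, mk_mem_knotsIn_iff]
      exact fun t => ⟨_, rfl⟩

end IsAdaptedTube

/-- Smooth maps into the image of an embedding lift to smooth maps. -/
theorem exists_contMDiff_lift [IsManifold 𝓘(ℝ, E') ∞ S] (hf : IsImmersion 𝓘(ℝ, E') 𝓘(ℝ, E) ∞ f)
    (hemb : IsEmbedding f) {N : Type*} [NormedAddCommGroup N] [NormedSpace ℝ N] {g : N → M}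
    (hg : ContMDiff 𝓘(ℝ, N) 𝓘(ℝ, E) ∞ g) (hgf : ∀ n, g n ∈ range f) :
    ∃ k : N → S, ContMDiff 𝓘(ℝ, N) 𝓘(ℝ, E') ∞ k ∧ ∀ n, f (k n) = g n := by
  choose k hk using hgf
  have hfk : f ∘ k = g := funext hk
  refine ⟨k, (ContMDiff.iff_comp_isImmersion hf).2 ⟨?_, ?_⟩, hk⟩
  · rw [hemb.isInducing.continuous_iff, hfk]
    exact hg.continuous
  · rw [hfk]
    exact hg

theorem tangentImage_subset_tangentSet [IsManifold 𝓘(ℝ, E) ∞ M]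
    (hf : ContMDiff 𝓘(ℝ, E') 𝓘(ℝ, E) ∞ f) :
    tangentImage hf δ ⊆ tangentSet (knotsIn 𝓘(ℝ, E) (range f)) (δ.map hf) := by
  rintro _ ⟨g, X, hg, -, hX, rfl⟩
  refine ⟨fun u => ⟨(g u).1.map hf, (g u).2⟩, X, hf.comp hg, fun u => ?_, hX, rfl⟩
  rw [mk_mem_knotsIn_iff]
  exact fun t => ⟨_, rfl⟩

/-- A curve of knots in the image of an embedding lifts to a smooth family in `S`, so its velocity
is tangent to `f`. -/
theorem IsAdaptedTube.tangentSet_subset [IsManifold 𝓘(ℝ, E) ∞ M] [IsManifold 𝓘(ℝ, E') ∞ S]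
    (h : IsAdaptedTube E E' f δ.toFun A₁ A₂ Φ Ψ) (hf : IsImmersion 𝓘(ℝ, E') 𝓘(ℝ, E) ∞ f)
    (hemb : IsEmbedding f) :
    tangentSet (knotsIn 𝓘(ℝ, E) (range f)) (δ.map hf.contMDiff) ⊆
      h.tangentSubmodule hf.contMDiff := by
  rintro _ ⟨g, X, hg, hgL, hX, rfl⟩
  have hg' : ContMDiff 𝓘(ℝ, ℝ × ℝ) 𝓘(ℝ, E) ∞ fun q : ℝ × ℝ => (g q.1).1.toFun q.2 := hg
  obtain ⟨k, hk, hfk⟩ := exists_contMDiff_lift hf hemb hg' fun q =>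
    mk_mem_knotsIn_iff.1 (hgL q.1) q.2
  refine h.mkQ_mem_tangentSubmodule hf.contMDiff
    (exists_eq_mfderiv_of_hasInitialVelocity hf.contMDiff hX
      (c := fun u t => k (u, t)) (fun t => ?_) (fun u t => (hfk (u, t)).symm) (fun t => ?_))
  · have h2 : ContMDiff 𝓘(ℝ, ℝ) 𝓘(ℝ, ℝ × ℝ) ∞ fun u : ℝ => (u, t) :=
      ContDiff.contMDiff (by fun_prop)
    exact (hk.comp h2).contMDiffAt.mdifferentiableAt (by simp)
  · refine hemb.injective ((hfk (0, t)).trans ?_)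
    exact (congrArg Bundle.TotalSpace.proj (hX t)).symm

end LagrangianImmersions

/-! ### Existence of adapted tubes and the general statements -/

section AdaptedTubes

variable {F₁ : Type*} [NormedAddCommGroup F₁] [NormedSpace ℝ F₁] [FiniteDimensional ℝ F₁]
  {F₂ : Type*} [NormedAddCommGroup F₂] [NormedSpace ℝ F₂] [FiniteDimensional ℝ F₂]
  {E : Type*} [NormedAddCommGroup E] [NormedSpace ℝ E]
  {M : Type*} [TopologicalSpace M] [ChartedSpace E M]
  {E' : Type*} [NormedAddCommGroup E'] [NormedSpace ℝ E']
  {S : Type*} [TopologicalSpace S] [ChartedSpace E' S]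
  {f : S → M}

theorem velocity_ne_zero_of_mem_loopsOver {hf : ContMDiff 𝓘(ℝ, E') 𝓘(ℝ, E) ∞ f}
    {δ : Loop 𝓘(ℝ, E') S} (hδ : δ ∈ loopsOver hf) (t : ℝ) :
    mfderiv 𝓘(ℝ, ℝ) 𝓘(ℝ, E') δ.toFun t (1 : ℝ) ≠ 0 := by
  intro h0
  refine hδ.immersion t ?_
  have h1 := mfderiv_comp_apply t (hf.mdifferentiableAt (by simp))
    (δ.smooth.mdifferentiableAt (by simp) (x := t)) (1 : ℝ)
  exact h1.trans ((congrArg (mfderiv 𝓘(ℝ, E') 𝓘(ℝ, E) f (δ.toFun t)) h0).trans (map_zero _))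

theorem IsAdaptedTube.isLagrangianSubspace [IsManifold 𝓘(ℝ, E) ∞ M]
    {A₁ : F₁ ≃L[ℝ] F₁} {A₂ : F₂ ≃L[ℝ] F₂}
    {Φ : ℝ × F₁ × F₂ → M} {Ψ : ℝ × F₁ → S} {δ : Loop 𝓘(ℝ, E') S}
    (h : IsAdaptedTube E E' f δ.toFun A₁ A₂ Φ Ψ) (hf : ContMDiff 𝓘(ℝ, E') 𝓘(ℝ, E) ∞ f)
    (hdim : Module.finrank ℝ F₂ ≤ Module.finrank ℝ F₁)
    {lam : ∀ p : M, (TangentSpace 𝓘(ℝ, E) p) [⋀^Fin 3]→L[ℝ] ℝ} (hlam : IsG2Form 𝓘(ℝ, E) lam)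
    (hiso : ∀ (p : S) (a b c : TangentSpace 𝓘(ℝ, E') p),
      lam (f p) ![mfderiv 𝓘(ℝ, E') 𝓘(ℝ, E) f p a, mfderiv 𝓘(ℝ, E') 𝓘(ℝ, E) f p b,
        mfderiv 𝓘(ℝ, E') 𝓘(ℝ, E) f p c] = 0) :
    IsLagrangianSubspace lam (δ.map hf) (h.tangentSubmodule hf) := by
  refine isLagrangianSubspace_comap_normalEquiv hlam h.twist h.diffeo (h.map_toFun hf) hdim
    fun t a b c => ?_
  rw [h.diffAt_inclFst hf, h.diffAt_inclFst hf, h.diffAt_inclFst hf]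
  exact hiso (δ.toFun t) _ _ _

variable [FiniteDimensional ℝ E'] [FiniteDimensional ℝ E]

/-- Any space of the right dimension serves as a complement for an immersion. -/
theorem isImmersionAtOfComplement_of_finrank (hf : IsImmersion 𝓘(ℝ, E') 𝓘(ℝ, E) ∞ f)
    (hdim : Module.finrank ℝ E = Module.finrank ℝ E' + Module.finrank ℝ F₂) (p : S) :
    IsImmersionAtOfComplement F₂ 𝓘(ℝ, E') 𝓘(ℝ, E) ∞ f p := by
  have h := hf.isImmersionOfComplement_complement p
  have : FiniteDimensional ℝ hf.complement :=
    Module.Finite.of_injective ((h.equiv : (E' × hf.complement) →ₗ[ℝ] E) ∘ₗ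
      LinearMap.inr ℝ E' hf.complement) (h.equiv.injective.comp LinearMap.inr_injective)
  have h1 : Module.finrank ℝ hf.complement = Module.finrank ℝ F₂ := by
    have h2 := h.equiv.toLinearEquiv.finrank_eq
    rw [Module.finrank_prod] at h2
    omega
  exact h.trans_F (ContinuousLinearEquiv.ofFinrankEq h1)

variable (F₁ F₂) in
/-- Every loop that an immersion maps to a singular knot has an adapted tube. -/
theorem exists_isAdaptedTube (hf : IsImmersion 𝓘(ℝ, E') 𝓘(ℝ, E) ∞ f)
    (hdim₁ : Module.finrank ℝ E' = Module.finrank ℝ F₁ + 1)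
    (hdim₂ : Module.finrank ℝ E = Module.finrank ℝ E' + Module.finrank ℝ F₂)
    {δ : Loop 𝓘(ℝ, E') S} (hδ : δ ∈ loopsOver hf.contMDiff) :
    ∃ (A₁ : F₁ ≃L[ℝ] F₁) (A₂ : F₂ ≃L[ℝ] F₂) (Φ : ℝ × F₁ × F₂ → M) (Ψ : ℝ × F₁ → S),
      IsAdaptedTube E E' f δ.toFun A₁ A₂ Φ Ψ := by
  obtain ⟨A₁, A₂, Φ, Ψ, h1, h2, h3⟩ := exists_isTubeAt_periodic (F₁ := F₁) (F₂ := F₂) δ.periodic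
    fun t => exists_isTubeAt hdim₁ δ.smooth t (velocity_ne_zero_of_mem_loopsOver hδ t)
      (isImmersionAtOfComplement_of_finrank hf hdim₂ (δ.toFun t))
  exact ⟨A₁, A₂, Φ, Ψ, h1, h2, h3⟩

variable [IsManifold 𝓘(ℝ, E) ∞ M] [T2Space M]
  {lam : ∀ p : M, (TangentSpace 𝓘(ℝ, E) p) [⋀^Fin 3]→L[ℝ] ℝ}

variable (F₁ F₂) in
theorem isLagrangianImmersion_of_isImmersion (hf : IsImmersion 𝓘(ℝ, E') 𝓘(ℝ, E) ∞ f)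
    (hdim₁ : Module.finrank ℝ E' = Module.finrank ℝ F₁ + 1)
    (hdim₂ : Module.finrank ℝ E = Module.finrank ℝ E' + Module.finrank ℝ F₂)
    (hdim : Module.finrank ℝ F₂ ≤ Module.finrank ℝ F₁) (hlam : IsG2Form 𝓘(ℝ, E) lam)
    (hiso : ∀ (p : S) (a b c : TangentSpace 𝓘(ℝ, E') p),
      lam (f p) ![mfderiv 𝓘(ℝ, E') 𝓘(ℝ, E) f p a, mfderiv 𝓘(ℝ, E') 𝓘(ℝ, E) f p b,
        mfderiv 𝓘(ℝ, E') 𝓘(ℝ, E) f p c] = 0) :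
    IsLagrangianImmersion lam hf.contMDiff := by
  rintro ⟨δ, hδ⟩
  obtain ⟨A₁, A₂, Φ, Ψ, h⟩ := exists_isAdaptedTube F₁ F₂ hf hdim₁ hdim₂ hδ
  exact ⟨h.tangentSubmodule hf.contMDiff,
    (h.subset_tangentImage hδ).antisymm (h.tangentImage_subset hf.contMDiff),
    isSplit_comap_normalEquiv h.twist h.diffeo (h.map_toFun hf.contMDiff),
    h.isLagrangianSubspace hf.contMDiff hdim hlam hiso, h.exists_charts hδ⟩

variable (F₁ F₂) in
theorem isLagrangianSubmanifold_of_isEmbedding [IsManifold 𝓘(ℝ, E') ∞ S]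
    (hf : IsImmersion 𝓘(ℝ, E') 𝓘(ℝ, E) ∞ f) (hemb : IsEmbedding f)
    (hdim₁ : Module.finrank ℝ E' = Module.finrank ℝ F₁ + 1)
    (hdim₂ : Module.finrank ℝ E = Module.finrank ℝ E' + Module.finrank ℝ F₂)
    (hdim : Module.finrank ℝ F₂ ≤ Module.finrank ℝ F₁) (hlam : IsG2Form 𝓘(ℝ, E) lam)
    (hiso : ∀ (p : S) (a b c : TangentSpace 𝓘(ℝ, E') p),
      lam (f p) ![mfderiv 𝓘(ℝ, E') 𝓘(ℝ, E) f p a, mfderiv 𝓘(ℝ, E') 𝓘(ℝ, E) f p b,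
        mfderiv 𝓘(ℝ, E') 𝓘(ℝ, E) f p c] = 0) :
    IsLagrangianSubmanifold lam (knotsIn 𝓘(ℝ, E) (range f)) := by
  rintro ⟨γ, hγ⟩ hL
  obtain ⟨k, hk, hkf⟩ := exists_contMDiff_lift hf hemb γ.smooth (mk_mem_knotsIn_iff.1 hL)
  obtain ⟨δ, rfl⟩ : ∃ δ : Loop 𝓘(ℝ, E') S, δ.map hf.contMDiff = γ :=
    ⟨⟨k, hk, fun t => hemb.injective (by rw [hkf, hkf, γ.periodic t])⟩, Loop.ext_toFun hkf⟩
  obtain ⟨A₁, A₂, Φ, Ψ, h⟩ := exists_isAdaptedTube F₁ F₂ hf hdim₁ hdim₂ hγ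
  exact ⟨h.tangentSubmodule hf.contMDiff,
    ((h.subset_tangentImage hγ).trans (tangentImage_subset_tangentSet hf.contMDiff)).antisymm
      (h.tangentSet_subset hf hemb),
    isSplit_comap_normalEquiv h.twist h.diffeo (h.map_toFun hf.contMDiff),
    h.isLagrangianSubspace hf.contMDiff hdim hlam hiso, h.exists_slice_chart hγ hemb⟩

end AdaptedTubes

end

theorem mainTheorem5
    {M : Type*} [TopologicalSpace M] [T2Space M] [SecondCountableTopology M]
    [ChartedSpace (EuclideanSpace ℝ (Fin 7)) M] [IsManifold (𝓡 7) ∞ M]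
    {S : Type*} [TopologicalSpace S] [T2Space S] [SecondCountableTopology S]
    [ChartedSpace (EuclideanSpace ℝ (Fin 4)) S] [IsManifold (𝓡 4) ∞ S]
    (lam : ∀ p : M, (TangentSpace (𝓡 7) p) [⋀^Fin 3]→L[ℝ] ℝ) (hlam : IsG2Form (𝓡 7) lam)
    (f : S → M) (hf : IsImmersion (𝓡 4) (𝓡 7) ∞ f)
    (hiso : ∀ (p : S) (a b c : TangentSpace (𝓡 4) p),
      lam (f p) ![mfderiv (𝓡 4) (𝓡 7) f p a, mfderiv (𝓡 4) (𝓡 7) f p b,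
        mfderiv (𝓡 4) (𝓡 7) f p c] = 0) :
    IsLagrangianImmersion lam hf.contMDiff ∧
      (IsEmbedding f → IsLagrangianSubmanifold lam (knotsIn (𝓡 7) (range f))) := by
  -- Both fibres are `ℝ³`: the normal space of a loop in `S` has dimension `4 - 1`, that of `S` in
  -- `M` has dimension `7 - 4`, and their equality is what makes the isotropic subspace maximal.
  have hdim₁ : Module.finrank ℝ (EuclideanSpace ℝ (Fin 4)) =
      Module.finrank ℝ (EuclideanSpace ℝ (Fin 3)) + 1 := by simp
  have hdim₂ : Module.finrank ℝ (EuclideanSpace ℝ (Fin 7)) =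
      Module.finrank ℝ (EuclideanSpace ℝ (Fin 4)) +
        Module.finrank ℝ (EuclideanSpace ℝ (Fin 3)) := by simp
  exact ⟨isLagrangianImmersion_of_isImmersion _ _ hf hdim₁ hdim₂ le_rfl hlam hiso, fun hemb =>
    isLagrangianSubmanifold_of_isEmbedding _ _ hf hemb hdim₁ hdim₂ le_rfl hlam hiso⟩
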